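/- Let $n \ge 1$, and let $g = -dt^2 + (dx^1)^2 + \dots + (dx^n)^2$ be the Minkowski metric on $\mathbb{R}^{1+n}$, with coordinates $(t,x) \in \mathbb{R} \times \mathbb{R}^n$ and wave operator $\Box = -\partial_t^2 + \partial_{x^1}^2 + \dots + \partial_{x^n}^2$. A set $\mathcal{U} \subseteq \mathbb{R}^{1+n}$ is a *generalized timelike cylinder* (GTC) if: (i) its boundary $\partial\mathcal{U}$ is a smooth timelike hypersurface of $\mathbb{R}^{1+n}$, with $\mathcal{U}$ lying locally on one side of it (that is, near each boundary point $\mathcal{U} = \{\rho < 0\}$ for a smooth function $\rho$ with $d\rho \neq 0$, and the normals of $\partial\mathcal{U}$ are spacelike); (ii) for every $\tau \in \mathbb{R}$, the slice $\Omega_\tau = \{ y \in \mathbb{R}^n : (\tau,y) \in \mathcal{U} \}$ is nonempty, bounded and open; (iii) there is a smooth future-directed timelike vector field $Z$ on $\bar{\mathcal{U}}$ that is tangent to $\partial\mathcal{U}$ along $\partial\mathcal{U}$. Let $\mathcal{N}$ denote the outward-pointing $g$-unit normal to $\partial\mathcal{U}$, write $\mathcal{U}_\tau = \mathcal{U} \cap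 \{t = \tau\}$, and for $P = (t_0,x_0)$ let $f_P(t,x) = \tfrac14 ( |x-x_0|^2 - (t-t_0)^2 )$. **Theorem.** Let $\mathcal{U}$ be a GTC in $\mathbb{R}^{1+n}$, let $x_0 \in \mathbb{R}^n$, and let $\tau_- < \tau_+$ satisfy $$ \tau_+ - \tau_- > R_+ + R_- , \qquad R_\pm := \sup_{(\tau_\pm, y) \in \partial\mathcal{U}} |y - x_0| . $$ Let $t_0 \in (\tau_-, \tau_+)$ be such that $\tau_+ - t_0 > R_+$ and $t_0 - \tau_- > R_-$, and put $P = (t_0,x_0)$. Then there is a constant $C > 0$, depending only on $\mathcal{U}$, $(t_0,x_0)$ and $\tau_+ - \tau_-$, such that every $\phi \in C^\infty(\bar{\mathcal{U}})$ with $\Box\phi = 0$ on $\mathcal{U}$ and $\phi = 0$ on $\partial\mathcal{U}$ satisfies both estimates $$ \int_{\mathcal{U}_{\tau_+}} \Big( (\partial_t\phi)^2 + \sum_{i=1}^n (\partial_{x^i}\phi)^2 + \phi^2 \Big) \le C \int_{\Gamma_*} |\mathcal{N}\phi|^2 , \qquad \int_{\mathcal{U}_{\tau_-}} \Big( (\partial_t\phi)^2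 + \sum_{i=1}^n (\partial_{x^i}\phi)^2 + \phi^2 \Big) \le C \int_{\Gamma_*} |\mathcal{N}\phi|^2 , $$ where $$ \Gamma_* := \{ (\tau,y) \in \partial\mathcal{U} : \tau_- < \tau < \tau_+ , \ \mathcal{N} f_P|_{(\tau,y)} > 0 \} , $$ and where the integrals over $\mathcal{U}_{\tau_\pm}$ and $\Gamma_*$ are taken with respect to the volume measures induced by $g$. -/

import Mathlib

open Set MeasureTheory
open scoped ContDiff ENNReal NNReal

noncomputable section

/-- The space `ℝ^{1+n}`; a point is a pair `(t, x)`. The product topology and smooth structure are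
used; the (sup) norm of the product plays no role. -/
abbrev Spacetime (n : ℕ) : Type := ℝ × EuclideanSpace ℝ (Fin n)

namespace Spacetime

variable {n : ℕ}

/-- The coordinate vector `∂_t`. -/
def eT : Spacetime n := (1, 0)

/-- The coordinate vector `∂_{x^i}`. -/
def eX (i : Fin n) : Spacetime n := (0, EuclideanSpace.single i 1)

/-- The Minkowski metric `g = -dt² + (dx¹)² + ⋯ + (dxⁿ)²`. -/
def mink (v w : Spacetime n) : ℝ := -(v.1 * w.1) + inner ℝ v.2 w.2

/-- The vector of partial derivatives `(∂_t h, ∂_{x^1} h, …, ∂_{x^n} h)` at `p`. -/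
def grad (h : Spacetime n → ℝ) (p : Spacetime n) : Spacetime n :=
  (fderiv ℝ h p eT, WithLp.toLp 2 fun i => fderiv ℝ h p (eX i))

/-- `|∇_{t,x} h|² = (∂_t h)² + (∂_{x^1} h)² + ⋯ + (∂_{x^n} h)²`. -/
def gradSq (h : Spacetime n → ℝ) (p : Spacetime n) : ℝ :=
  (fderiv ℝ h p eT) ^ 2 + ∑ i, (fderiv ℝ h p (eX i)) ^ 2

/-- The wave operator `□ h = -∂_t² h + ∂_{x^1}² h + ⋯ + ∂_{x^n}² h`. -/
def box (h : Spacetime n → ℝ) (p : Spacetime n) : ℝ :=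
  -(fderiv ℝ (fderiv ℝ h) p eT eT) + ∑ i, fderiv ℝ (fderiv ℝ h) p (eX i) (eX i)

/-- The shifted hyperbolic function `f_P = (|x - x(P)|² - (t - t(P))²) / 4`. -/
def hyp (P q : Spacetime n) : ℝ := (‖q.2 - P.2‖ ^ 2 - (q.1 - P.1) ^ 2) / 4

/-- `ρ` is a smooth defining function of `U` near the boundary point `p`: near `p` it is smooth,
it has non-vanishing differential at its zero `p`, and `U` is the set where it is negative. -/
def IsDefiningFunctionAt (U : Set (Spacetime n)) (p : Spacetime n) (ρ : Spacetime n → ℝ) : Prop :=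
  ρ p = 0 ∧ fderiv ℝ ρ p ≠ 0 ∧
    ∃ W : Set (Spacetime n), IsOpen W ∧ p ∈ W ∧ ContDiffOn ℝ ∞ ρ W ∧
      U ∩ W = {q | q ∈ W ∧ ρ q < 0}

/-- The time slice `Ω_τ = {y | (τ, y) ∈ U}`. -/
def slice (U : Set (Spacetime n)) (τ : ℝ) : Set (EuclideanSpace ℝ (Fin n)) := {y | (τ, y) ∈ U}

/-- `Z` is a generator of `U`: a smooth future-directed timelike vector field on the closure of `U`
that is tangent to the boundary of `U`. -/
structure IsGenerator (U : Set (Spacetime n)) (Z : Spacetime n → Spacetime n) : Prop where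
  smooth : ContDiffOn ℝ ∞ Z (closure U)
  timelike : ∀ p ∈ closure U, mink (Z p) (Z p) < 0
  future : ∀ p ∈ closure U, 0 < (Z p).1
  tangent : ∀ p ∈ frontier U, ∀ ρ, IsDefiningFunctionAt U p ρ → fderiv ℝ ρ p (Z p) = 0

/-- Generalized timelike cylinders. The boundary is a smooth hypersurface with `U` on one side of
it, and it is timelike: its normals are spacelike, i.e. `g⁻¹(dρ, dρ) > 0` for the differential of a
defining function `ρ`. (On covectors the inverse metric has the same expression as `g`.) -/
structure IsGTC (U : Set (Spacetime n)) : Prop where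
  smooth_boundary : ∀ p ∈ frontier U, ∃ ρ, IsDefiningFunctionAt U p ρ
  timelike_boundary : ∀ p ∈ frontier U, ∀ ρ, IsDefiningFunctionAt U p ρ →
    0 < mink (grad ρ p) (grad ρ p)
  slice_nonempty : ∀ τ, (slice U τ).Nonempty
  slice_bounded : ∀ τ, Bornology.IsBounded (slice U τ)
  slice_open : ∀ τ, IsOpen (slice U τ)
  generator : ∃ Z, IsGenerator U Z

open Classical in
/-- The Euclidean outer unit normal of `U` at the boundary point `p`: the normalized Euclidean
gradient of a defining function (any two of them have positively proportional gradients at `p`). -/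
def euclNormal (U : Set (Spacetime n)) (p : Spacetime n) : Spacetime n :=
  if h : ∃ ρ, IsDefiningFunctionAt U p ρ then
    (√((grad h.choose p).1 ^ 2 + ‖(grad h.choose p).2‖ ^ 2))⁻¹ • grad h.choose p
  else 0

/-- The Minkowski outer unit normal `𝒩` of `U`: the metric dual `(-ν^t, ν^x)` of the Euclidean outer
normal `(ν^t, ν^x)`, rescaled so that `g(𝒩, 𝒩) = 1`. -/
def minkNormal (U : Set (Spacetime n)) (p : Spacetime n) : Spacetime n :=
  (√(mink (euclNormal U p) (euclNormal U p)))⁻¹ • (-(euclNormal U p).1, (euclNormal U p).2)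

/-- The `n`-dimensional surface measure for the Euclidean metric of `ℝ^{1+n}`. -/
def euclSurfaceMeasure (n : ℕ) : Measure (Spacetime n) :=
  Measure.map WithLp.ofLp
    (Measure.euclideanHausdorffMeasure n : Measure (WithLp 2 (Spacetime n)))

/-- The integral of a nonnegative function `h` over a subset `Γ` of the boundary of `U`, with respect
to the volume measure of the metric that the Minkowski metric induces on the boundary. That measure
has density `√(g(ν, ν))` with respect to the Euclidean surface measure, where `ν` is the Euclidean
unit normal. -/
def boundaryIntegral (U Γ : Set (Spacetime n)) (h : Spacetime n → ℝ) : ℝ≥0∞ :=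
  ∫⁻ p in Γ, ENNReal.ofReal (h p * √(mink (euclNormal U p) (euclNormal U p)))
    ∂(euclSurfaceMeasure n)

/-- `∫_{U_τ} (|∇_{t,x} φ|² + φ²)`. -/
def sliceEnergy (U : Set (Spacetime n)) (φ : Spacetime n → ℝ) (τ : ℝ) : ℝ≥0∞ :=
  ∫⁻ y in slice U τ, ENNReal.ofReal (gradSq φ (τ, y) + φ (τ, y) ^ 2)

/-- The derivative `𝒩φ` at a boundary point, of a function `φ` that is smooth on the closure. -/
def normalDeriv (U : Set (Spacetime n)) (φ : Spacetime n → ℝ) (p : Spacetime n) : ℝ :=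
  fderivWithin ℝ φ (closure U) p (minkNormal U p)

/-- `sup {|y - x₀| : (τ, y) ∈ ∂U}`. -/
def boundaryRadius (U : Set (Spacetime n)) (x₀ : EuclideanSpace ℝ (Fin n)) (τ : ℝ) : ℝ :=
  sSup ((fun y => ‖y - x₀‖) '' {y | (τ, y) ∈ frontier U})

/-- `Γ_* = {(τ, y) ∈ ∂U : τ₋ < τ < τ₊, 𝒩 f_P > 0}`. -/
def observationRegion (U : Set (Spacetime n)) (P : Spacetime n) (τm τp : ℝ) : Set (Spacetime n) :=
  {p | p ∈ frontier U ∧ τm < p.1 ∧ p.1 < τp ∧ 0 < fderiv ℝ (hyp P) p (minkNormal U p)}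

end Spacetime

end

/-! The proof is a multiplier argument. Let `S = (t - t₀)∂_t + (x - x₀)·∂_x` be the scaling field
centred at `P` (`scaling`), and test the wave equation with `Sφ + wφ`, `w = (n - 1)/2`. For this
weight the energy current is divergence free (`IsGTC.currentDiv_scaling`). As `φ` vanishes on the
boundary, `dφ` is conormal there, and the inward flux of the current is a positive density times
`(S·ν)|𝒩φ|²`, where `ν` is the Euclidean normal (`IsGTC.edot_current`). Since `S` is twice the
metric gradient of `f_P`, the sign of `S·ν` is that of `𝒩f_P`, so only `Γ_*` contributes positively.
Hence `I(τ₊) - I(τ₋) ≤ C ∫_{Γ_*} |𝒩φ|²`, where `I(t)` is the slice integral of the time component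
(`IsGTC.exists_scaling_flux_le`).

On a slice, `I(t) = (t - t₀)E(t) + ∫ ∂_tφ ((x - x₀)·∇φ + wφ)`, with `E` the energy. The virial
identity `∫ (nφ² + 2φ (x - x₀)·∇φ) = 0` (`IsGTC.sliceInt_virial`) bounds the last integral by `R
E(t)` if `|x - x₀| ≤ R` on the slice (`IsGTC.abs_sliceInt_scaling_sub_le`). So `I(τ₊) - I(τ₋)`
dominates `(τ₊ - t₀ - R₊)E(τ₊) + (t₀ - τ₋ - R₋)E(τ₋)`, and both gaps are positive. The virial
identity also yields the Poincaré inequality needed for the `φ²` term (`IsGTC.sliceEnergy_le`).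

The constant must depend on `τ±` only through their difference. Because the boundary is timelike,
the boundary radius is 1-Lipschitz in time (`IsGTC.boundaryRadius_le_add`); so, for a fixed
difference, one of the two gaps is at least the smaller gap of a reference pair. One gap is enough,
since the energies at both ends are comparable: the current of the generator has no boundary flux,
and Gronwall applies (`IsGTC.exists_energy_comparison`).

Much of the file proves the divergence theorem in the weak form that is used: the inward flux is at
most a constant times a surface integral (`IsGTC.exists_flux_bound`, `IsGTC.exists_slab_bound`).
This needs no area formula, only that the surface measure of a graph dominates the Lebesgue measure
of its projection. -/

namespace Spacetime

/-! ### Defining functions and the Euclidean normal. -/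

open Filter Topology

variable {n : ℕ} {U : Set (Spacetime n)} {p : Spacetime n} {ρ : Spacetime n → ℝ}

/-- The Euclidean inner product of `ℝ^{1+n}`. -/
noncomputable def edot (v w : Spacetime n) : ℝ := v.1 * w.1 + inner ℝ v.2 w.2

lemma edot_comm (v w : Spacetime n) : edot v w = edot w v := by
  simp only [edot, real_inner_comm, mul_comm]

lemma edot_smul_right (c : ℝ) (v w : Spacetime n) : edot v (c • w) = c * edot v w := by
  simp only [edot, Prod.smul_fst, Prod.smul_snd, inner_smul_right, smul_eq_mul]; ring

lemma edot_self (v : Spacetime n) : edot v v = v.1 ^ 2 + ‖v.2‖ ^ 2 := by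
  simp only [edot, real_inner_self_eq_norm_sq]; ring

lemma eq_sum_coord (v : Spacetime n) : v = v.1 • eT + ∑ i, v.2 i • eX i := by
  ext1
  · simp [eT, eX, Prod.fst_sum]
  · ext j
    simp [eT, eX, Prod.snd_sum, Pi.single_apply]

lemma clm_apply_eq_sum (A : Spacetime n →L[ℝ] ℝ) (v : Spacetime n) :
    A v = v.1 * A eT + ∑ i, v.2 i * A (eX i) := by
  conv_lhs => rw [eq_sum_coord v]
  simp [map_sum]

lemma edot_grad (h : Spacetime n → ℝ) (p v : Spacetime n) :
    edot v (grad h p) = fderiv ℝ h p v := by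
  rw [clm_apply_eq_sum]
  simp [edot, grad, PiLp.inner_apply, mul_comm]

lemma eventually_neg_of_hasFDerivAt {E : Type*} [NormedAddCommGroup E] [NormedSpace ℝ E]
    {f : E → ℝ} {f' : E →L[ℝ] ℝ} {p v : E} (hf : HasFDerivAt f f' p) (h0 : f p = 0)
    (hv : f' v < 0) : ∀ᶠ s in 𝓝[>] (0 : ℝ), f (p + s • v) < 0 := by
  have h1 : Tendsto (fun s : ℝ => s⁻¹ • (f (p + s • v) - f p)) (𝓝[≠] 0) (𝓝 (f' v)) := by
    have := (hf.hasLineDerivAt v)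
    simpa using this.tendsto_slope_zero
  have h2 := (h1.mono_left (nhdsWithin_mono _ (fun x hx => ne_of_gt hx))).eventually
    (gt_mem_nhds hv)
  filter_upwards [h2, self_mem_nhdsWithin] with s hs hs0
  rw [h0, sub_zero, smul_eq_mul] at hs
  have hs0 : 0 < s := hs0
  by_contra hc
  exact absurd hs (not_lt.2 (mul_nonneg (inv_nonneg.2 hs0.le) (not_lt.1 hc)))

namespace IsDefiningFunctionAt

lemma contDiffAt (h : IsDefiningFunctionAt U p ρ) : ContDiffAt ℝ ∞ ρ p := by
  obtain ⟨-, -, W, hW, hp, hs, -⟩ := h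
  exact hs.contDiffAt (hW.mem_nhds hp)

lemma hasFDerivAt (h : IsDefiningFunctionAt U p ρ) : HasFDerivAt ρ (fderiv ℝ ρ p) p :=
  (h.contDiffAt.differentiableAt (by simp)).hasFDerivAt

lemma eventually_mem_iff (h : IsDefiningFunctionAt U p ρ) : ∀ᶠ q in 𝓝 p, (q ∈ U ↔ ρ q < 0) := by
  obtain ⟨-, -, W, hW, hp, -, hUW⟩ := h
  filter_upwards [hW.mem_nhds hp] with q hq
  have := Set.ext_iff.1 hUW q
  simpa [hq] using this

lemma notMem (h : IsDefiningFunctionAt U p ρ) : p ∉ U := by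
  rw [h.eventually_mem_iff.self_of_nhds, h.1]; exact lt_irrefl _

lemma tendsto_add_smul (p v : Spacetime n) :
    Tendsto (fun s : ℝ => p + s • v) (𝓝[>] 0) (𝓝 p) := by
  have : Continuous (fun s : ℝ => p + s • v) := by fun_prop
  simpa using (this.tendsto 0).mono_left nhdsWithin_le_nhds

lemma eventually_mem (h : IsDefiningFunctionAt U p ρ) {v : Spacetime n}
    (hv : fderiv ℝ ρ p v < 0) : ∀ᶠ s in 𝓝[>] (0 : ℝ), p + s • v ∈ U := by
  filter_upwards [(tendsto_add_smul p v).eventually h.eventually_mem_iff,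
    eventually_neg_of_hasFDerivAt h.hasFDerivAt h.1 hv] with s h1 h2
  exact h1.2 h2

lemma eventually_notMem (h : IsDefiningFunctionAt U p ρ) {v : Spacetime n}
    (hv : 0 < fderiv ℝ ρ p v) : ∀ᶠ s in 𝓝[>] (0 : ℝ), p + s • v ∉ U := by
  have h1 : HasFDerivAt (fun q => -ρ q) (-fderiv ℝ ρ p) p := h.hasFDerivAt.neg
  have h2 := eventually_neg_of_hasFDerivAt (v := v) h1 (by simp [h.1]) (by simpa using hv)
  filter_upwards [(tendsto_add_smul p v).eventually h.eventually_mem_iff, h2] with s h1 h2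
  rw [h1]; linarith

lemma exists_neg (h : IsDefiningFunctionAt U p ρ) : ∃ v, fderiv ℝ ρ p v < 0 := by
  obtain ⟨v, hv⟩ : ∃ v, fderiv ℝ ρ p v ≠ 0 := by
    by_contra! hc
    exact h.2.1 (ContinuousLinearMap.ext hc)
  rcases lt_or_gt_of_ne hv with h1 | h1
  · exact ⟨v, h1⟩
  · exact ⟨-v, by simpa using h1⟩

lemma mem_closure (h : IsDefiningFunctionAt U p ρ) : p ∈ closure U := by
  obtain ⟨v, hv⟩ := h.exists_neg
  exact mem_closure_of_tendsto (tendsto_add_smul p v) (h.eventually_mem hv)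

lemma mem_frontier (h : IsDefiningFunctionAt U p ρ) : p ∈ frontier U :=
  ⟨h.mem_closure, fun hi => h.notMem (interior_subset hi)⟩

/-- A defining function at `p` is one at all nearby zeros. -/
lemma eventually_isDefiningFunctionAt (h : IsDefiningFunctionAt U p ρ) :
    ∀ᶠ q in 𝓝 p, ρ q = 0 → IsDefiningFunctionAt U q ρ := by
  have hc : ContinuousAt (fderiv ℝ ρ) p :=
    (h.contDiffAt.fderiv_right (m := 0) (by norm_cast)).continuousAt
  have h0 := hc.eventually_ne h.2.1
  obtain ⟨-, -, W, hW, hp, hs, hUW⟩ := h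
  filter_upwards [h0, hW.mem_nhds hp] with q h1 h2 h3
  exact ⟨h3, h1, W, hW, h2, hs, hUW⟩

/-- The tangent cone contains the open half-space of inward directions, which spans. This makes
`fderivWithin` on `closure U` well determined at the boundary. -/
lemma uniqueDiffWithinAt (h : IsDefiningFunctionAt U p ρ) :
    UniqueDiffWithinAt ℝ (closure U) p := by
  refine ⟨?_, subset_closure h.mem_closure⟩
  have hsub : {v | fderiv ℝ ρ p v < 0} ⊆ tangentConeAt ℝ (closure U) p := by
    intro v hv
    refine mem_tangentConeAt_of_add_smul_mem (l := 𝓝[>] (0 : ℝ)) (c := id) ?_ ?_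
    · exact tendsto_id.mono_left (nhdsWithin_mono _ fun x hx => ne_of_gt hx)
    · exact (h.eventually_mem hv).mono fun s hs => subset_closure hs
  have hop : IsOpen {v | fderiv ℝ ρ p v < 0} :=
    isOpen_lt (fderiv ℝ ρ p).continuous continuous_const
  have htop : Submodule.span ℝ (tangentConeAt ℝ (closure U) p) = ⊤ := by
    refine Submodule.eq_top_of_nonempty_interior' _ ?_
    obtain ⟨v, hv⟩ := h.exists_neg
    exact ⟨v, mem_interior.2 ⟨_, hsub.trans Submodule.subset_span, hop, hv⟩⟩
  rw [htop]; exact dense_univ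

/-- Two defining functions at `p` have positively proportional differentials. -/
lemma exists_fderiv_eq (h : IsDefiningFunctionAt U p ρ) {ρ' : Spacetime n → ℝ}
    (h' : IsDefiningFunctionAt U p ρ') :
    ∃ c : ℝ, 0 < c ∧ ∀ v, fderiv ℝ ρ' p v = c * fderiv ℝ ρ p v := by
  set A := fderiv ℝ ρ p with hA
  set B := fderiv ℝ ρ' p with hB
  -- A direction that enters `U` to first order for one function cannot leave it for the other.
  have key : ∀ v, A v < 0 → B v ≤ 0 := by
    intro v hv
    by_contra! hc
    obtain ⟨s, hs⟩ := ((h.eventually_mem hv).and (h'.eventually_notMem hc)).exists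
    exact hs.2 hs.1
  obtain ⟨v₀, hv₀⟩ := h.exists_neg
  have hker : ∀ v, A v = 0 → B v = 0 := by
    intro v hv
    have hle : ∀ u, A u = 0 → B u ≤ 0 := by
      intro u hu
      by_contra! hc
      -- The added multiple of `u` leaves `A` negative, while its coefficient makes the value of `B`
      -- equal to `B v₀ + 1 + |B v₀|`, which is positive.
      have := key (v₀ + ((1 + |B v₀|) / B u) • u) (by simp [hu]; exact hv₀)
      rw [map_add, map_smul, smul_eq_mul, div_mul_cancel₀ _ hc.ne'] at this
      linarith [neg_abs_le (B v₀)]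
    refine le_antisymm (hle v hv) ?_
    have := hle (-v) (by simp [hv])
    simpa using this
  have hform : ∀ v, B v = (B v₀ / A v₀) * A v := by
    intro v
    have h1 := hker (v - (A v / A v₀) • v₀) (by
      rw [map_sub, map_smul, smul_eq_mul, div_mul_cancel₀ _ (ne_of_lt hv₀), sub_self])
    rw [map_sub, map_smul, smul_eq_mul, sub_eq_zero] at h1
    rw [h1]; ring
  refine ⟨B v₀ / A v₀, ?_, hform⟩
  refine lt_of_le_of_ne (div_nonneg_of_nonpos (key v₀ hv₀) hv₀.le) fun h0 => ?_
  refine h'.2.1 (ContinuousLinearMap.ext fun v => ?_)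
  show B v = 0
  rw [hform, ← h0, zero_mul]

lemma edot_grad_self_pos (h : IsDefiningFunctionAt U p ρ) :
    0 < edot (grad ρ p) (grad ρ p) := by
  refine lt_of_le_of_ne (by rw [edot_self]; positivity) fun h0 => ?_
  rw [edot_self] at h0
  have h1 : (grad ρ p).1 = 0 := by
    have : (grad ρ p).1 ^ 2 = 0 := by nlinarith [sq_nonneg (grad ρ p).1, sq_nonneg ‖(grad ρ p).2‖]
    exact pow_eq_zero_iff (by simp) |>.1 this
  have h2 : (grad ρ p).2 = 0 := by
    have : ‖(grad ρ p).2‖ ^ 2 = 0 := by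
      nlinarith [sq_nonneg (grad ρ p).1, sq_nonneg ‖(grad ρ p).2‖]
    exact norm_eq_zero.1 (pow_eq_zero_iff (by simp) |>.1 this)
  refine h.2.1 (ContinuousLinearMap.ext fun v => ?_)
  rw [← edot_grad]; simp [edot, h1, h2]

lemma edot_euclNormal_self (h : IsDefiningFunctionAt U p ρ) :
    edot (euclNormal U p) (euclNormal U p) = 1 := by
  have hex : ∃ ρ, IsDefiningFunctionAt U p ρ := ⟨ρ, h⟩
  have hpos := hex.choose_spec.edot_grad_self_pos
  rw [euclNormal, dif_pos hex, edot_smul_right, edot_comm, edot_smul_right, ← edot_self,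
    ← mul_assoc, ← mul_inv, Real.mul_self_sqrt hpos.le, inv_mul_cancel₀ (ne_of_gt hpos)]

/-- The differential of a defining function is a positive multiple of the pairing with the
Euclidean normal. -/
lemma exists_fderiv_eq_edot (h : IsDefiningFunctionAt U p ρ) :
    ∃ c : ℝ, 0 < c ∧ ∀ v, fderiv ℝ ρ p v = c * edot v (euclNormal U p) := by
  have hex : ∃ ρ, IsDefiningFunctionAt U p ρ := ⟨ρ, h⟩
  have hpos := hex.choose_spec.edot_grad_self_pos
  obtain ⟨c, hc, hcv⟩ := hex.choose_spec.exists_fderiv_eq h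
  refine ⟨c * √(edot (grad hex.choose p) (grad hex.choose p)),
    mul_pos hc (Real.sqrt_pos.2 hpos), fun v => ?_⟩
  rw [euclNormal, dif_pos hex, edot_smul_right, ← edot_self, hcv, mul_assoc,
    ← mul_assoc (√_), mul_inv_cancel₀ (Real.sqrt_pos.2 hpos).ne', one_mul, edot_grad]

end IsDefiningFunctionAt

namespace IsGTC

/-- Openness is assumed for the slices only. It passes to `U` because a defining function is zero,
hence not negative, at its boundary point. -/
lemma isOpen (hU : IsGTC U) : IsOpen U := by
  rw [← disjoint_frontier_iff_isOpen, Set.disjoint_left]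
  intro p hp hpU
  obtain ⟨ρ, hρ⟩ := hU.smooth_boundary p hp
  exact hρ.notMem hpU

lemma mem_frontier_iff (hU : IsGTC U) : p ∈ frontier U ↔ p ∈ closure U ∧ p ∉ U := by
  rw [hU.isOpen.frontier_eq]; rfl

lemma uniqueDiffOn (hU : IsGTC U) : UniqueDiffOn ℝ (closure U) := by
  intro p hp
  by_cases hpU : p ∈ U
  · exact (hU.isOpen.uniqueDiffWithinAt hpU).mono subset_closure
  · obtain ⟨ρ, hρ⟩ := hU.smooth_boundary p (hU.mem_frontier_iff.2 ⟨hp, hpU⟩)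
    exact hρ.uniqueDiffWithinAt

/-- The spatial gradient of a defining function dominates its time derivative. -/
lemma abs_grad_fst_lt (hU : IsGTC U) (h : IsDefiningFunctionAt U p ρ) :
    |(grad ρ p).1| < ‖(grad ρ p).2‖ := by
  have := hU.timelike_boundary p h.mem_frontier ρ h
  rw [mink, real_inner_self_eq_norm_sq] at this
  exact abs_lt_of_sq_lt_sq (by nlinarith) (norm_nonneg _)

end IsGTC

end Spacetime

/-! ### Slices, the boundary radius and compactness of time slabs. -/

namespace Spacetime

open Filter Topology

variable {n : ℕ} {U : Set (Spacetime n)}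

namespace IsGTC

/-- The boundary is timelike, so the gradient has a nonzero spatial part `g.2`, and the purely
spatial direction `(0, -g.2)` enters `U`. -/
lemma mem_closure_slice (hU : IsGTC U) {τ : ℝ} {y : EuclideanSpace ℝ (Fin n)}
    (hy : (τ, y) ∈ closure U) : y ∈ closure (slice U τ) := by
  by_cases hyU : (τ, y) ∈ U
  · exact subset_closure hyU
  · obtain ⟨ρ, hρ⟩ := hU.smooth_boundary _ (hU.mem_frontier_iff.2 ⟨hy, hyU⟩)
    set g := grad ρ (τ, y) with hg
    have hlt : 0 < ‖g.2‖ := (abs_nonneg _).trans_lt (hU.abs_grad_fst_lt hρ)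
    have h1 : fderiv ℝ ρ (τ, y) (0, -g.2) < 0 := by
      rw [← edot_grad, edot, ← hg]
      simp only [zero_mul, inner_neg_left, real_inner_self_eq_norm_sq, zero_add]
      nlinarith
    have h2 := hρ.eventually_mem h1
    have h3 : Tendsto (fun s : ℝ => y + s • (-g.2)) (𝓝[>] 0) (𝓝 y) := by
      have : Continuous (fun s : ℝ => y + s • (-g.2)) := by fun_prop
      simpa using (this.tendsto 0).mono_left nhdsWithin_le_nhds
    refine mem_closure_of_tendsto h3 (h2.mono fun s hs => ?_)
    simpa [slice] using hs

/-- From a point of the closure one can move, in both time directions, inside the closure at speed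
at most one. -/
lemma exists_mem_closure_of_mem_closure (hU : IsGTC U) {τ : ℝ} {y : EuclideanSpace ℝ (Fin n)}
    (hy : (τ, y) ∈ closure U) (τ' : ℝ) :
    ∃ y', (τ', y') ∈ closure U ∧ ‖y' - y‖ ≤ |τ' - τ| := by
  obtain ⟨σ, r₁, hσ, hr₁, hτ'⟩ : ∃ σ r₁ : ℝ, |σ| = 1 ∧ 0 ≤ r₁ ∧ τ' = τ + σ * r₁ := by
    rcases le_total τ τ' with h | h
    · exact ⟨1, τ' - τ, by simp, by linarith, by ring⟩
    · exact ⟨-1, τ - τ', by simp, by linarith, by ring⟩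
  have habs : |τ' - τ| = r₁ := by rw [hτ', add_sub_cancel_left, abs_mul, hσ, one_mul,
    abs_of_nonneg hr₁]
  -- Continuous induction on the elapsed time `r`: the reachable times form a closed set that can be
  -- continued to the right of each of its points.
  set S : Set ℝ := {r | ∃ y', (τ + σ * r, y') ∈ closure U ∧ ‖y' - y‖ ≤ r} with hS
  suffices Icc 0 r₁ ⊆ S by
    obtain ⟨y', h1, h2⟩ := this (right_mem_Icc.2 hr₁)
    exact ⟨y', hτ' ▸ h1, habs ▸ h2⟩
  refine IsClosed.Icc_subset_of_forall_exists_gt ?_ ?_ ?_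
  · have hK : IsCompact ((Icc 0 r₁ ×ˢ Metric.closedBall y r₁) ∩
        {q : ℝ × EuclideanSpace ℝ (Fin n) | (τ + σ * q.1, q.2) ∈ closure U ∧ ‖q.2 - y‖ ≤ q.1}) := by
      refine (isCompact_Icc.prod (isCompact_closedBall y r₁)).inter_right (IsClosed.inter ?_ ?_)
      · exact isClosed_closure.preimage (by fun_prop :
          Continuous fun q : ℝ × EuclideanSpace ℝ (Fin n) => (τ + σ * q.1, q.2))
      · exact isClosed_le ((continuous_snd.sub continuous_const).norm) continuous_fst
    convert (hK.image continuous_fst).isClosed using 1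
    ext r
    simp only [hS, mem_inter_iff, mem_ofPred_eq, mem_image, mem_prod, Metric.mem_closedBall,
      dist_eq_norm, Prod.exists]
    constructor
    · rintro ⟨⟨y', h1, h2⟩, h3⟩
      exact ⟨r, y', ⟨⟨h3, h2.trans h3.2⟩, h1, h2⟩, rfl⟩
    · rintro ⟨r', y', ⟨⟨h3, -⟩, h1, h2⟩, rfl⟩
      exact ⟨⟨y', h1, h2⟩, h3⟩
  · exact ⟨y, by simpa using hy, by simp⟩
  · rintro r ⟨⟨y', h1, h2⟩, -⟩ r' hr'
    obtain ⟨w, hw, hev⟩ : ∃ w : EuclideanSpace ℝ (Fin n), ‖w‖ ≤ 1 ∧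
        ∀ᶠ s in 𝓝[>] (0 : ℝ), (τ + σ * r, y') + s • ((σ, w) : Spacetime n) ∈ U := by
      by_cases hyU : (τ + σ * r, y') ∈ U
      · refine ⟨0, by simp, ?_⟩
        exact (IsDefiningFunctionAt.tendsto_add_smul _ _).eventually (hU.isOpen.mem_nhds hyU)
      · obtain ⟨ρ, hρ⟩ := hU.smooth_boundary _ (hU.mem_frontier_iff.2 ⟨h1, hyU⟩)
        set g := grad ρ (τ + σ * r, y') with hg
        have hlt := hU.abs_grad_fst_lt hρ
        have hpos : 0 < ‖g.2‖ := (abs_nonneg _).trans_lt hlt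
        -- Motion at unit speed along the inward spatial normal: `ρ` changes at the rate `σ * g.1 -
        -- ‖g.2‖`, which is negative because the boundary is timelike.
        refine ⟨-(‖g.2‖⁻¹ • g.2), ?_, hρ.eventually_mem ?_⟩
        · rw [norm_neg, norm_smul, norm_inv, norm_norm, inv_mul_cancel₀ hpos.ne']
        · rw [← edot_grad, edot, ← hg]
          simp only [inner_neg_left, inner_smul_left, real_inner_self_eq_norm_sq]
          have e1 : ‖g.2‖⁻¹ * ‖g.2‖ ^ 2 = ‖g.2‖ := by field_simp
          have e2 : σ * g.1 ≤ |g.1| := by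
            calc σ * g.1 ≤ |σ * g.1| := le_abs_self _
              _ = |g.1| := by rw [abs_mul, hσ, one_mul]
          simp only [conj_trivial, e1]
          linarith
    have hlt : (0 : ℝ) < r' - r := sub_pos.2 hr'
    obtain ⟨s, hs, hs0, hs1⟩ := (hev.and (Ioo_mem_nhdsGT hlt)).exists
    refine ⟨r + s, ⟨y' + s • w, ?_, ?_⟩, by linarith, by linarith⟩
    · refine subset_closure ?_
      convert hs using 1
      ext1
      · simp; ring
      · simp
    · calc ‖y' + s • w - y‖ = ‖(y' - y) + s • w‖ := by congr 1; abel
        _ ≤ ‖y' - y‖ + ‖s • w‖ := norm_add_le _ _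
        _ ≤ r + s := by
          rw [norm_smul, Real.norm_eq_abs, abs_of_pos hs0]
          nlinarith

/-- The distance to `x₀` on a closed slice is maximized at a boundary point. -/
lemma exists_mem_frontier_max (hU : IsGTC U) (hn : 1 ≤ n) (x₀ : EuclideanSpace ℝ (Fin n))
    (τ : ℝ) : ∃ y, (τ, y) ∈ frontier U ∧ ∀ z, (τ, z) ∈ closure U → ‖z - x₀‖ ≤ ‖y - x₀‖ := by
  have hc : IsCompact (closure (slice U τ)) := (hU.slice_bounded τ).isCompact_closure
  obtain ⟨y, hy, hmax⟩ := hc.exists_isMaxOn (hU.slice_nonempty τ).closure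
    (by fun_prop : ContinuousOn (fun y => ‖y - x₀‖) _)
  have hmap : MapsTo (fun z => (τ, z)) (slice U τ) U := fun z hz => hz
  refine ⟨y, ?_, fun z hz => hmax (hU.mem_closure_slice hz)⟩
  refine hU.mem_frontier_iff.2 ⟨hmap.closure (by fun_prop) hy, fun hyU => ?_⟩
  have : Nonempty (Fin n) := ⟨⟨0, hn⟩⟩
  obtain ⟨u₀, hu₀⟩ := exists_ne (0 : EuclideanSpace ℝ (Fin n))
  -- An interior maximum is impossible: a nonzero `u` making no obtuse angle with `y - x₀` strictly
  -- increases the distance. Here `1 ≤ n` supplies a nonzero vector.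
  obtain ⟨u, hu, hin⟩ : ∃ u : EuclideanSpace ℝ (Fin n), u ≠ 0 ∧ 0 ≤ inner ℝ (y - x₀) u := by
    rcases le_total 0 (inner ℝ (y - x₀) u₀) with h | h
    · exact ⟨u₀, hu₀, h⟩
    · exact ⟨-u₀, by simpa using hu₀, by rw [inner_neg_right]; linarith⟩
  have ht : Tendsto (fun s : ℝ => y + s • u) (𝓝[>] 0) (𝓝 y) := by
    have : Continuous (fun s : ℝ => y + s • u) := by fun_prop
    simpa using (this.tendsto 0).mono_left nhdsWithin_le_nhds
  obtain ⟨s, hs, hs0⟩ := ((ht.eventually ((hU.slice_open τ).mem_nhds hyU)).and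
    self_mem_nhdsWithin).exists
  have hs0 : 0 < s := hs0
  have h1 : ‖y + s • u - x₀‖ ≤ ‖y - x₀‖ := hmax (subset_closure hs)
  have h2 : ‖y + s • u - x₀‖ ^ 2 =
      ‖y - x₀‖ ^ 2 + 2 * (s * inner ℝ (y - x₀) u) + s ^ 2 * ‖u‖ ^ 2 := by
    rw [show y + s • u - x₀ = (y - x₀) + s • u by abel, norm_add_sq_real, inner_smul_right,
      norm_smul, Real.norm_eq_abs, mul_pow, sq_abs]
  have h3 : 0 < s ^ 2 * ‖u‖ ^ 2 := by have := norm_pos_iff.2 hu; positivity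
  have h4 := mul_nonneg hs0.le hin
  nlinarith [norm_nonneg (y + s • u - x₀), norm_nonneg (y - x₀)]

lemma norm_sub_le_boundaryRadius (hU : IsGTC U) (hn : 1 ≤ n) {x₀ y : EuclideanSpace ℝ (Fin n)}
    {τ : ℝ} (hy : (τ, y) ∈ closure U) : ‖y - x₀‖ ≤ boundaryRadius U x₀ τ := by
  obtain ⟨z, hz, hmax⟩ := hU.exists_mem_frontier_max hn x₀ τ
  refine (hmax y hy).trans (le_csSup ⟨‖z - x₀‖, ?_⟩ ⟨z, hz, rfl⟩)
  rintro _ ⟨w, hw, rfl⟩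
  exact hmax w (frontier_subset_closure hw)

lemma boundaryRadius_nonneg (hU : IsGTC U) (hn : 1 ≤ n) (x₀ : EuclideanSpace ℝ (Fin n)) (τ : ℝ) :
    0 ≤ boundaryRadius U x₀ τ := by
  obtain ⟨z, hz, -⟩ := hU.exists_mem_frontier_max hn x₀ τ
  exact (norm_nonneg _).trans (hU.norm_sub_le_boundaryRadius hn (frontier_subset_closure hz))

/-- The boundary radius is a `1`-Lipschitz function of time. -/
lemma boundaryRadius_le_add (hU : IsGTC U) (hn : 1 ≤ n) (x₀ : EuclideanSpace ℝ (Fin n))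
    (τ τ' : ℝ) : boundaryRadius U x₀ τ ≤ boundaryRadius U x₀ τ' + |τ' - τ| := by
  obtain ⟨z, hz, -⟩ := hU.exists_mem_frontier_max hn x₀ τ
  refine csSup_le ⟨_, z, hz, rfl⟩ ?_
  rintro _ ⟨y, hy, rfl⟩
  obtain ⟨y', h1, h2⟩ := hU.exists_mem_closure_of_mem_closure (frontier_subset_closure hy) τ'
  calc ‖y - x₀‖ = ‖(y' - x₀) - (y' - y)‖ := by congr 1; abel
    _ ≤ ‖y' - x₀‖ + ‖y' - y‖ := norm_sub_le _ _
    _ ≤ _ := add_le_add (hU.norm_sub_le_boundaryRadius hn h1) h2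

lemma isCompact_slab (hU : IsGTC U) (hn : 1 ≤ n) (a b : ℝ) :
    IsCompact (closure U ∩ Prod.fst ⁻¹' Icc a b) := by
  refine IsCompact.of_isClosed_subset ((isCompact_Icc (a := a) (b := b)).prod (isCompact_closedBall
    (0 : EuclideanSpace ℝ (Fin n)) (boundaryRadius U 0 a + (b - a))))
    (isClosed_closure.inter (isClosed_Icc.preimage continuous_fst)) ?_
  rintro ⟨t, y⟩ ⟨h1, h2⟩
  refine ⟨h2, ?_⟩
  have h3 := hU.norm_sub_le_boundaryRadius hn (x₀ := 0) h1
  have h4 := hU.boundaryRadius_le_add hn 0 t a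
  have h5 : |a - t| ≤ b - a := by
    have h2 : t ∈ Icc a b := h2
    rw [abs_of_nonpos (by linarith [h2.1])]; linarith [h2.2]
  rw [mem_closedBall_zero_iff]
  simp only [sub_zero] at h3
  linarith

end IsGTC

end Spacetime

/-! ### The boundary as a graph, after exchanging `t` with a spatial coordinate. -/

open Filter Topology in
/-- A function that is `C^m` at a point agrees near it with a globally `C^m` function. -/
lemma ContDiffAt.exists_contDiff_eventuallyEq {E : Type*} [NormedAddCommGroup E]
    [InnerProductSpace ℝ E] [FiniteDimensional ℝ E] {m : ℕ} {f : E → ℝ} {x : E}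
    (hf : ContDiffAt ℝ m f x) :
    ∃ g : E → ℝ, ContDiff ℝ m g ∧ g =ᶠ[𝓝 x] f := by
  have hev : ∀ᶠ y in 𝓝 x, ContDiffAt ℝ m f y := hf.eventually (by simp)
  obtain ⟨r, hr, hball⟩ := Metric.eventually_nhds_iff_ball.1 hev
  let b : ContDiffBump x := ⟨r / 4, r / 2, by positivity, by linarith⟩
  refine ⟨fun y => b y * f y, ?_, ?_⟩
  · refine contDiff_iff_contDiffAt.2 fun y => ?_
    by_cases hy : y ∈ tsupport (fun y => b y * f y)
    swap
    · exact contDiffAt_const.congr_of_eventuallyEq (notMem_tsupport_iff_eventuallyEq.1 hy)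
    have hy' : y ∈ tsupport (b : E → ℝ) := closure_mono (Function.support_mul_subset_left _ _) hy
    rw [b.tsupport_eq] at hy'
    refine b.contDiff.contDiffAt.mul (hball y ?_)
    exact Metric.closedBall_subset_ball (by show r / 2 < r; linarith) hy'
  · filter_upwards [b.eventuallyEq_one] with y hy
    simp [hy]

namespace Spacetime

open Filter Topology

variable {n : ℕ} {U : Set (Spacetime n)}

/-- The linear map that exchanges `t` with `ε xₖ`. -/
noncomputable def flip (k : Fin n) (ε : ℝ) : Spacetime n →L[ℝ] Spacetime n :=
  (ε • (EuclideanSpace.proj k ∘L ContinuousLinearMap.snd ℝ ℝ (EuclideanSpace ℝ (Fin n)))).prod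
    (ContinuousLinearMap.snd ℝ ℝ _ +
      (ε • ContinuousLinearMap.fst ℝ ℝ _ -
        EuclideanSpace.proj k ∘L ContinuousLinearMap.snd ℝ ℝ _).smulRight
        (EuclideanSpace.single k (1 : ℝ)))

lemma flip_fst (k : Fin n) (ε : ℝ) (p : Spacetime n) : (flip k ε p).1 = ε * p.2 k := by
  simp [flip]

lemma flip_snd (k : Fin n) (ε : ℝ) (p : Spacetime n) (i : Fin n) :
    (flip k ε p).2 i = if i = k then ε * p.1 else p.2 i := by
  rcases eq_or_ne i k with rfl | h
  · simp [flip]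
  · simp [flip, h]

lemma flip_flip (k : Fin n) {ε : ℝ} (hε : ε * ε = 1) (p : Spacetime n) :
    flip k ε (flip k ε p) = p := by
  ext1
  · rw [flip_fst, flip_snd, if_pos rfl, ← mul_assoc, hε, one_mul]
  · ext i
    rw [flip_snd, flip_fst, flip_snd]
    split_ifs with h
    · rw [← mul_assoc, hε, one_mul, h]
    · rfl

lemma flip_eT (k : Fin n) (ε : ℝ) : flip k ε eT = ε • eX k := by
  ext1
  · simp [flip_fst, eT, eX]
  · ext i
    rw [flip_snd]
    by_cases h : i = k <;> simp [eT, eX, h]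

lemma flip_eX_self (k : Fin n) (ε : ℝ) : flip k ε (eX k) = ε • eT := by
  ext1
  · simp [flip_fst, eT, eX]
  · ext i
    rw [flip_snd]
    by_cases h : i = k <;> simp [eT, eX, h]

lemma flip_eX_of_ne {k i : Fin n} (h : i ≠ k) (ε : ℝ) : flip k ε (eX i) = eX i := by
  ext1
  · simp [flip_fst, eX, h.symm]
  · ext j
    rw [flip_snd]
    by_cases h' : j = k
    · subst h'; simp [eX, h.symm]
    · simp [eX, h']

lemma edot_flip (k : Fin n) {ε : ℝ} (hε : ε * ε = 1) (v w : Spacetime n) :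
    edot (flip k ε v) (flip k ε w) = edot v w := by
  simp only [edot, PiLp.inner_apply, flip_fst, flip_snd, RCLike.inner_apply, conj_trivial]
  rw [← Finset.add_sum_erase _ _ (Finset.mem_univ k),
    ← Finset.add_sum_erase (a := k) Finset.univ (fun i => w.2 i * v.2 i) (Finset.mem_univ k)]
  have : ∑ i ∈ Finset.univ.erase k, ((if i = k then ε * w.1 else w.2 i) *
      (if i = k then ε * v.1 else v.2 i)) = ∑ i ∈ Finset.univ.erase k, w.2 i * v.2 i := by
    refine Finset.sum_congr rfl fun i hi => ?_
    rw [if_neg (Finset.ne_of_mem_erase hi), if_neg (Finset.ne_of_mem_erase hi)]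
  rw [this]
  simp only [if_true]
  linear_combination (v.2 k * w.2 k + v.1 * w.1) * hε

instance isAddHaarMeasure_volume : (volume : Measure (Spacetime n)).IsAddHaarMeasure :=
  Measure.prod.instIsAddHaarMeasure (volume : Measure ℝ)
    (volume : Measure (EuclideanSpace ℝ (Fin n)))

/-- An involution has determinant of absolute value one. -/
lemma measurePreserving_flip (k : Fin n) {ε : ℝ} (hε : ε * ε = 1) :
    MeasurePreserving (flip k ε : Spacetime n → Spacetime n) := by
  refine ⟨(flip k ε).continuous.measurable, ?_⟩
  set A : Spacetime n →ₗ[ℝ] Spacetime n := (flip k ε).toLinearMap with hA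
  have hAA : A * A = 1 := by
    exact LinearMap.ext fun p => flip_flip k hε p
  have hdet : A.det * A.det = 1 := by rw [← map_mul, hAA, map_one]
  have h1 : |A.det| = 1 := by
    rcases mul_self_eq_one_iff.1 hdet with h | h <;> simp [h]
  have h0 : A.det ≠ 0 := fun h => by simp [h] at hdet
  have := Measure.map_linearMap_addHaar_eq_smul_addHaar (volume : Measure (Spacetime n)) h0
  rw [abs_inv, h1, inv_one, ENNReal.ofReal_one, one_smul] at this
  exact this

/-- `W` is an open set in which, after the linear change of coordinates `L`, the set `U` is the
region below the graph of `ψ`, and the differential of `s - ψ(y)` is conormal to the graph. -/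
structure IsGraphPatch (U W : Set (Spacetime n)) (L : Spacetime n →L[ℝ] Spacetime n)
    (ψ : EuclideanSpace ℝ (Fin n) → ℝ) : Prop where
  isOpen : IsOpen W
  mem_iff : ∀ q ∈ W, (q ∈ U ↔ (L q).1 < ψ (L q).2)
  exists_fderiv_eq : ∀ q ∈ W, (L q).1 = ψ (L q).2 → ∃ ρ, IsDefiningFunctionAt U q ρ ∧
    ∃ c : ℝ, 0 < c ∧ ∀ v, fderiv ℝ ρ q v = c * ((L v).1 - fderiv ℝ ψ (L q).2 (L v).2)

/-- The boundary is timelike, so some spatial derivative of `ρ` is nonzero. After `flip` that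
coordinate is the graph variable and the implicit function theorem applies. Class `C²` is kept so
that straightening the graph, which involves `fderiv ℝ ψ`, preserves `C¹` fields. -/
lemma IsGTC.exists_graphPatch (hU : IsGTC U) {p : Spacetime n} (hp : p ∈ frontier U) :
    ∃ (k : Fin n) (ε : ℝ) (ψ : EuclideanSpace ℝ (Fin n) → ℝ) (W : Set (Spacetime n)),
      ε * ε = 1 ∧ ContDiff ℝ 2 ψ ∧ p ∈ W ∧ IsGraphPatch U W (flip k ε) ψ := by
  obtain ⟨ρ, hρ⟩ := hU.smooth_boundary p hp
  obtain ⟨k, hk⟩ : ∃ k, fderiv ℝ ρ p (eX k) ≠ 0 := by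
    by_contra! hc
    have h1 := hU.abs_grad_fst_lt hρ
    have : (grad ρ p).2 = 0 := by ext i; simp [grad, hc]
    rw [this, norm_zero] at h1
    exact absurd h1 (not_lt.2 (abs_nonneg _))
  -- The sign `ε` makes `ρ` increase with the graph variable, so that `U` lies below the graph.
  obtain ⟨ε, hε, hpos⟩ : ∃ ε : ℝ, ε * ε = 1 ∧ 0 < fderiv ℝ ρ p (flip k ε eT) := by
    rcases lt_or_gt_of_ne hk with h | h
    · exact ⟨-1, by norm_num, by rw [flip_eT]; simpa using h⟩
    · exact ⟨1, by norm_num, by rw [flip_eT]; simpa using h⟩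
  set L : Spacetime n →L[ℝ] Spacetime n := flip k ε with hL
  have hLL : ∀ q, L (L q) = q := flip_flip k hε
  set u : EuclideanSpace ℝ (Fin n) × ℝ := ((L p).2, (L p).1) with hu
  set f : EuclideanSpace ℝ (Fin n) × ℝ → ℝ := fun z => ρ (L (z.2, z.1)) with hf
  have hLu : L (u.2, u.1) = p := hLL p
  have hfL : ∀ q, f ((L q).2, (L q).1) = ρ q := fun q => by
    show ρ (L (L q)) = ρ q
    rw [hLL]
  have hLc : Continuous fun z : EuclideanSpace ℝ (Fin n) × ℝ => L (z.2, z.1) := by fun_prop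
  have hLt : Tendsto (fun z : EuclideanSpace ℝ (Fin n) × ℝ => L (z.2, z.1)) (𝓝 u) (𝓝 p) := by
    have := hLc.tendsto u
    rwa [hLu] at this
  have hfd : ∀ z, DifferentiableAt ℝ ρ (L (z.2, z.1)) → HasFDerivAt f
      ((fderiv ℝ ρ (L (z.2, z.1))) ∘L L ∘L ((ContinuousLinearMap.snd ℝ _ ℝ).prod
        (ContinuousLinearMap.fst ℝ _ ℝ))) z := by
    intro z hz
    have h1 : HasFDerivAt (fun z : EuclideanSpace ℝ (Fin n) × ℝ => L (z.2, z.1))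
      (L ∘L ((ContinuousLinearMap.snd ℝ _ ℝ).prod (ContinuousLinearMap.fst ℝ _ ℝ))) z :=
      (L ∘L ((ContinuousLinearMap.snd ℝ _ ℝ).prod
        (ContinuousLinearMap.fst ℝ (EuclideanSpace ℝ (Fin n)) ℝ))).hasFDerivAt
    exact hz.hasFDerivAt.comp z h1
  have hρ2 : ContDiffAt ℝ 2 ρ p := hρ.contDiffAt.of_le (by norm_cast)
  have hcd : ContDiffAt ℝ 2 f u := by
    refine ContDiffAt.comp u (by rw [hLu]; exact hρ2) ?_
    exact ((L.contDiff.comp (contDiff_snd.prodMk contDiff_fst)).contDiffAt)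
  have hfu : f u = 0 := by show ρ (L (u.2, u.1)) = 0; rw [hLu, hρ.1]
  set c₀ := fderiv ℝ ρ p (L eT) with hc₀
  have hinv : (fderiv ℝ f u ∘L .inr ℝ (EuclideanSpace ℝ (Fin n)) ℝ).IsInvertible := by
    have heq : fderiv ℝ f u ∘L .inr ℝ (EuclideanSpace ℝ (Fin n)) ℝ
        = c₀ • ContinuousLinearMap.id ℝ ℝ := by
      rw [(hfd u (by rw [hLu]; exact hρ2.differentiableAt (by simp))).fderiv, hLu]
      ext
      simp [hc₀, eT]
    rw [heq]
    refine ContinuousLinearMap.IsInvertible.of_inverse (g := c₀⁻¹ • ContinuousLinearMap.id ℝ ℝ)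
      ?_ ?_
    · ext; simp [hpos.ne']
    · ext; simp [hpos.ne']
  set ψ₀ := hcd.implicitFunction (by simp) hinv with hψ₀
  have hψu : ψ₀ u.1 = u.2 := hcd.implicitFunction_apply_self _ _
  have hψcd : ContDiffAt ℝ ((2 : ℕ) : WithTop ℕ∞) ψ₀ u.1 := hcd.contDiffAt_implicitFunction _ _
  -- A globally defined `ψ` allows the shear and the integrals over the whole of `ℝⁿ` below; only
  -- its values near `u.1` describe the boundary.
  obtain ⟨ψ, hψ, hψeq⟩ := hψcd.exists_contDiff_eventuallyEq
  have hψu' : ψ u.1 = u.2 := hψeq.self_of_nhds.trans hψu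
  have hfψ : ∀ᶠ y in 𝓝 u.1, f (y, ψ y) = 0 := by
    filter_upwards [hcd.eventually_apply_implicitFunction (by simp) hinv, hψeq] with y h1 h2
    rw [h2, h1, hfu]
  -- positivity of the derivative in the direction of the graph variable
  have hcont : ContinuousAt (fun q => fderiv ℝ ρ q (L eT)) p :=
    ((hρ2.fderiv_right (m := 1) (by norm_num)).continuousAt).clm_apply continuousAt_const
  have hposev : ∀ᶠ q in 𝓝 p, 0 < fderiv ℝ ρ q (L eT) := hcont.eventually (lt_mem_nhds hpos)
  have hdiffev : ∀ᶠ q in 𝓝 p, DifferentiableAt ℝ ρ q :=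
    (hρ2.eventually (by simp)).mono fun q hq => hq.differentiableAt (by simp)
  obtain ⟨r, hr, hball⟩ := Metric.eventually_nhds_iff_ball.1
    (hLt.eventually (hposev.and hdiffev))
  have hψt : ContinuousAt ψ u.1 := hψ.continuous.continuousAt
  have hψr : ∀ᶠ y in 𝓝 u.1, ψ y ∈ Metric.ball u.2 r :=
    hψt.eventually (by rw [hψu']; exact Metric.ball_mem_nhds _ hr)
  -- In a small box `f` is strictly increasing in its second variable and vanishes on the graph, so
  -- its sign tells on which side of the graph a point lies.
  have hsign : ∀ᶠ z in 𝓝 u, (f z < 0 ↔ z.2 < ψ z.1) := by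
    have h1 : ∀ᶠ z : EuclideanSpace ℝ (Fin n) × ℝ in 𝓝 u, z.1 ∈ Metric.ball u.1 r ∧
        ψ z.1 ∈ Metric.ball u.2 r ∧ f (z.1, ψ z.1) = 0 :=
      (continuous_fst.tendsto u).eventually
        (Eventually.and (Metric.ball_mem_nhds u.1 hr) (hψr.and hfψ))
    have h2 : ∀ᶠ z : EuclideanSpace ℝ (Fin n) × ℝ in 𝓝 u, z.2 ∈ Metric.ball u.2 r :=
      (continuous_snd.tendsto u).eventually (Metric.ball_mem_nhds _ hr)
    filter_upwards [h1, h2] with z ⟨hz1, hz2, hz3⟩ hz4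
    have hmem : ∀ s ∈ Metric.ball u.2 r, (z.1, s) ∈ Metric.ball u r := by
      intro s hs
      rw [← ball_prod_same]; exact ⟨hz1, hs⟩
    have hder : ∀ s ∈ Metric.ball u.2 r, HasDerivAt (fun s => f (z.1, s))
        (fderiv ℝ ρ (L (s, z.1)) (L eT)) s := by
      intro s hs
      have h3 := (hfd (z.1, s) (hball _ (hmem s hs)).2).comp_hasDerivAt s
        ((hasDerivAt_const s z.1).prodMk (hasDerivAt_id s))
      convert! h3 using 1
    have hmono : StrictMonoOn (fun s => f (z.1, s)) (Metric.ball u.2 r) := by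
      refine strictMonoOn_of_deriv_pos (convex_ball _ _)
        (fun s hs => (hder s hs).continuousAt.continuousWithinAt) fun s hs => ?_
      rw [Metric.isOpen_ball.interior_eq] at hs
      rw [(hder s hs).deriv]
      exact (hball _ (hmem s hs)).1
    have := hmono.lt_iff_lt hz4 hz2
    simp only [hz3] at this
    exact this
  have hLp : Tendsto (fun q => ((L q).2, (L q).1)) (𝓝 p) (𝓝 u) := by
    have : Continuous fun q => ((L q).2, (L q).1) := by fun_prop
    exact this.tendsto p
  have hgood : ∀ᶠ q in 𝓝 p, (q ∈ U ↔ (L q).1 < ψ (L q).2) ∧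
      ((L q).1 = ψ (L q).2 → ∃ ρ, IsDefiningFunctionAt U q ρ ∧
        ∃ c : ℝ, 0 < c ∧ ∀ v, fderiv ℝ ρ q v = c * ((L v).1 - fderiv ℝ ψ (L q).2 (L v).2)) := by
    have hfψ' : ∀ᶠ q in 𝓝 p, ∀ᶠ y in 𝓝 (L q).2, f (y, ψ y) = 0 := by
      have : Tendsto (fun q => (L q).2) (𝓝 p) (𝓝 u.1) := by
        have : Continuous fun q => (L q).2 := by fun_prop
        exact this.tendsto p
      exact this.eventually (eventually_eventually_nhds.2 hfψ)
    filter_upwards [hρ.eventually_mem_iff, hLp.eventually hsign,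
      hρ.eventually_isDefiningFunctionAt, hposev, hdiffev, hfψ'] with q h1 h2 h3 h4 h5 h6
    refine ⟨?_, fun hq => ?_⟩
    · rw [h1, ← hfL q, h2]
    · have hq0 : ρ q = 0 := by
        rw [← hfL q, hq]; exact h6.self_of_nhds
      refine ⟨ρ, h3 hq0, fderiv ℝ ρ q (L eT), h4, fun v => ?_⟩
      set y := (L q).2 with hy
      have hLy : L (ψ y, y) = q := by rw [← hq, hy]; exact hLL q
      have hd1 : HasFDerivAt (fun y => (y, ψ y))
          ((ContinuousLinearMap.id ℝ _).prod (fderiv ℝ ψ y)) y :=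
        (hasFDerivAt_id y).prodMk (hψ.contDiffAt.differentiableAt (by simp)).hasFDerivAt
      have hd2 := (hfd (y, ψ y) (by simpa only [hLy] using h5)).comp y hd1
      have hd3 : HasFDerivAt (f ∘ fun y => (y, ψ y)) (0 : _ →L[ℝ] ℝ) y :=
        (hasFDerivAt_const (0 : ℝ) y).congr_of_eventuallyEq h6
      -- Differentiating `f (y, ψ y) = 0` shows that `fderiv ℝ ρ q` kills the vectors tangent to the
      -- graph; only the component along `L eT` remains.
      have hz : ∀ w, fderiv ℝ ρ q (L (fderiv ℝ ψ y w, w)) = 0 := by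
        intro w
        have := congrArg (fun A => A w) (hd2.unique hd3)
        simpa [hLy] using this
      have hdec : v = L (fderiv ℝ ψ y (L v).2, (L v).2)
          + ((L v).1 - fderiv ℝ ψ y (L v).2) • L eT := by
        conv_lhs => rw [← hLL v]
        rw [← map_smul, ← map_add]
        congr 1
        ext1
        · simp [eT]
        · simp [eT]
      conv_lhs => rw [hdec]
      rw [map_add, hz, map_smul, smul_eq_mul, zero_add, mul_comm]
  obtain ⟨W, hW, hWo, hpW⟩ := eventually_nhds_iff.1 hgood
  exact ⟨k, ε, ψ, W, hε, hψ, hpW, hWo, fun q hq => (hW q hq).1, fun q hq => (hW q hq).2⟩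

end Spacetime

/-! ### The divergence theorem in a half-space and below a graph. -/

lemma MeasureTheory.integrable_of_bounded_of_isCompact {X : Type*} [TopologicalSpace X] [T2Space X]
    [MeasurableSpace X] [BorelSpace X] {μ : Measure X} [IsFiniteMeasureOnCompacts μ]
    {F : X → ℝ} (hF : Measurable F) {M : ℝ} (hM : ∀ x, |F x| ≤ M) {K : Set X} (hK : IsCompact K)
    (h0 : ∀ x, x ∉ K → F x = 0) : Integrable F μ := by
  have h1 : IntegrableOn F K μ :=
    Measure.integrableOn_of_bounded hK.measure_lt_top.ne hF.aestronglyMeasurable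
      (Filter.Eventually.of_forall fun x => by simpa using hM x)
  rw [← integrable_indicator_iff hK.measurableSet] at h1
  have h2 : K.indicator F = F := by
    ext x
    by_cases hx : x ∈ K
    · simp [hx]
    · simp [hx, h0 x hx]
  rwa [h2] at h1

namespace Spacetime

open Filter Topology

variable {n : ℕ}

/-- The divergence of a vector field. -/
noncomputable def diverg (V : Spacetime n → Spacetime n) (p : Spacetime n) : ℝ :=
  (fderiv ℝ V p eT).1 + ∑ i, (fderiv ℝ V p (eX i)).2 i

lemma measurable_fderiv_fst (V : Spacetime n → Spacetime n) (v : Spacetime n) :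
    Measurable fun p => (fderiv ℝ V p v).1 :=
  (measurable_fderiv_apply_const ℝ V v).fst

lemma measurable_fderiv_snd (V : Spacetime n → Spacetime n) (v : Spacetime n) (i : Fin n) :
    Measurable fun p => (fderiv ℝ V p v).2 i := by
  have h1 : Continuous fun x : EuclideanSpace ℝ (Fin n) => x i := by fun_prop
  exact h1.measurable.comp (measurable_fderiv_apply_const ℝ V v).snd

lemma measurable_diverg (V : Spacetime n → Spacetime n) : Measurable (diverg V) :=
  (measurable_fderiv_fst V eT).add
    (Finset.measurable_sum _ fun i _ => measurable_fderiv_snd V (eX i) i)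

lemma abs_snd_apply_le (v : Spacetime n) (i : Fin n) : |v.2 i| ≤ ‖v‖ :=
  (PiLp.norm_apply_le v.2 i).trans (norm_snd_le v)

/-- The partial derivatives of a compactly supported field, cut off to the open half-space. -/
lemma exists_bound_fderiv {V : Spacetime n → Spacetime n} {D O : Set (Spacetime n)}
    (hD : UniqueDiffOn ℝ D) (hDc : IsClosed D) (hO : IsOpen O) (hOD : O ⊆ D)
    (hV : ContDiffOn ℝ 1 V D) (hc : HasCompactSupport V) :
    ∃ M : ℝ, 0 ≤ M ∧ ∀ p ∈ O, ‖fderiv ℝ V p‖ ≤ M := by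
  have hK : IsCompact (tsupport V ∩ D) := hc.isCompact.inter_right hDc
  have h1 : ContinuousOn (fderivWithin ℝ V D) (tsupport V ∩ D) :=
    (hV.continuousOn_fderivWithin hD (by simp)).mono inter_subset_right
  obtain ⟨M, hM⟩ := hK.exists_bound_of_continuousOn h1
  refine ⟨max M 0, le_max_right _ _, fun p hp => ?_⟩
  by_cases hpt : p ∈ tsupport V
  · have := hM p ⟨hpt, hOD hp⟩
    rw [fderivWithin_of_mem_nhds (mem_of_superset (hO.mem_nhds hp) hOD)] at this
    exact this.trans (le_max_left _ _)
  · rw [(notMem_tsupport_iff_eventuallyEq.1 hpt).fderiv_eq]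
    simp

lemma uniqueDiffOn_halfSpace : UniqueDiffOn ℝ {q : Spacetime n | q.1 ≤ 0} := by
  have : {q : Spacetime n | q.1 ≤ 0} = Iic 0 ×ˢ univ := by ext; simp
  rw [this]
  exact (uniqueDiffOn_Iic 0).prod uniqueDiffOn_univ

lemma integral_fderiv_apply_eq_zero {E : Type*} [NormedAddCommGroup E] [NormedSpace ℝ E]
    [FiniteDimensional ℝ E] [MeasurableSpace E] [BorelSpace E] {μ : Measure E}
    [μ.IsAddHaarMeasure] {g : E → ℝ} (hg : Differentiable ℝ g) {v : E} (hi : Integrable g μ)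
    (hi' : Integrable (fun y => fderiv ℝ g y v) μ) : ∫ y, fderiv ℝ g y v ∂μ = 0 := by
  have := integral_mul_fderiv_eq_neg_fderiv_mul_of_integrable (μ := μ) (f := fun _ => (1 : ℝ))
    (g := g) (v := v) (by simp) (by simpa using hi') (by simpa using hi)
    (fun x _ => differentiableAt_const _) (fun x _ => hg x)
  simpa using this

/-- By Fubini, the time derivative integrates along each vertical line to the boundary value, and
each spatial derivative integrates to zero over a full horizontal hyperplane. Regularity is known
only on the closed half-space, hence the indicators of the open one. -/
theorem integral_diverg_halfSpace {V : Spacetime n → Spacetime n}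
    (hV : ContDiffOn ℝ 1 V {q | q.1 ≤ 0}) (hc : HasCompactSupport V) :
    ∫ q in {q : Spacetime n | q.1 < 0}, diverg V q = ∫ y, (V (0, y)).1 := by
  set D : Set (Spacetime n) := {q | q.1 ≤ 0} with hD
  set O : Set (Spacetime n) := {q | q.1 < 0} with hO
  have hOo : IsOpen O := isOpen_lt continuous_fst continuous_const
  have hDc : IsClosed D := isClosed_le continuous_fst continuous_const
  have hOD : O ⊆ D := fun q (hq : q.1 < 0) => hq.le
  have hdiff : ∀ q ∈ O, HasFDerivAt V (fderiv ℝ V q) q := fun q hq =>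
    ((hV.contDiffAt (mem_of_superset (hOo.mem_nhds hq) hOD)).differentiableAt
      (by simp)).hasFDerivAt
  obtain ⟨M, hM0, hM⟩ := exists_bound_fderiv uniqueDiffOn_halfSpace hDc hOo hOD hV hc
  have hz : ∀ q, q ∉ tsupport V → fderiv ℝ V q = 0 := fun q hq => by
    rw [(notMem_tsupport_iff_eventuallyEq.1 hq).fderiv_eq]; simp
  -- integrability of a cut-off component of the derivative
  have hT : Integrable (O.indicator fun q => (fderiv ℝ V q eT).1) := by
    refine integrable_of_bounded_of_isCompact
      ((measurable_fderiv_fst V eT).indicator hOo.measurableSet)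
      (M := M * ‖(eT : Spacetime n)‖) (fun q => ?_) hc.isCompact (fun q hq => ?_)
    · by_cases hq : q ∈ O
      · rw [indicator_of_mem hq]
        exact (norm_fst_le _).trans (ContinuousLinearMap.le_of_opNorm_le _ (hM q hq) _)
      · rw [indicator_of_notMem hq]; simp; positivity
    · by_cases hq' : q ∈ O <;> simp [hq', hz q hq]
  have hX : ∀ i, Integrable (O.indicator fun q => (fderiv ℝ V q (eX i)).2 i) := by
    intro i
    refine integrable_of_bounded_of_isCompact
      ((measurable_fderiv_snd V (eX i) i).indicator hOo.measurableSet)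
      (M := M * ‖(eX i : Spacetime n)‖) (fun q => ?_) hc.isCompact (fun q hq => ?_)
    · by_cases hq : q ∈ O
      · rw [indicator_of_mem hq]
        exact (abs_snd_apply_le _ _).trans (ContinuousLinearMap.le_of_opNorm_le _ (hM q hq) _)
      · rw [indicator_of_notMem hq]; simp; positivity
    · by_cases hq' : q ∈ O <;> simp [hq', hz q hq]
  -- the time part
  have hT' : ∫ q, O.indicator (fun q => (fderiv ℝ V q eT).1) q = ∫ y, (V (0, y)).1 := by
    rw [Measure.volume_eq_prod] at hT ⊢
    rw [integral_prod_symm _ hT]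
    refine integral_congr_ae ?_
    filter_upwards [hT.prod_left_ae] with y hy
    have hind : (fun s : ℝ => O.indicator (fun q => (fderiv ℝ V q eT).1) (s, y)) =
        (Iio (0 : ℝ)).indicator fun s => (fderiv ℝ V (s, y) eT).1 := by
      ext s
      by_cases hs : s < 0 <;> simp [hO, indicator, hs]
    rw [hind] at hy ⊢
    rw [integrable_indicator_iff measurableSet_Iio] at hy
    rw [integral_indicator measurableSet_Iio, ← integral_Iic_eq_integral_Iio]
    have hfun : Continuous fun s : ℝ => ((s, y) : Spacetime n) := by fun_prop
    have hlim : Tendsto (fun s : ℝ => (V (s, y)).1) atBot (𝓝 0) := by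
      have hcomp : IsCompact (Prod.fst '' tsupport V) := hc.isCompact.image continuous_fst
      obtain ⟨R, hR⟩ := hcomp.bddBelow
      refine tendsto_const_nhds.congr' ?_
      filter_upwards [eventually_lt_atBot R] with s hs
      have : (s, y) ∉ tsupport V := fun h => absurd (hR ⟨_, h, rfl⟩) (not_le.2 hs)
      rw [image_eq_zero_of_notMem_tsupport this]; rfl
    have := integral_Iic_of_hasDerivAt_of_tendsto (f := fun s : ℝ => (V (s, y)).1)
      (f' := fun s => (fderiv ℝ V (s, y) eT).1) (a := 0) ?_ ?_ ?_ hlim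
    · simpa using this
    · have h1 : ContinuousWithinAt V D (0, y) := hV.continuousOn _ (by simp [hD])
      exact (h1.comp (s := Iic (0 : ℝ)) (f := fun s : ℝ => ((s, y) : Spacetime n))
        hfun.continuousWithinAt (fun s hs => hs)).fst
    · intro s hs
      have h1 : HasDerivAt (fun s : ℝ => ((s, y) : Spacetime n)) eT s :=
        (hasDerivAt_id s).prodMk (hasDerivAt_const s y)
      exact (ContinuousLinearMap.fst ℝ ℝ (EuclideanSpace ℝ (Fin n))).hasFDerivAt.comp_hasDerivAt s
        ((hdiff (s, y) hs).comp_hasDerivAt s h1)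
    · exact (integrableOn_Iic_iff_integrableOn_Iio).2 hy
  -- the space part
  have hX' : ∀ i, ∫ q, O.indicator (fun q => (fderiv ℝ V q (eX i)).2 i) q = 0 := by
    intro i
    have hXi := hX i
    rw [Measure.volume_eq_prod] at hXi ⊢
    rw [integral_prod _ hXi]
    refine integral_eq_zero_of_ae ?_
    filter_upwards [hXi.prod_right_ae] with s hs
    by_cases hs0 : s < 0
    · have hmem : ∀ y, (s, y) ∈ O := fun y => hs0
      simp only [indicator_of_mem (hmem _)] at hs ⊢
      have hd : ∀ y, HasFDerivAt (fun y => (V (s, y)).2 i)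
          ((EuclideanSpace.proj i ∘L ContinuousLinearMap.snd ℝ ℝ _) ∘L
            (fderiv ℝ V (s, y)) ∘L (ContinuousLinearMap.inr ℝ ℝ _)) y := by
        intro y
        have h1 : HasFDerivAt (fun y : EuclideanSpace ℝ (Fin n) => ((s, y) : Spacetime n))
            (ContinuousLinearMap.inr ℝ ℝ _) y := hasFDerivAt_prodMk_right s y
        have h2 := (hdiff (s, y) (hmem y)).comp y h1
        exact (EuclideanSpace.proj i ∘L
          ContinuousLinearMap.snd ℝ ℝ (EuclideanSpace ℝ (Fin n))).hasFDerivAt.comp y h2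
      have heq : ∀ y, (fderiv ℝ V (s, y) (eX i)).2 i =
          fderiv ℝ (fun y => (V (s, y)).2 i) y (EuclideanSpace.single i 1) := by
        intro y
        rw [(hd y).fderiv]
        simp [eX]
      simp only [heq] at hs ⊢
      have hdf : Differentiable ℝ fun y => (V (s, y)).2 i := fun y => (hd y).differentiableAt
      refine integral_fderiv_apply_eq_zero hdf ?_ hs
      refine hdf.continuous.integrable_of_hasCompactSupport ?_
      refine HasCompactSupport.intro (hc.isCompact.image continuous_snd) fun y hy => ?_
      have : (s, y) ∉ tsupport V := fun h => hy ⟨_, h, rfl⟩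
      rw [image_eq_zero_of_notMem_tsupport this]; rfl
    · have hmem : ∀ y, (s, y) ∉ O := fun y => hs0
      simp [indicator_of_notMem (hmem _)]
  rw [← integral_indicator hOo.measurableSet]
  have hsplit : O.indicator (diverg V) = fun q =>
      O.indicator (fun q => (fderiv ℝ V q eT).1) q +
        ∑ i, O.indicator (fun q => (fderiv ℝ V q (eX i)).2 i) q := by
    ext q
    by_cases hq : q ∈ O <;> simp [hq, diverg]
  rw [hsplit, integral_add hT (integrable_finsetSum _ fun i _ => hX i),
    integral_finsetSum _ fun i _ => hX i, hT']
  simp [hX']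

end Spacetime

namespace Spacetime

open Filter Topology

variable {n : ℕ}

/-- The shear that straightens the graph of `ψ`. -/
def shear {ψ : EuclideanSpace ℝ (Fin n) → ℝ} (hψ : Continuous ψ) : Spacetime n ≃ₜ Spacetime n where
  toFun q := (q.1 + ψ q.2, q.2)
  invFun q := (q.1 - ψ q.2, q.2)
  left_inv q := by simp
  right_inv q := by simp
  continuous_toFun := by fun_prop
  continuous_invFun := by fun_prop

lemma measurePreserving_shear {ψ : EuclideanSpace ℝ (Fin n) → ℝ} (hψ : Continuous ψ) :
    MeasurePreserving (shear hψ) := by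
  have h1 : MeasurePreserving (fun q : EuclideanSpace ℝ (Fin n) × ℝ => (q.1, q.2 + ψ q.1))
      (volume.prod volume) (volume.prod volume) := by
    refine (MeasurePreserving.id volume).skew_product (g := fun y s => s + ψ y) ?_ ?_
    · exact (by fun_prop : Continuous fun q : EuclideanSpace ℝ (Fin n) × ℝ =>
        q.2 + ψ q.1).measurable
    · exact Eventually.of_forall fun y => map_add_right_eq_self volume (ψ y)
  exact (Measure.measurePreserving_swap.comp h1).comp Measure.measurePreserving_swap

/-- The divergence theorem below the graph of `ψ`. -/
theorem integral_diverg_graph {V : Spacetime n → Spacetime n}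
    {ψ : EuclideanSpace ℝ (Fin n) → ℝ} (hψ : ContDiff ℝ 2 ψ)
    (hV : ContDiffOn ℝ 1 V {q | q.1 ≤ ψ q.2}) (hc : HasCompactSupport V) :
    ∫ q in {q : Spacetime n | q.1 < ψ q.2}, diverg V q =
      ∫ y, ((V (ψ y, y)).1 - fderiv ℝ ψ y (V (ψ y, y)).2) := by
  set Ψ := shear hψ.continuous with hΨ
  have hΨa : ∀ q, Ψ q = (q.1 + ψ q.2, q.2) := fun q => rfl
  -- The pull-back of `V` under the shear. The shear preserves volume, so the divergence of `V'` is
  -- that of `V` at the sheared point, and on `t = 0` the time component of `V'` is the pairing of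
  -- `V` with the conormal of the graph.
  set V' : Spacetime n → Spacetime n := fun q =>
    ((V (Ψ q)).1 - fderiv ℝ ψ q.2 (V (Ψ q)).2, (V (Ψ q)).2) with hV'
  have hΨs : ContDiff ℝ 1 (fun q => Ψ q) := by
    have : ContDiff ℝ 1 ψ := hψ.of_le (by norm_num)
    exact (contDiff_fst.add (this.comp contDiff_snd)).prodMk contDiff_snd
  have hψ' : ContDiff ℝ 1 (fderiv ℝ ψ) := hψ.fderiv_right (by norm_num)
  have hVΨ : ContDiffOn ℝ 1 (fun q => V (Ψ q)) {q | q.1 ≤ 0} :=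
    hV.comp hΨs.contDiffOn (fun q (hq : q.1 ≤ 0) => by
      show q.1 + ψ q.2 ≤ ψ q.2
      linarith)
  have hV's : ContDiffOn ℝ 1 V' {q | q.1 ≤ 0} := by
    refine (hVΨ.fst.sub ?_).prodMk hVΨ.snd
    exact (hψ'.comp contDiff_snd).contDiffOn.clm_apply hVΨ.snd
  have hV'c : HasCompactSupport V' := by
    refine HasCompactSupport.intro (hc.comp_homeomorph Ψ).isCompact fun q hq => ?_
    have : V (Ψ q) = 0 := image_eq_zero_of_notMem_tsupport (f := V ∘ Ψ) hq
    simp [hV', this]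
  have key := integral_diverg_halfSpace hV's hV'c
  have hR : ∀ y, (V' (0, y)).1 = (V (ψ y, y)).1 - fderiv ℝ ψ y (V (ψ y, y)).2 := by
    intro y; simp [hV', hΨa]
  simp only [hR] at key
  rw [← key, ← (measurePreserving_shear hψ.continuous).setIntegral_preimage_emb
    Ψ.measurableEmbedding]
  have hpre : Ψ ⁻¹' {q | q.1 < ψ q.2} = {q | q.1 < 0} := by
    ext q
    show q.1 + ψ q.2 < ψ q.2 ↔ q.1 < 0
    constructor <;> intro h <;> linarith
  rw [← hΨ, hpre]
  have hopen : IsOpen {q : Spacetime n | q.1 < 0} := isOpen_lt continuous_fst continuous_const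
  have hopen' : IsOpen {q : Spacetime n | q.1 < ψ q.2} :=
    isOpen_lt continuous_fst (hψ.continuous.comp continuous_snd)
  refine setIntegral_congr_fun hopen.measurableSet fun q hq => ?_
  have hqΨ : Ψ q ∈ {q : Spacetime n | q.1 < ψ q.2} := by
    rw [← hpre] at hq; exact hq
  have hA : HasFDerivAt V (fderiv ℝ V (Ψ q)) (Ψ q) := by
    refine ((hV.contDiffAt (mem_of_superset (hopen'.mem_nhds hqΨ) ?_)).differentiableAt
      (by simp)).hasFDerivAt
    exact fun q (hq : q.1 < ψ q.2) => hq.le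
  set A := fderiv ℝ V (Ψ q) with hAdef
  set b := fderiv ℝ ψ q.2 with hb
  have hsnd : HasFDerivAt (fun q : Spacetime n => q.2) (ContinuousLinearMap.snd ℝ ℝ _) q :=
    hasFDerivAt_snd
  have hΨd : HasFDerivAt (fun q => Ψ q) ((ContinuousLinearMap.fst ℝ ℝ _ +
      b ∘L ContinuousLinearMap.snd ℝ ℝ _).prod (ContinuousLinearMap.snd ℝ ℝ _)) q := by
    refine HasFDerivAt.prodMk (hasFDerivAt_fst.add ?_) hsnd
    exact (hψ.contDiffAt.differentiableAt (by simp)).hasFDerivAt.comp q hsnd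
  have hB := hA.comp q hΨd
  have hb' : HasFDerivAt (fun q : Spacetime n => fderiv ℝ ψ q.2)
      (fderiv ℝ (fderiv ℝ ψ) q.2 ∘L ContinuousLinearMap.snd ℝ ℝ _) q :=
    (hψ'.contDiffAt.differentiableAt (by simp)).hasFDerivAt.comp q hsnd
  have hD := ((hasFDerivAt_fst.comp q hB).sub
    (hb'.clm_apply (hasFDerivAt_snd.comp q hB))).prodMk (hasFDerivAt_snd.comp q hB)
  have hD' : fderiv ℝ V' q = _ := HasFDerivAt.fderiv hD
  have hTeq : (fderiv ℝ V' q eT).1 = (A eT).1 - b (A eT).2 := by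
    rw [hD']
    simp [eT, hb]
  have hXeq : ∀ i, (fderiv ℝ V' q (eX i)).2 i =
      b (EuclideanSpace.single i 1) * (A eT).2 i + (A (eX i)).2 i := by
    intro i
    have : A (b (EuclideanSpace.single i 1), EuclideanSpace.single i 1) =
        b (EuclideanSpace.single i 1) • A eT + A (eX i) := by
      rw [← map_smul, ← map_add]; simp [eT, eX]
    rw [hD']
    simp [eX, hb] at this ⊢
    rw [this]
    simp
  have hbA : b (A eT).2 = ∑ i, b (EuclideanSpace.single i 1) * (A eT).2 i := by
    conv_lhs => rw [← (EuclideanSpace.basisFun (Fin n) ℝ).sum_repr (A eT).2]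
    simp [map_sum, mul_comm]
  simp only [diverg, hTeq, hXeq, Finset.sum_add_distrib, hbA]
  ring

/-! ### Surface measure, and flux bounds localized to patches. -/

/-- `flip` is a Euclidean isometry, and forgetting a coordinate shortens vectors. The norm has to be
that of `WithLp 2`, which defines the Hausdorff measure, and not the sup norm. -/
lemma lipschitzWith_flip_snd (k : Fin n) {ε : ℝ} (hε : ε * ε = 1) :
    LipschitzWith 1 fun z : WithLp 2 (Spacetime n) => (flip k ε z.ofLp).2 := by
  refine LipschitzWith.of_dist_le_mul fun z w => ?_
  rw [NNReal.coe_one, one_mul, dist_eq_norm, dist_eq_norm, ← Prod.snd_sub, ← map_sub,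
    ← WithLp.ofLp_sub]
  set v := z - w
  refine abs_le_of_sq_le_sq' ?_ (norm_nonneg _) |>.2
  have h1 := edot_flip k hε v.ofLp v.ofLp
  rw [edot_self, edot_self] at h1
  rw [WithLp.prod_norm_sq_eq_of_L2]
  have h2 : ‖v.ofLp.1‖ ^ 2 = v.ofLp.1 ^ 2 := by rw [Real.norm_eq_abs, sq_abs]
  have : ‖v.fst‖ ^ 2 + ‖v.snd‖ ^ 2 = v.ofLp.1 ^ 2 + ‖v.ofLp.2‖ ^ 2 := by
    rw [← h2]; rfl
  nlinarith [sq_nonneg (flip k ε v.ofLp).1]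

lemma euclSurfaceMeasure_apply (S : Set (Spacetime n)) :
    euclSurfaceMeasure n S =
      (Measure.euclideanHausdorffMeasure n : Measure (WithLp 2 (Spacetime n)))
        (WithLp.ofLp ⁻¹' S) := by
  rw [euclSurfaceMeasure]
  exact (MeasurableEquiv.toLp 2 (Spacetime n)).symm.map_apply S

/-- The surface measure of a graph dominates the Lebesgue measure of its projection. -/
lemma lintegral_comp_graph_le (k : Fin n) {ε : ℝ} (hε : ε * ε = 1)
    {ψ : EuclideanSpace ℝ (Fin n) → ℝ} (hψ : Continuous ψ) (Γ : Set (Spacetime n))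
    (h : Spacetime n → ℝ≥0∞) :
    ∫⁻ y in {y | flip k ε (ψ y, y) ∈ Γ}, h (flip k ε (ψ y, y)) ≤
      ∫⁻ p in Γ, h p ∂(euclSurfaceMeasure n) := by
  set G : EuclideanSpace ℝ (Fin n) → Spacetime n := fun y => flip k ε (ψ y, y) with hG
  set π : Spacetime n → EuclideanSpace ℝ (Fin n) := fun p => (flip k ε p).2 with hπ
  set Gr : Set (Spacetime n) := {p | (flip k ε p).1 = ψ (flip k ε p).2} with hGr
  have hπc : Continuous π := by fun_prop
  have hGrm : MeasurableSet Gr :=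
    (isClosed_eq (by fun_prop) (by fun_prop)).measurableSet
  have hπG : ∀ y, π (G y) = y := fun y => by simp only [hπ, hG, flip_flip k hε]
  have hGGr : ∀ y, G y ∈ Gr := fun y => by
    show (flip k ε (G y)).1 = ψ (flip k ε (G y)).2
    simp only [hG, flip_flip k hε]
  have hGπ : ∀ p ∈ Gr, G (π p) = p := fun p (hp : (flip k ε p).1 = ψ (flip k ε p).2) => by
    simp only [hG, hπ]
    rw [← hp]
    exact flip_flip k hε p
  set μ := ((euclSurfaceMeasure n).restrict Γ).restrict Gr with hμ
  -- A 1-Lipschitz map does not increase Hausdorff measure; applied to the projection of the graph,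
  -- this replaces the area formula. Neither `Γ` nor `h` need be measurable.
  have hle : (volume : Measure (EuclideanSpace ℝ (Fin n))).restrict {y | G y ∈ Γ} ≤ μ.map π := by
    refine Measure.le_iff.2 fun B hB => ?_
    rw [Measure.restrict_apply hB, Measure.map_apply hπc.measurable hB, hμ,
      Measure.restrict_restrict hGrm, Measure.restrict_apply (hπc.measurable hB),
      euclSurfaceMeasure_apply, ← EuclideanSpace.euclideanHausdorffMeasure_eq_volume n]
    set T : Set (WithLp 2 (Spacetime n)) := WithLp.ofLp ⁻¹' (π ⁻¹' B ∩ (Gr ∩ Γ)) with hT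
    have hsub : B ∩ {y | G y ∈ Γ} ⊆
        (fun z : WithLp 2 (Spacetime n) => (flip k ε z.ofLp).2) '' T := by
      rintro y ⟨hyB, hyΓ⟩
      refine ⟨WithLp.toLp 2 (G y), ⟨?_, hGGr y, hyΓ⟩, hπG y⟩
      show π (G y) ∈ B
      rw [hπG]; exact hyB
    refine (measure_mono hsub).trans ?_
    rw [Measure.euclideanHausdorffMeasure_def, Measure.euclideanHausdorffMeasure_def,
      Measure.smul_apply, Measure.smul_apply]
    have := (lipschitzWith_flip_snd k hε).hausdorffMeasure_image_le (d := n) (by positivity) T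
    simp only [ENNReal.coe_one, ENNReal.one_rpow, one_mul] at this
    exact smul_le_smul_of_nonneg_left this zero_le
  calc ∫⁻ y in {y | G y ∈ Γ}, h (G y) ≤ ∫⁻ y, h (G y) ∂(μ.map π) := lintegral_mono' hle le_rfl
    _ ≤ ∫⁻ p, h (G (π p)) ∂μ := lintegral_map_le _ _
    _ = ∫⁻ p, h p ∂μ := setLIntegral_congr_fun hGrm fun p hp => by simp only [hGπ p hp]
    _ ≤ _ := setLIntegral_le_lintegral _ _

end Spacetime

lemma MeasureTheory.ofReal_integral_le_lintegral_ofReal {X : Type*} [MeasurableSpace X]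
    {μ : Measure X} (f : X → ℝ) : ENNReal.ofReal (∫ x, f x ∂μ) ≤ ∫⁻ x, ENNReal.ofReal (f x) ∂μ := by
  by_cases hf : Integrable f μ
  · rw [integral_eq_lintegral_pos_part_sub_lintegral_neg_part hf]
    refine (ENNReal.ofReal_le_ofReal (sub_le_self _ ENNReal.toReal_nonneg)).trans ?_
    exact ENNReal.ofReal_toReal_le
  · simp [integral_undef hf]

namespace Spacetime

open Filter Topology

variable {n : ℕ} {U : Set (Spacetime n)}

/-- The divergence is a trace, hence invariant under conjugation by an involution. -/
lemma diverg_flip_conj (k : Fin n) {ε : ℝ} (hε : ε * ε = 1) {X : Spacetime n → Spacetime n}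
    {q : Spacetime n} (hX : DifferentiableAt ℝ X (flip k ε q)) :
    diverg (fun q => flip k ε (X (flip k ε q))) q = diverg X (flip k ε q) := by
  set A := fderiv ℝ X (flip k ε q) with hA
  have h1 : HasFDerivAt (fun q => flip k ε (X (flip k ε q)))
      (flip k ε ∘L A ∘L flip k ε) q :=
    (flip k ε).hasFDerivAt.comp q (hX.hasFDerivAt.comp q (flip k ε).hasFDerivAt)
  rw [diverg, h1.fderiv, diverg, ← hA,
    ← Finset.add_sum_erase _ _ (Finset.mem_univ k),
    ← Finset.add_sum_erase (a := k) Finset.univ (fun i => (A (eX i)).2 i) (Finset.mem_univ k)]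
  have h2 : ∑ i ∈ Finset.univ.erase k, ((flip k ε ∘L A ∘L flip k ε) (eX i)).2 i =
      ∑ i ∈ Finset.univ.erase k, (A (eX i)).2 i := by
    refine Finset.sum_congr rfl fun i hi => ?_
    have hik := Finset.ne_of_mem_erase hi
    simp only [ContinuousLinearMap.comp_apply, flip_snd, if_neg hik, flip_eX_of_ne hik]
  rw [h2]
  simp only [ContinuousLinearMap.comp_apply, flip_snd, flip_fst, flip_eX_self, flip_eT, map_smul,
    Prod.smul_fst, Prod.smul_snd, PiLp.smul_apply, smul_eq_mul, if_true]
  linear_combination ((A (eX k)).2 k + (A eT).1) * hε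

lemma diverg_eq_zero_of_notMem_tsupport {X : Spacetime n → Spacetime n} {q : Spacetime n}
    (hq : q ∉ tsupport X) : diverg X q = 0 := by
  simp [diverg, (notMem_tsupport_iff_eventuallyEq.1 hq).fderiv_eq]

lemma IsGraphPatch.mem_closure {W : Set (Spacetime n)} {L : Spacetime n →L[ℝ] Spacetime n}
    {ψ : EuclideanSpace ℝ (Fin n) → ℝ} (h : IsGraphPatch U W L ψ) {q : Spacetime n} (hq : q ∈ W)
    (hle : (L q).1 ≤ ψ (L q).2) : q ∈ closure U := by
  rcases hle.lt_or_eq with h1 | h1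
  · exact subset_closure ((h.mem_iff q hq).2 h1)
  · obtain ⟨ρ, hρ, -⟩ := h.exists_fderiv_eq q hq h1
    exact hρ.mem_closure

/-- The divergence theorem for a field supported in a graph patch. -/
lemma IsGraphPatch.integral_diverg {W : Set (Spacetime n)} {k : Fin n} {ε : ℝ} (hε : ε * ε = 1)
    {ψ : EuclideanSpace ℝ (Fin n) → ℝ} (hψ : ContDiff ℝ 2 ψ)
    (h : IsGraphPatch U W (flip k ε) ψ) (hU : IsOpen U) {X : Spacetime n → Spacetime n}
    (hX : ContDiffOn ℝ 1 X (closure U)) (hc : HasCompactSupport X) (hsup : tsupport X ⊆ W) :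
    ∫ q in U, diverg X q = ∫ y, ((flip k ε (X (flip k ε (ψ y, y)))).1 -
      fderiv ℝ ψ y (flip k ε (X (flip k ε (ψ y, y)))).2) := by
  set L : Spacetime n →L[ℝ] Spacetime n := flip k ε with hL
  have hLL : ∀ q, L (L q) = q := flip_flip k hε
  have hemb : MeasurableEmbedding (L : Spacetime n → Spacetime n) :=
    L.continuous.measurableEmbedding (Function.LeftInverse.injective hLL)
  set X' : Spacetime n → Spacetime n := fun q => L (X (L q)) with hX'
  set D : Set (Spacetime n) := {q | q.1 < ψ q.2} with hD
  have hDo : IsOpen D := isOpen_lt continuous_fst (hψ.continuous.comp continuous_snd)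
  have hzero : ∀ q, L q ∉ tsupport X → (fun q => X (L q)) =ᶠ[𝓝 q] 0 := fun q hq =>
    L.continuous.continuousAt.eventually (notMem_tsupport_iff_eventuallyEq.1 hq)
  have hX's : ContDiffOn ℝ 1 X' {q | q.1 ≤ ψ q.2} := by
    intro q hq
    refine L.contDiff.contDiffAt.comp_contDiffWithinAt q ?_
    by_cases hqs : L q ∈ tsupport X
    · have hW : L ⁻¹' W ∈ 𝓝 q := L.continuous.continuousAt (h.isOpen.mem_nhds (hsup hqs))
      have hmaps : MapsTo L ({q | q.1 ≤ ψ q.2} ∩ L ⁻¹' W) (closure U) := fun z hz =>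
        h.mem_closure hz.2 (by rw [hLL]; exact hz.1)
      have h1 : ContDiffWithinAt ℝ 1 X (closure U) (L q) := hX _ (hmaps ⟨hq, hsup hqs⟩)
      exact (h1.comp q L.contDiff.contDiffWithinAt hmaps).mono_of_mem_nhdsWithin
        (inter_mem_nhdsWithin _ hW)
    · exact (contDiffAt_const.congr_of_eventuallyEq (hzero q hqs)).contDiffWithinAt
  have hX'c : HasCompactSupport X' := by
    refine HasCompactSupport.intro (hc.isCompact.image L.continuous) fun q hq => ?_
    have : L q ∉ tsupport X := fun hh => hq ⟨_, hh, hLL q⟩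
    simp [hX', image_eq_zero_of_notMem_tsupport this]
  rw [← integral_diverg_graph hψ hX's hX'c]
  have h1 : ∫ q in D, diverg X' q = ∫ q in D, diverg X (L q) := by
    refine setIntegral_congr_fun hDo.measurableSet fun q hq => diverg_flip_conj k hε ?_
    by_cases hqs : flip k ε q ∈ tsupport X
    · have hqU : flip k ε q ∈ U := (h.mem_iff _ (hsup hqs)).2 (by rw [hLL]; exact hq)
      exact (hX.contDiffAt (mem_of_superset (hU.mem_nhds hqU) subset_closure)).differentiableAt
        (by simp)
    · exact ((differentiableAt_const (0 : Spacetime n)).congr_of_eventuallyEq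
        (notMem_tsupport_iff_eventuallyEq.1 hqs))
  have hDL : L ⁻¹' (L ⁻¹' D) = D := by ext q; simp [hLL]
  have h2 : ∫ q in D, diverg X (L q) = ∫ q in L ⁻¹' D, diverg X q := by
    rw [← (measurePreserving_flip k hε).setIntegral_preimage_emb hemb (diverg X) (L ⁻¹' D),
      ← hL, hDL]
  rw [h1, h2, ← integral_indicator hU.measurableSet,
    ← integral_indicator (hDo.preimage L.continuous).measurableSet]
  congr 1
  ext q
  by_cases hqs : q ∈ tsupport X
  · have : q ∈ U ↔ q ∈ L ⁻¹' D := h.mem_iff q (hsup hqs)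
    by_cases hqU : q ∈ U
    · rw [indicator_of_mem hqU, indicator_of_mem (this.1 hqU)]
    · rw [indicator_of_notMem hqU, indicator_of_notMem fun hh => hqU (this.2 hh)]
  · simp [indicator, diverg_eq_zero_of_notMem_tsupport hqs]

lemma abs_flip_fst_le_one {v : Spacetime n} (hv : edot v v = 1) : |v.1| ≤ 1 ∧ ‖v.2‖ ≤ 1 := by
  rw [edot_self] at hv
  constructor
  · exact abs_le_one_iff_mul_self_le_one.2 (by nlinarith [sq_nonneg ‖v.2‖])
  · nlinarith [sq_nonneg v.1, norm_nonneg v.2]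

/-- On a graph patch the conormal of the graph is a positive multiple of the Euclidean normal. -/
lemma IsGraphPatch.exists_eq_edot {W : Set (Spacetime n)} {k : Fin n} {ε : ℝ} (hε : ε * ε = 1)
    {ψ : EuclideanSpace ℝ (Fin n) → ℝ}
    (h : IsGraphPatch U W (flip k ε) ψ) {y : EuclideanSpace ℝ (Fin n)}
    (hy : flip k ε (ψ y, y) ∈ W) :
    flip k ε (ψ y, y) ∈ frontier U ∧ ∃ m : ℝ, 0 < m ∧ m ≤ 1 + ‖fderiv ℝ ψ y‖ ∧
      ∀ v, (flip k ε v).1 - fderiv ℝ ψ y (flip k ε v).2 =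
        m * edot v (euclNormal U (flip k ε (ψ y, y))) := by
  have hLL := flip_flip k hε (ψ y, y)
  obtain ⟨ρ, hρ, c, hc, hcv⟩ := h.exists_fderiv_eq _ hy (by rw [hLL])
  obtain ⟨c', hc', hcv'⟩ := hρ.exists_fderiv_eq_edot
  rw [hLL] at hcv
  set ν := euclNormal U (flip k ε (ψ y, y)) with hν
  have hform : ∀ v, (flip k ε v).1 - fderiv ℝ ψ y (flip k ε v).2 = c' / c * edot v ν := by
    intro v
    have := (hcv v).symm.trans (hcv' v)
    field_simp
    linarith
  refine ⟨hρ.mem_frontier, c' / c, div_pos hc' hc, ?_, hform⟩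
  -- Evaluating the identity `hform` at the unit vector `ν` isolates the factor `c' / c`, which is
  -- thereby bounded.
  have h1 : edot ν ν = 1 := hρ.edot_euclNormal_self
  have h2 := hform ν
  rw [h1, mul_one] at h2
  have h3 := abs_flip_fst_le_one ((edot_flip k hε ν ν).trans h1)
  rw [← h2]
  have h4 : |fderiv ℝ ψ y (flip k ε ν).2| ≤ ‖fderiv ℝ ψ y‖ := by
    refine ((fderiv ℝ ψ y).le_opNorm _).trans ?_
    exact mul_le_of_le_one_right (norm_nonneg _) h3.2
  linarith [(abs_le.1 h3.1).2, (abs_le.1 h4).1]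

/-- The inward flux of `Y` through the boundary is dominated by `h` on `Γ`, and nonpositive
elsewhere. -/
def InwardFluxLE (U : Set (Spacetime n)) (Y : Spacetime n → Spacetime n) (Γ : Set (Spacetime n))
    (h : Spacetime n → ℝ≥0∞) : Prop :=
  ∀ p ∈ frontier U, ENNReal.ofReal (-edot (Y p) (euclNormal U p)) ≤ Γ.indicator h p

/-- `C` bounds the flux of fields localized to `W`. -/
def IsFluxConstant (U W : Set (Spacetime n)) (C : ℝ≥0) : Prop :=
  ∀ (Y : Spacetime n → Spacetime n) (Γ : Set (Spacetime n)) (h : Spacetime n → ℝ≥0∞)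
    (χ : Spacetime n → ℝ), ContDiffOn ℝ 1 Y (closure U) → InwardFluxLE U Y Γ h →
    ContDiff ℝ 1 χ → (∀ p, 0 ≤ χ p) → (∀ p, χ p ≤ 1) → HasCompactSupport χ → tsupport χ ⊆ W →
    ENNReal.ofReal (-∫ p in U, diverg (fun p => χ p • Y p) p) ≤
      C * ∫⁻ p in Γ, h p ∂(euclSurfaceMeasure n)

/-- The conormal of the graph is `m` times the Euclidean normal with `m ≤ 1 + ‖fderiv ℝ ψ y‖`, which
is bounded on a bounded patch. The flux, an integral over the projection, is then compared with the
surface integral by `lintegral_comp_graph_le`. -/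
lemma IsGraphPatch.exists_isFluxConstant {W : Set (Spacetime n)} {k : Fin n} {ε : ℝ}
    (hε : ε * ε = 1) {ψ : EuclideanSpace ℝ (Fin n) → ℝ} (hψ : ContDiff ℝ 2 ψ)
    (hW : IsGraphPatch U W (flip k ε) ψ) (hU : IsOpen U) (hWb : Bornology.IsBounded W) :
    ∃ C, IsFluxConstant U W C := by
  have hK : IsCompact ((fun p => (flip k ε p).2) '' closure W) :=
    hWb.isCompact_closure.image (by fun_prop)
  obtain ⟨M, hM⟩ := hK.exists_bound_of_continuousOn
    (hψ.continuous_fderiv (by simp)).continuousOn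
  refine ⟨(1 + M).toNNReal, fun Y Γ h χ hY hflux hχ hχ0 hχ1 hχc hχs => ?_⟩
  have hts : tsupport (fun p => χ p • Y p) ⊆ tsupport χ :=
    tsupport_smul_subset_left χ Y
  rw [hW.integral_diverg hε hψ hU (X := fun p => χ p • Y p) (hχ.contDiffOn.smul hY)
      hχc.smul_right (hts.trans hχs),
    ← integral_neg]
  refine (ofReal_integral_le_lintegral_ofReal _).trans ?_
  set G : EuclideanSpace ℝ (Fin n) → Spacetime n := fun y => flip k ε (ψ y, y) with hG
  have hpt : ∀ y, ENNReal.ofReal (-((flip k ε (χ (G y) • Y (G y))).1 -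
      fderiv ℝ ψ y (flip k ε (χ (G y) • Y (G y))).2)) ≤
      {y | G y ∈ Γ}.indicator (fun y => ((1 + M).toNNReal : ℝ≥0∞) * h (G y)) y := by
    intro y
    by_cases hy : G y ∈ W
    · obtain ⟨hfr, m, hm0, hm1, hm⟩ := hW.exists_eq_edot hε hy
      have hfl := hflux _ hfr
      have hmM : m ≤ 1 + M := hm1.trans (by
        have := hM y ⟨G y, subset_closure hy, by simp only [hG, flip_flip k hε]⟩
        linarith)
      rw [hm, edot_comm, edot_smul_right, edot_comm]
      set e := edot (Y (G y)) (euclNormal U (G y)) with he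
      have h1 : -(m * (χ (G y) * e)) = (m * χ (G y)) * (-e) := by ring
      have h2 : m * χ (G y) ≤ 1 + M :=
        (mul_le_of_le_one_right hm0.le (hχ1 _)).trans hmM
      have h3 : ENNReal.ofReal (-(m * (χ (G y) * e))) ≤
          ((1 + M).toNNReal : ℝ≥0∞) * ENNReal.ofReal (-e) := by
        rw [h1, ENNReal.ofReal_mul (mul_nonneg hm0.le (hχ0 _))]
        exact mul_le_mul_left (ENNReal.ofReal_le_ofReal h2) _
      refine h3.trans ((mul_le_mul_right hfl _).trans ?_)
      by_cases hΓ : G y ∈ Γ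
      · rw [indicator_of_mem hΓ, indicator_of_mem (by exact hΓ)]
      · rw [indicator_of_notMem hΓ, mul_zero]; exact zero_le
    · have : χ (G y) = 0 := image_eq_zero_of_notMem_tsupport fun hh => hy (hχs hh)
      simp [this]
  refine (lintegral_mono hpt).trans ((lintegral_indicator_le _ _).trans ?_)
  rw [lintegral_const_mul' _ _ ENNReal.coe_ne_top]
  exact mul_le_mul_right (lintegral_comp_graph_le k hε hψ.continuous Γ h) _

lemma integral_diverg_eq_zero {X : Spacetime n → Spacetime n} (hX : ContDiff ℝ 1 X)
    (hc : HasCompactSupport X) : ∫ p, diverg X p = 0 := by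
  have hd : ∀ p, HasFDerivAt X (fderiv ℝ X p) p := fun p =>
    (hX.contDiffAt.differentiableAt (by simp)).hasFDerivAt
  have hcc : ∀ v, HasCompactSupport fun p => fderiv ℝ X p v := fun v => hc.fderiv_apply ℝ v
  have hcon : ∀ v, Continuous fun p => fderiv ℝ X p v := fun v =>
    (hX.continuous_fderiv (by simp)).clm_apply continuous_const
  have key : ∀ (A : Spacetime n →L[ℝ] ℝ) (v : Spacetime n),
      Integrable (fun p => A (fderiv ℝ X p v)) ∧ ∫ p, A (fderiv ℝ X p v) = 0 := by
    intro A v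
    have h1 : ∀ p, HasFDerivAt (fun p => A (X p)) (A ∘L fderiv ℝ X p) p := fun p =>
      A.hasFDerivAt.comp p (hd p)
    have h2 : ∀ p, fderiv ℝ (fun p => A (X p)) p v = A (fderiv ℝ X p v) := fun p => by
      rw [(h1 p).fderiv]; rfl
    have h3 : Integrable (fun p => A (fderiv ℝ X p v)) :=
      (A.continuous.comp (hcon v)).integrable_of_hasCompactSupport
        ((hcc v).comp_left (map_zero A))
    refine ⟨h3, ?_⟩
    simp only [← h2] at h3 ⊢
    refine integral_fderiv_apply_eq_zero (fun p => (h1 p).differentiableAt) ?_ h3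
    exact (A.continuous.comp hX.continuous).integrable_of_hasCompactSupport
        (hc.comp_left (map_zero A))
  have hT := key (ContinuousLinearMap.fst ℝ ℝ _) eT
  have hS := fun i => key (EuclideanSpace.proj i ∘L ContinuousLinearMap.snd ℝ ℝ _) (eX i)
  have : diverg X = fun p => ContinuousLinearMap.fst ℝ ℝ _ (fderiv ℝ X p eT) +
      ∑ i, (EuclideanSpace.proj i ∘L ContinuousLinearMap.snd ℝ ℝ _) (fderiv ℝ X p (eX i)) := rfl
  rw [this, integral_add hT.1 (integrable_finsetSum _ fun i _ => (hS i).1), hT.2,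
    integral_finsetSum _ fun i _ => (hS i).1, Finset.sum_eq_zero fun i _ => (hS i).2, add_zero]

/-- Interior patches contribute nothing: the cut-off field is a compactly supported `C¹` field on
the whole space. -/
lemma isFluxConstant_self (hU : IsOpen U) : IsFluxConstant U U 0 := by
  intro Y Γ h χ hY _ hχ _ _ hχc hχs
  have hts : tsupport (fun p => χ p • Y p) ⊆ tsupport χ :=
    tsupport_smul_subset_left χ Y
  have hX : ContDiff ℝ 1 fun p => χ p • Y p := by
    refine contDiff_iff_contDiffAt.2 fun p => ?_
    by_cases hp : p ∈ tsupport χ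
    · exact hχ.contDiffAt.smul (hY.contDiffAt (mem_of_superset (hU.mem_nhds (hχs hp))
        subset_closure))
    · exact contDiffAt_const.congr_of_eventuallyEq
        (notMem_tsupport_iff_eventuallyEq.1 fun hh => hp (hts hh))
  have h0 := integral_diverg_eq_zero hX hχc.smul_right
  rw [setIntegral_eq_integral_of_forall_compl_eq_zero, h0]
  · simp
  · exact fun p hp => diverg_eq_zero_of_notMem_tsupport fun hh => hp (hχs (hts hh))

lemma IsFluxConstant.mono {W W' : Set (Spacetime n)} {C : ℝ≥0} (h : IsFluxConstant U W C)
    (hW : W' ⊆ W) : IsFluxConstant U W' C :=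
  fun Y Γ g χ hY hf hχ h0 h1 hc hs => h Y Γ g χ hY hf hχ h0 h1 hc (hs.trans hW)

lemma IsGTC.integrableOn_diverg (hU : IsGTC U) {X : Spacetime n → Spacetime n}
    (hX : ContDiffOn ℝ 1 X (closure U)) (hc : HasCompactSupport X) :
    IntegrableOn (diverg X) U := by
  obtain ⟨M, hM0, hM⟩ := exists_bound_fderiv hU.uniqueDiffOn isClosed_closure hU.isOpen
    subset_closure hX hc
  rw [← integrable_indicator_iff hU.isOpen.measurableSet]
  refine integrable_of_bounded_of_isCompact
    ((measurable_diverg X).indicator hU.isOpen.measurableSet)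
    (M := M * ‖(eT : Spacetime n)‖ + ∑ i, M * ‖(eX i : Spacetime n)‖) (fun q => ?_) hc.isCompact
    (fun q hq => by simp [indicator, diverg_eq_zero_of_notMem_tsupport hq])
  by_cases hq : q ∈ U
  · rw [indicator_of_mem hq, diverg]
    refine (abs_add_le _ _).trans (add_le_add ?_ ((Finset.abs_sum_le_sum_abs _ _).trans
      (Finset.sum_le_sum fun i _ => ?_)))
    · exact (norm_fst_le _).trans (ContinuousLinearMap.le_of_opNorm_le _ (hM q hq) _)
    · exact (abs_snd_apply_le _ _).trans (ContinuousLinearMap.le_of_opNorm_le _ (hM q hq) _)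
  · rw [indicator_of_notMem hq, abs_zero]
    positivity

lemma diverg_sum {ι : Type*} (s : Finset ι) {X : ι → Spacetime n → Spacetime n} {p : Spacetime n}
    (hX : ∀ i ∈ s, DifferentiableAt ℝ (X i) p) :
    diverg (fun q => ∑ i ∈ s, X i q) p = ∑ i ∈ s, diverg (X i) p := by
  have h1 : fderiv ℝ (fun q => ∑ i ∈ s, X i q) p = ∑ i ∈ s, fderiv ℝ (X i) p :=
    fderiv_fun_sum hX
  simp only [diverg, h1, sum_apply, Prod.fst_sum, Prod.snd_sum,
    WithLp.ofLp_sum, Finset.sum_apply, Finset.sum_add_distrib]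
  rw [Finset.sum_comm]

/-- The flux of a field through the part of the boundary in a time slab is controlled by the surface
integral of a bound for the inward normal component. -/
theorem IsGTC.exists_flux_bound (hU : IsGTC U) (hn : 1 ≤ n) (a b : ℝ) :
    ∃ C : ℝ≥0, ∀ (Y : Spacetime n → Spacetime n) (Γ : Set (Spacetime n)) (h : Spacetime n → ℝ≥0∞),
      ContDiffOn ℝ 1 Y (closure U) → InwardFluxLE U Y Γ h →
      (∀ p ∈ U, p.1 ∉ Icc a b → Y p = 0) →
      ENNReal.ofReal (-∫ p in U, diverg Y p) ≤ C * ∫⁻ p in Γ, h p ∂(euclSurfaceMeasure n) := by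
  set K := closure U ∩ Prod.fst ⁻¹' Icc a b with hK
  have hKc : IsCompact K := hU.isCompact_slab hn a b
  -- Interior points have flux constant zero; at boundary points a graph patch is intersected with a
  -- ball to make it bounded.
  have hloc : ∀ p ∈ K, ∃ (W : Set (Spacetime n)) (C : ℝ≥0), p ∈ W ∧ IsOpen W ∧
      Bornology.IsBounded W ∧ IsFluxConstant U W C := by
    intro p hp
    by_cases hpU : p ∈ U
    · exact ⟨U ∩ Metric.ball p 1, 0, ⟨hpU, Metric.mem_ball_self one_pos⟩,
        hU.isOpen.inter Metric.isOpen_ball, Metric.isBounded_ball.subset inter_subset_right,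
        (isFluxConstant_self hU.isOpen).mono inter_subset_left⟩
    · obtain ⟨k, ε, ψ, W, hε, hψ, hpW, hW⟩ :=
        hU.exists_graphPatch (hU.mem_frontier_iff.2 ⟨hp.1, hpU⟩)
      have hW' : IsGraphPatch U (W ∩ Metric.ball p 1) (flip k ε) ψ :=
        ⟨hW.isOpen.inter Metric.isOpen_ball, fun q hq => hW.mem_iff q hq.1,
          fun q hq => hW.exists_fderiv_eq q hq.1⟩
      have hb : Bornology.IsBounded (W ∩ Metric.ball p 1) :=
        Metric.isBounded_ball.subset inter_subset_right
      obtain ⟨C, hC⟩ := hW'.exists_isFluxConstant hε hψ hU.isOpen hb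
      exact ⟨W ∩ Metric.ball p 1, C, ⟨hpW, Metric.mem_ball_self one_pos⟩, hW'.isOpen, hb, hC⟩
  choose! W C hpW hWo hWb hWC using hloc
  obtain ⟨t, htK, hcov⟩ := hKc.elim_nhds_subcover W fun p hp => (hWo p hp).mem_nhds (hpW p hp)
  obtain ⟨f, hf⟩ := SmoothPartitionOfUnity.exists_isSubordinate
    (modelWithCornersSelf ℝ (Spacetime n)) hKc.isClosed
    (fun i : t => W i) (fun i => hWo i (htK i i.2)) (fun p hp => by
      obtain ⟨q, hq, hpq⟩ := mem_iUnion₂.1 (hcov hp)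
      exact mem_iUnion.2 ⟨⟨q, hq⟩, hpq⟩)
  -- The cover is chosen before the field, so the constant depends only on `U` and the slab.
  refine ⟨∑ i : t, C i, fun Y Γ h hY hflux h0 => ?_⟩
  have hχ : ∀ i : t, ContDiff ℝ 1 (f i) := fun i =>
    ((f i).contMDiff.contDiff).of_le (by norm_cast)
  have hχc : ∀ i : t, HasCompactSupport (f i) := fun i =>
    ((hWb i (htK i i.2)).isCompact_closure).of_isClosed_subset (isClosed_tsupport _)
      ((hf i).trans subset_closure)
  have hYi : ∀ i : t, ContDiffOn ℝ 1 (fun p => f i p • Y p) (closure U) := fun i =>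
    (hχ i).contDiffOn.smul hY
  -- Outside the slab the partition need not sum to one, but there `Y` vanishes.
  have hsum : ∀ p ∈ U, Y p = ∑ i : t, f i p • Y p := by
    intro p hp
    by_cases hpK : p.1 ∈ Icc a b
    · have := f.sum_eq_one (x := p) ⟨subset_closure hp, hpK⟩
      rw [finsum_eq_sum_of_fintype] at this
      rw [← Finset.sum_smul, this, one_smul]
    · simp [h0 p hp hpK]
  have hdiv : ∀ p ∈ U, diverg Y p = ∑ i : t, diverg (fun p => f i p • Y p) p := by
    intro p hp
    have hev : Y =ᶠ[𝓝 p] fun p => ∑ i : t, f i p • Y p := by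
      filter_upwards [hU.isOpen.mem_nhds hp] with q hq using hsum q hq
    have : diverg Y p = diverg (fun p => ∑ i : t, f i p • Y p) p := by
      simp only [diverg, hev.fderiv_eq]
    rw [this]
    exact diverg_sum _ fun i _ => ((hYi i).contDiffAt (mem_of_superset (hU.isOpen.mem_nhds hp)
      subset_closure)).differentiableAt (by simp)
  rw [setIntegral_congr_fun hU.isOpen.measurableSet hdiv, integral_finsetSum _ fun i _ =>
    hU.integrableOn_diverg (hYi i) (hχc i).smul_right, ← Finset.sum_neg_distrib]
  refine (Finset.le_sum_of_subadditive ENNReal.ofReal ENNReal.ofReal_zero.le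
    (fun _ _ => ENNReal.ofReal_add_le) _ _).trans ?_
  push_cast
  rw [Finset.sum_mul]
  exact Finset.sum_le_sum fun i _ => hWC i (htK i i.2) Y Γ h (f i) hY hflux (hχ i)
    (f.nonneg i) (f.le_one i) (hχc i) (hf i)

end Spacetime

/-! ### Smooth cutoffs in time. -/

open Filter Topology

lemma deriv_smoothTransition_of_notMem {u : ℝ} (hu : u ∉ Icc (0 : ℝ) 1) :
    deriv Real.smoothTransition u = 0 := by
  rcases lt_or_ge u 0 with h | h
  · have : Real.smoothTransition =ᶠ[𝓝 u] fun _ => 0 := by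
      filter_upwards [gt_mem_nhds h] with v hv using Real.smoothTransition.zero_of_nonpos hv.le
    rw [this.deriv_eq]; simp
  · have h1 : 1 < u := not_le.1 fun h' => hu ⟨h, h'⟩
    have : Real.smoothTransition =ᶠ[𝓝 u] fun _ => 1 := by
      filter_upwards [lt_mem_nhds h1] with v hv using Real.smoothTransition.one_of_one_le hv.le
    rw [this.deriv_eq]; simp

lemma integral_deriv_smoothTransition_mul (g : ℝ → ℝ) :
    ∫ u, deriv Real.smoothTransition u * g u =
      ∫ u in (0 : ℝ)..1, deriv Real.smoothTransition u * g u := by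
  rw [intervalIntegral.integral_of_le zero_le_one, ← integral_Icc_eq_integral_Ioc,
    setIntegral_eq_integral_of_forall_compl_eq_zero]
  intro u hu
  rw [deriv_smoothTransition_of_notMem hu, zero_mul]

lemma continuous_deriv_smoothTransition : Continuous (deriv Real.smoothTransition) :=
  (Real.smoothTransition.contDiff (n := 1)).continuous_deriv (by simp)

/-- The offset `d` places the bump on `[c, c + ε]` if `d = 0` and on `[c - ε, c]` if `d = 1`. -/
lemma integral_rescaled_bump {ε : ℝ} (hε : 0 < ε) (c d : ℝ) (H : ℝ → ℝ) :
    ∫ t, ε⁻¹ * deriv Real.smoothTransition ((t - c) / ε + d) * H t =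
      ∫ u in (0 : ℝ)..1, deriv Real.smoothTransition u * H (c + ε * (u - d)) := by
  rw [← integral_deriv_smoothTransition_mul fun u => H (c + ε * (u - d))]
  set g : ℝ → ℝ := fun u => deriv Real.smoothTransition u * H (c + ε * (u - d)) with hg
  have h1 : ∀ t, ε⁻¹ * deriv Real.smoothTransition ((t - c) / ε + d) * H t =
      ε⁻¹ * g ((t - c) / ε + d) := by
    intro t
    have : c + ε * ((t - c) / ε + d - d) = t := by field_simp; ring
    simp only [hg, this]; ring
  simp only [h1, integral_const_mul]
  rw [integral_sub_right_eq_self (fun t => g (t / ε + d)) c,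
    Measure.integral_comp_div (fun x => g (x + d)) ε, integral_add_right_eq_self g d,
    abs_of_pos hε, smul_eq_mul, ← mul_assoc, inv_mul_cancel₀ hε.ne', one_mul]

/-- The bump has total mass one, and its integral against `H`, in the rescaled variable, is
continuous in `ε` up to `ε = 0`. -/
lemma tendsto_integral_bump {H : ℝ → ℝ} (hH : Continuous H) (c d : ℝ) {ε : ℕ → ℝ}
    (hε : Tendsto ε atTop (𝓝 0)) :
    Tendsto (fun k => ∫ u in (0 : ℝ)..1, deriv Real.smoothTransition u * H (c + ε k * (u - d)))
      atTop (𝓝 (H c)) := by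
  have hcont : Continuous fun e : ℝ =>
      ∫ u in (0 : ℝ)..1, deriv Real.smoothTransition u * H (c + e * (u - d)) := by
    refine intervalIntegral.continuous_parametric_intervalIntegral_of_continuous'
      (f := fun e u => deriv Real.smoothTransition u * H (c + e * (u - d))) ?_ 0 1
    have := continuous_deriv_smoothTransition
    simp only [Function.uncurry_def]
    fun_prop
  have h1 := (hcont.tendsto 0).comp hε
  have h2 : ∫ u in (0 : ℝ)..1, deriv Real.smoothTransition u * H (c + 0 * (u - d)) = H c := by
    simp only [zero_mul, add_zero, intervalIntegral.integral_mul_const]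
    rw [intervalIntegral.integral_deriv_eq_sub]
    · simp
    · exact fun x _ => (Real.smoothTransition.contDiff (n := 1)).contDiffAt.differentiableAt
        (by simp)
    · exact continuous_deriv_smoothTransition.intervalIntegrable _ _
  rw [h2] at h1
  exact h1

/-- Smooth cutoffs that approximate the indicator of an interval. -/
lemma exists_cutoff_seq {τm τp : ℝ} (hτ : τm < τp) :
    ∃ θ : ℕ → ℝ → ℝ, (∀ k, ContDiff ℝ 1 (θ k)) ∧ (∀ k t, 0 ≤ θ k t) ∧ (∀ k t, θ k t ≤ 1) ∧
      (∀ k t, t ∉ Ioo τm τp → θ k t = 0) ∧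
      ∀ H : ℝ → ℝ, Continuous H →
        Tendsto (fun k => ∫ t, deriv (θ k) t * H t) atTop (𝓝 (H τm - H τp)) := by
  set ε : ℕ → ℝ := fun k => (τp - τm) / (k + 1) with hε
  have hl : 0 < τp - τm := sub_pos.2 hτ
  have hε0 : ∀ k, 0 < ε k := fun k => by positivity
  have hεt : Tendsto ε atTop (𝓝 0) := by
    have := (tendsto_one_div_add_atTop_nhds_zero_nat (𝕜 := ℝ)).const_mul (τp - τm)
    simpa [hε, div_eq_mul_inv] using this
  have hS : ContDiff ℝ 1 Real.smoothTransition := Real.smoothTransition.contDiff (n := 1)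
  -- The first term rises on `[τm, τm + ε k]` and the second on `[τp - ε k, τp]`, so `θ k` lives
  -- inside the interval. For `k = 0` the two transitions coincide and `θ 0 = 0`, which is harmless.
  set θ : ℕ → ℝ → ℝ := fun k t => Real.smoothTransition ((t - τm) / ε k + 0) -
    Real.smoothTransition ((t - τp) / ε k + 1) with hθ
  have hle : ∀ k t, (t - τp) / ε k + 1 ≤ (t - τm) / ε k + 0 := by
    intro k t
    have h1 : (t - τm) / ε k = (t - τp) / ε k + (τp - τm) / ε k := by ring
    have h2 : (τp - τm) / ε k = k + 1 := by
      simp only [hε]; field_simp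
    rw [h1, h2]
    have : (0 : ℝ) ≤ k := Nat.cast_nonneg k
    linarith
  have hd : ∀ k c d t, HasDerivAt (fun t => Real.smoothTransition ((t - c) / ε k + d))
      ((ε k)⁻¹ * deriv Real.smoothTransition ((t - c) / ε k + d)) t := by
    intro k c d t
    have h1 : HasDerivAt (fun t => (t - c) / ε k + d) (1 / ε k) t :=
      (((hasDerivAt_id t).sub_const c).div_const (ε k)).add_const d
    have h2 : HasDerivAt Real.smoothTransition _ ((t - c) / ε k + d) :=
      (hS.contDiffAt.differentiableAt (by simp)).hasDerivAt
    have := h2.comp t h1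
    rw [mul_comm, ← one_div]; exact this
  have hcs : ∀ k (c d : ℝ) (H : ℝ → ℝ), Continuous H → Integrable fun t =>
      (ε k)⁻¹ * deriv Real.smoothTransition ((t - c) / ε k + d) * H t := by
    intro k c d H hH
    have := continuous_deriv_smoothTransition
    refine Continuous.integrable_of_hasCompactSupport (by fun_prop) ?_
    refine HasCompactSupport.intro (isCompact_Icc (a := c - d * ε k) (b := c + (1 - d) * ε k))
      fun t ht => ?_
    rw [deriv_smoothTransition_of_notMem]
    · simp
    · intro h
      apply ht
      have h3 := h.1
      have h4 := h.2
      have h5 : (t - c) / ε k * ε k = t - c := div_mul_cancel₀ _ (hε0 k).ne'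
      constructor <;> nlinarith [hε0 k]
  refine ⟨θ, fun k => ?_, fun k t => ?_, fun k t => ?_, fun k t ht => ?_, fun H hH => ?_⟩
  · exact (hS.comp (by fun_prop)).sub (hS.comp (by fun_prop))
  · exact sub_nonneg.2 (Real.smoothTransition.monotone (hle k t))
  · have h1 := Real.smoothTransition.le_one ((t - τm) / ε k + 0)
    have h2 := Real.smoothTransition.nonneg ((t - τp) / ε k + 1)
    simp only [hθ]; linarith
  · rcases le_or_gt t τm with h | h
    · have h1 : (t - τm) / ε k + 0 ≤ 0 := by
        rw [add_zero]; exact div_nonpos_of_nonpos_of_nonneg (by linarith) (hε0 k).le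
      simp only [hθ]
      rw [Real.smoothTransition.zero_of_nonpos h1,
        Real.smoothTransition.zero_of_nonpos ((hle k t).trans h1), sub_zero]
    · have h0 : τp ≤ t := not_lt.1 fun h' => ht ⟨h, h'⟩
      have h1 : 1 ≤ (t - τp) / ε k + 1 := by
        have := div_nonneg (sub_nonneg.2 h0) (hε0 k).le
        linarith
      simp only [hθ]
      rw [Real.smoothTransition.one_of_one_le h1,
        Real.smoothTransition.one_of_one_le (h1.trans (hle k t)), sub_self]
  · have h1 : ∀ k, ∫ t, deriv (θ k) t * H t =
        (∫ u in (0 : ℝ)..1, deriv Real.smoothTransition u * H (τm + ε k * (u - 0))) -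
        ∫ u in (0 : ℝ)..1, deriv Real.smoothTransition u * H (τp + ε k * (u - 1)) := by
      intro k
      rw [← integral_rescaled_bump (hε0 k), ← integral_rescaled_bump (hε0 k),
        ← integral_sub (hcs k τm 0 H hH) (hcs k τp 1 H hH)]
      refine integral_congr_ae (Eventually.of_forall fun t => ?_)
      simp only [hθ]
      rw [((hd k τm 0 t).fun_sub (hd k τp 1 t)).deriv]
      ring
    simp only [h1]
    exact (tendsto_integral_bump hH τm 0 hεt).sub (tendsto_integral_bump hH τp 1 hεt)

/-! ### Slice integrals and the divergence inequality in a time slab. -/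

namespace Spacetime

variable {n : ℕ} {U : Set (Spacetime n)}

lemma IsGraphPatch.eq_of_mem_frontier {W : Set (Spacetime n)}
    {L : Spacetime n →L[ℝ] Spacetime n} {ψ : EuclideanSpace ℝ (Fin n) → ℝ} (hψ : Continuous ψ)
    (h : IsGraphPatch U W L ψ) (hU : IsOpen U) {q : Spacetime n} (hq : q ∈ W)
    (hqf : q ∈ frontier U) : (L q).1 = ψ (L q).2 := by
  rw [hU.frontier_eq] at hqf
  refine le_antisymm ?_ (not_lt.1 fun hlt => hqf.2 ((h.mem_iff q hq).2 hlt))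
  by_contra! hlt
  have hopen : IsOpen (W ∩ {z | ψ (L z).2 < (L z).1}) :=
    h.isOpen.inter (isOpen_lt (by fun_prop) (by fun_prop))
  obtain ⟨z, ⟨hzW, hz⟩, hzU⟩ := mem_closure_iff.1 hqf.1 _ hopen ⟨hq, hlt⟩
  exact absurd ((h.mem_iff z hzW).1 hzU) (not_lt.2 (le_of_lt hz))

/-- Within a patch the slice of the boundary satisfies an equation that determines `y k` from the
other coordinates. Distinct translates along that axis are therefore disjoint, and infinitely many
of them by bounded vectors force measure zero. -/
lemma IsGTC.volume_slice_frontier (hU : IsGTC U) (τ : ℝ) :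
    volume {y : EuclideanSpace ℝ (Fin n) | (τ, y) ∈ frontier U} = 0 := by
  refine measure_null_of_locally_null _ fun y hy => ?_
  obtain ⟨k, ε, ψ, W, hε, hψ, hpW, hW⟩ := hU.exists_graphPatch hy
  have hτc : Continuous fun z : EuclideanSpace ℝ (Fin n) => ((τ, z) : Spacetime n) := by fun_prop
  refine ⟨{y | (τ, y) ∈ frontier U} ∩ (fun z => (τ, z)) ⁻¹' W, inter_mem_nhdsWithin _
    (hτc.continuousAt (hW.isOpen.mem_nhds hpW)), ?_⟩
  set A : Set (EuclideanSpace ℝ (Fin n)) :=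
    {z | (flip k ε (τ, z)).1 = ψ (flip k ε (τ, z)).2} with hA
  have hψc := hψ.continuous
  have hAm : MeasurableSet A := (isClosed_eq (by fun_prop) (by fun_prop)).measurableSet
  refine measure_mono_null (t := A)
    (fun z hz => hW.eq_of_mem_frontier hψc hU.isOpen hz.2 hz.1) ?_
  refine Measure.addHaar_eq_zero_of_disjoint_translates volume
    (fun m : ℕ => ((m + 1 : ℝ)⁻¹) • EuclideanSpace.single k (1 : ℝ)) ?_ ?_ hAm
  · refine (Metric.isBounded_closedBall (x := (0 : EuclideanSpace ℝ (Fin n)))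
      (r := 1)).subset ?_
    rintro _ ⟨m, rfl⟩
    rw [mem_closedBall_zero_iff, norm_smul, EuclideanSpace.single, PiLp.norm_single, norm_one,
      mul_one,
      norm_inv, Real.norm_eq_abs, abs_of_pos (by positivity)]
    exact inv_le_one_of_one_le₀ (by simp)
  · intro i j hij
    refine Set.disjoint_left.2 fun z hzi hzj => hij ?_
    obtain ⟨-, rfl, z₁, hz₁, e₁⟩ := hzi
    obtain ⟨-, rfl, z₂, hz₂, e₂⟩ := hzj
    have hz₁' : (flip k ε (τ, z₁)).1 = ψ (flip k ε (τ, z₁)).2 := hz₁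
    have hz₂' : (flip k ε (τ, z₂)).1 = ψ (flip k ε (τ, z₂)).2 := hz₂
    simp only at e₁ e₂
    have hcoord : ∀ l, z₁ l + (if l = k then ((i + 1 : ℝ)⁻¹) else 0) =
        z₂ l + (if l = k then ((j + 1 : ℝ)⁻¹) else 0) := by
      intro l
      have := congrArg (fun v : EuclideanSpace ℝ (Fin n) => v l) (e₁.trans e₂.symm)
      simp only [PiLp.add_apply, PiLp.smul_apply, EuclideanSpace.single, PiLp.single_apply,
        smul_eq_mul, mul_ite, mul_one, mul_zero] at this
      linarith
    have hsnd : (flip k ε (τ, z₁)).2 = (flip k ε (τ, z₂)).2 := by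
      ext l
      rw [flip_snd, flip_snd]
      by_cases hl : l = k
      · simp [hl]
      · have := hcoord l
        simpa [hl] using this
    have h1 : ε * z₁ k = ε * z₂ k := by
      rw [hsnd, ← hz₂', flip_fst, flip_fst] at hz₁'
      exact hz₁'
    have hε0 : ε ≠ 0 := fun h => by simp [h] at hε
    have h2 := mul_left_cancel₀ hε0 h1
    have h3 := hcoord k
    rw [h2] at h3
    simp only [if_true, add_right_inj, inv_inj] at h3
    have h4 : (i : ℝ) = j := by linarith
    exact_mod_cast h4

/-- Slice integrals of a function that is continuous up to the boundary. -/
noncomputable def sliceInt (U : Set (Spacetime n)) (G : Spacetime n → ℝ) (t : ℝ) : ℝ :=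
  ∫ y in slice U t, G (t, y)

lemma IsGTC.exists_bound (hU : IsGTC U) (hn : 1 ≤ n) {F : Type*} [NormedAddCommGroup F]
    {G : Spacetime n → F}
    (hG : ContinuousOn G (closure U)) (a b : ℝ) :
    ∃ M : ℝ, 0 ≤ M ∧ ∀ p ∈ closure U, p.1 ∈ Icc a b → ‖G p‖ ≤ M := by
  obtain ⟨M, hM⟩ := (hU.isCompact_slab hn a b).exists_bound_of_continuousOn
    (hG.mono inter_subset_left)
  exact ⟨max M 0, le_max_right _ _, fun p hp hpt => (hM p ⟨hp, hpt⟩).trans (le_max_left _ _)⟩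

lemma continuousOn_slice {G : Spacetime n → ℝ} (hG : ContinuousOn G (closure U)) (t : ℝ) :
    ContinuousOn (fun y => G (t, y)) (slice U t) :=
  hG.comp (by fun_prop) fun _ hy => subset_closure hy

lemma IsGTC.integrableOn_slice (hU : IsGTC U) (hn : 1 ≤ n) {G : Spacetime n → ℝ}
    (hG : ContinuousOn G (closure U)) (t : ℝ) :
    IntegrableOn (fun y => G (t, y)) (slice U t) := by
  obtain ⟨M, hM0, hM⟩ := hU.exists_bound hn hG t t
  refine ⟨(continuousOn_slice hG t).aestronglyMeasurable (hU.slice_open t).measurableSet,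
    HasFiniteIntegral.restrict_of_bounded M (hU.slice_bounded t).measure_lt_top ?_⟩
  filter_upwards [ae_restrict_mem (hU.slice_open t).measurableSet] with y hy
  exact hM (t, y) (subset_closure hy) (by simp)

/-- Dominated convergence. For fixed `y` the extension of `G` by zero is continuous at `(t₀, y)`
unless this point lies on the boundary, which happens only for a null set of `y`. -/
lemma IsGTC.continuous_sliceInt (hU : IsGTC U) (hn : 1 ≤ n) {G : Spacetime n → ℝ}
    (hG : ContinuousOn G (closure U)) : Continuous (sliceInt U G) := by
  refine continuous_iff_continuousAt.2 fun t₀ => ?_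
  have heq : sliceInt U G = fun t => ∫ y, U.indicator G (t, y) := by
    ext t
    rw [sliceInt, ← integral_indicator (hU.slice_open t).measurableSet]
    rfl
  rw [heq]
  obtain ⟨M, hM0, hM⟩ := hU.exists_bound hn hG (t₀ - 1) (t₀ + 1)
  obtain ⟨R, hR0, hR⟩ := hU.exists_bound hn (G := fun p : Spacetime n => p.2)
    (by fun_prop) (t₀ - 1) (t₀ + 1)
  have hnear : ∀ᶠ t in 𝓝 t₀, t ∈ Icc (t₀ - 1) (t₀ + 1) :=
    Icc_mem_nhds (by linarith) (by linarith)
  refine continuousAt_of_dominated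
    (bound := (Metric.closedBall (0 : EuclideanSpace ℝ (Fin n)) R).indicator fun _ => M) ?_ ?_ ?_ ?_
  · refine Eventually.of_forall fun t => ?_
    have : (fun y => U.indicator G (t, y)) = (slice U t).indicator fun y => G (t, y) := rfl
    rw [this, aestronglyMeasurable_indicator_iff (hU.slice_open t).measurableSet]
    exact (continuousOn_slice hG t).aestronglyMeasurable (hU.slice_open t).measurableSet
  · filter_upwards [hnear] with t ht
    refine Eventually.of_forall fun y => ?_
    by_cases hy : (t, y) ∈ U
    · have h1 : y ∈ Metric.closedBall (0 : EuclideanSpace ℝ (Fin n)) R := by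
        rw [mem_closedBall_zero_iff]; exact hR (t, y) (subset_closure hy) ht
      rw [indicator_of_mem hy, indicator_of_mem h1]
      exact hM (t, y) (subset_closure hy) ht
    · rw [indicator_of_notMem hy, norm_zero]
      exact indicator_nonneg (fun _ _ => hM0) _
  · rw [integrable_indicator_iff measurableSet_closedBall]
    exact integrableOn_const (measure_closedBall_lt_top.ne)
  · have h0 := hU.volume_slice_frontier t₀
    have h1 : ∀ᵐ y : EuclideanSpace ℝ (Fin n), (t₀, y) ∉ frontier U := by
      rw [ae_iff]; simpa using h0
    filter_upwards [h1] with y hy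
    have hyc : Continuous fun t : ℝ => ((t, y) : Spacetime n) := by fun_prop
    by_cases hyU : (t₀, y) ∈ U
    · have h2 : ContinuousAt G (t₀, y) :=
        hG.continuousAt (mem_of_superset (hU.isOpen.mem_nhds hyU) subset_closure)
      have h3 : ContinuousAt (U.indicator G) (t₀, y) := by
        refine h2.congr ?_
        filter_upwards [hU.isOpen.mem_nhds hyU] with q hq
        rw [indicator_of_mem hq]
      exact h3.comp (f := fun t : ℝ => ((t, y) : Spacetime n)) hyc.continuousAt
    · have hyc' : (t₀, y) ∈ (closure U)ᶜ := fun h => hy (hU.mem_frontier_iff.2 ⟨h, hyU⟩)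
      have h3 : ContinuousAt (U.indicator G) (t₀, y) := by
        refine (continuousAt_const (y := (0 : ℝ))).congr ?_
        filter_upwards [isClosed_closure.isOpen_compl.mem_nhds hyc'] with q hq
        rw [indicator_of_notMem fun h => hq (subset_closure h)]
      exact h3.comp (f := fun t : ℝ => ((t, y) : Spacetime n)) hyc.continuousAt

lemma IsGTC.integral_eq_integral_sliceInt (hU : IsGTC U) {G : Spacetime n → ℝ}
    (hG : IntegrableOn G U) : ∫ p in U, G p = ∫ t, sliceInt U G t := by
  rw [← integral_indicator hU.isOpen.measurableSet]
  rw [← integrable_indicator_iff hU.isOpen.measurableSet] at hG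
  rw [Measure.volume_eq_prod] at hG ⊢
  rw [integral_prod _ hG]
  refine integral_congr_ae (Eventually.of_forall fun t => ?_)
  simp only [sliceInt]
  rw [← integral_indicator (hU.slice_open t).measurableSet]
  rfl

lemma IsGTC.integrableOn_of_continuousOn (hU : IsGTC U) (hn : 1 ≤ n) {G : Spacetime n → ℝ}
    (hG : ContinuousOn G (closure U)) {a b : ℝ} (h0 : ∀ p ∈ U, p.1 ∉ Icc a b → G p = 0) :
    IntegrableOn G U := by
  have h1 : IntegrableOn G (closure U ∩ Prod.fst ⁻¹' Icc a b) :=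
    (hG.mono inter_subset_left).integrableOn_compact (hU.isCompact_slab hn a b)
  refine h1.of_forall_sdiff_eq_zero hU.isOpen.measurableSet fun p hp => h0 p hp.1 fun h => ?_
  exact hp.2 ⟨subset_closure hp.1, h⟩

lemma diverg_time_smul {V : Spacetime n → Spacetime n} {θ : ℝ → ℝ} (hθ : ContDiff ℝ 1 θ)
    {p : Spacetime n} (hV : DifferentiableAt ℝ V p) :
    diverg (fun p => θ p.1 • V p) p = deriv θ p.1 * (V p).1 + θ p.1 * diverg V p := by
  have h1 : HasFDerivAt (fun p : Spacetime n => θ p.1)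
      (deriv θ p.1 • ContinuousLinearMap.fst ℝ ℝ (EuclideanSpace ℝ (Fin n))) p :=
    (hθ.contDiffAt.differentiableAt (by simp)).hasDerivAt.comp_hasFDerivAt p hasFDerivAt_fst
  have h2 := (h1.smul hV.hasFDerivAt).fderiv
  have h3 : fderiv ℝ (fun p => θ p.1 • V p) p = _ := h2
  rw [diverg, h3, diverg]
  simp [eT, eX, mul_add, Finset.mul_sum]
  ring

/-- The divergence theorem in a time slab, as an inequality. -/
theorem IsGTC.exists_slab_bound (hU : IsGTC U) (hn : 1 ≤ n) (a b : ℝ) :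
    ∃ C : ℝ≥0, ∀ (V : Spacetime n → Spacetime n) (D : Spacetime n → ℝ) (Γ : Set (Spacetime n))
      (h : Spacetime n → ℝ≥0∞) (τm τp : ℝ), a ≤ τm → τm < τp → τp ≤ b →
      ContDiffOn ℝ 1 V (closure U) → ContinuousOn D (closure U) → (∀ p ∈ U, diverg V p = D p) →
      (∀ p ∈ frontier U, p.1 ∈ Ioo τm τp →
        ENNReal.ofReal (-edot (V p) (euclNormal U p)) ≤ Γ.indicator h p) →
      ENNReal.ofReal (sliceInt U (fun p => (V p).1) τp - sliceInt U (fun p => (V p).1) τm -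
        ∫ t in τm..τp, sliceInt U D t) ≤ C * ∫⁻ p in Γ, h p ∂(euclSurfaceMeasure n) := by
  obtain ⟨C, hC⟩ := hU.exists_flux_bound hn a b
  refine ⟨C, fun V D Γ h τm τp ha hτ hb hV hD hdiv hflux => ?_⟩
  obtain ⟨θ, hθs, hθ0, hθ1, hθz, hθlim⟩ := exists_cutoff_seq hτ
  have hV1 : ContinuousOn (fun p => (V p).1) (closure U) := hV.continuousOn.fst
  set E := sliceInt U fun p => (V p).1 with hE
  have hEc : Continuous E := hU.continuous_sliceInt hn hV1
  have hDc : Continuous (sliceInt U D) := hU.continuous_sliceInt hn hD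
  -- Integrating by parts against the cutoff turns the source term into `-F`, so that only
  -- derivatives of cutoffs, tested against `E - F`, have to pass to the limit.
  set F : ℝ → ℝ := fun t => ∫ s in τm..t, sliceInt U D s with hF
  have hFd : ∀ t, HasDerivAt F (sliceInt U D t) t := fun t =>
    intervalIntegral.integral_hasDerivAt_right (hDc.intervalIntegrable _ _)
      hDc.stronglyMeasurable.stronglyMeasurableAtFilter hDc.continuousAt
  have hFc : Continuous F := continuous_iff_continuousAt.2 fun t => (hFd t).continuousAt
  have hbound : ∀ k, ENNReal.ofReal (-∫ t, deriv (θ k) t * (E t - F t)) ≤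
      C * ∫⁻ p in Γ, h p ∂(euclSurfaceMeasure n) := by
    intro k
    have hθ' : Continuous (deriv (θ k)) := (hθs k).continuous_deriv (by simp)
    have hθd : ∀ t, HasDerivAt (θ k) (deriv (θ k) t) t := fun t =>
      ((hθs k).contDiffAt.differentiableAt (by simp)).hasDerivAt
    have hθz' : ∀ t, t ∉ Icc τm τp → deriv (θ k) t = 0 := by
      intro t ht
      have : θ k =ᶠ[𝓝 t] fun _ => 0 := by
        filter_upwards [isClosed_Icc.isOpen_compl.mem_nhds ht] with s hs
        exact hθz k s fun h => hs (Ioo_subset_Icc_self h)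
      rw [this.deriv_eq]; simp
    have hcθ : HasCompactSupport (θ k) :=
      HasCompactSupport.intro (isCompact_Icc (a := τm) (b := τp))
      fun t ht => hθz k t fun h => ht (Ioo_subset_Icc_self h)
    have hcθ' : HasCompactSupport (deriv (θ k)) :=
      HasCompactSupport.intro (isCompact_Icc (a := τm) (b := τp)) hθz'
    have hmain := hC (fun p => θ k p.1 • V p) Γ h
      (((hθs k).comp contDiff_fst).contDiffOn.smul hV) ?_ ?_
    rotate_left
    · intro p hp
      by_cases hpt : p.1 ∈ Ioo τm τp
      · refine le_trans ?_ (hflux p hp hpt)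
        rw [edot_comm, edot_smul_right, edot_comm, ← mul_neg, ENNReal.ofReal_mul (hθ0 k _)]
        exact mul_le_of_le_one_left zero_le (by simpa using hθ1 k p.1)
      · simp [hθz k _ hpt, edot]
    · intro p _ hpt
      rw [hθz k p.1 fun h => hpt ⟨ha.trans h.1.le, h.2.le.trans hb⟩, zero_smul]
    set G : Spacetime n → ℝ := fun p => deriv (θ k) p.1 * (V p).1 + θ k p.1 * D p with hG
    have hGc : ContinuousOn G (closure U) := by
      refine ContinuousOn.add (ContinuousOn.mul ?_ hV1) (ContinuousOn.mul ?_ hD)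
      · exact (hθ'.comp continuous_fst).continuousOn
      · exact ((hθs k).continuous.comp continuous_fst).continuousOn
    have hGi : IntegrableOn G U := by
      refine hU.integrableOn_of_continuousOn hn hGc (a := τm) (b := τp) fun p _ hpt => ?_
      simp only [hG]
      rw [hθz' _ hpt, hθz k _ fun h => hpt (Ioo_subset_Icc_self h)]; simp
    have hdivG : ∫ p in U, diverg (fun p => θ k p.1 • V p) p = ∫ p in U, G p := by
      refine setIntegral_congr_fun hU.isOpen.measurableSet fun p hp => ?_
      have hd : DifferentiableAt ℝ V p :=
        (hV.contDiffAt (mem_of_superset (hU.isOpen.mem_nhds hp) subset_closure)).differentiableAt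
          (by simp)
      simp only [hG]
      rw [diverg_time_smul (hθs k) hd, hdiv p hp]
    have hslice : ∀ t, sliceInt U G t = deriv (θ k) t * E t + θ k t * sliceInt U D t := by
      intro t
      simp only [sliceInt, hG, hE]
      rw [integral_add, integral_const_mul, integral_const_mul]
      · exact (hU.integrableOn_slice hn hV1 t).const_mul _
      · exact (hU.integrableOn_slice hn hD t).const_mul _
    have hi1 : Integrable fun t => deriv (θ k) t * E t :=
      (hθ'.mul hEc).integrable_of_hasCompactSupport hcθ'.mul_right
    have hi2 : Integrable fun t => θ k t * sliceInt U D t :=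
      ((hθs k).continuous.mul hDc).integrable_of_hasCompactSupport hcθ.mul_right
    have hi3 : Integrable fun t => deriv (θ k) t * F t :=
      (hθ'.mul hFc).integrable_of_hasCompactSupport hcθ'.mul_right
    have hi4 : Integrable fun t => θ k t * F t :=
      ((hθs k).continuous.mul hFc).integrable_of_hasCompactSupport hcθ.mul_right
    have hparts := integral_mul_deriv_eq_deriv_mul_of_integrable (u := θ k) (v := F)
      (u' := deriv (θ k)) (v' := sliceInt U D) (fun t _ => hθd t) (fun t _ => hFd t) hi2 hi3 hi4
    rw [hdivG, hU.integral_eq_integral_sliceInt hGi] at hmain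
    simp only [hslice] at hmain
    rw [integral_add hi1 hi2, hparts] at hmain
    simp only [mul_sub]
    rw [integral_sub hi1 hi3, sub_eq_add_neg]
    exact hmain
  have hlim := (hθlim (fun t => E t - F t) (hEc.sub hFc)).neg
  have hlim' := (ENNReal.continuous_ofReal.tendsto _).comp hlim
  have hfin : -(E τm - F τm - (E τp - F τp)) = E τp - E τm - ∫ t in τm..τp, sliceInt U D t := by
    simp only [hF, intervalIntegral.integral_same]; ring
  rw [hfin] at hlim'
  exact le_of_tendsto' hlim' hbound

end Spacetime

/-! ### Energy currents and their divergence. -/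

namespace Spacetime

variable {n : ℕ} {U : Set (Spacetime n)} {φ : Spacetime n → ℝ} {X : Spacetime n → Spacetime n}
  {w : ℝ} {p : Spacetime n}

/-- The derivative `∂ₜφ`, up to the boundary. -/
noncomputable def dT (U : Set (Spacetime n)) (φ : Spacetime n → ℝ) (p : Spacetime n) : ℝ :=
  fderivWithin ℝ φ (closure U) p eT

/-- The derivative `∂ᵢφ`, up to the boundary. -/
noncomputable def dX (U : Set (Spacetime n)) (φ : Spacetime n → ℝ) (i : Fin n)
    (p : Spacetime n) : ℝ :=
  fderivWithin ℝ φ (closure U) p (eX i)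

/-- The energy density `(|∂ₜφ|² + |∇φ|²) / 2`. -/
noncomputable def energyDensity (U : Set (Spacetime n)) (φ : Spacetime n → ℝ)
    (p : Spacetime n) : ℝ :=
  (dT U φ p ^ 2 + ∑ i, dX U φ i p ^ 2) / 2

/-- The energy current of `φ` for the multiplier `Xφ + wφ`. -/
noncomputable def current (U : Set (Spacetime n)) (φ : Spacetime n → ℝ)
    (X : Spacetime n → Spacetime n) (w : ℝ) (p : Spacetime n) : Spacetime n :=
  ((X p).1 * ((dT U φ p ^ 2 + ∑ i, dX U φ i p ^ 2) / 2) +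
      dT U φ p * ∑ i, (X p).2 i * dX U φ i p + w * (φ p * dT U φ p),
    WithLp.toLp 2 fun i => (X p).2 i * ((-dT U φ p ^ 2 + ∑ j, dX U φ j p ^ 2) / 2) -
      ((X p).1 * dT U φ p + ∑ j, (X p).2 j * dX U φ j p + w * φ p) * dX U φ i p)

/-- The divergence of the current of a solution of the wave equation. -/
noncomputable def currentDiv (U : Set (Spacetime n)) (φ : Spacetime n → ℝ)
    (X : Spacetime n → Spacetime n) (w : ℝ) (p : Spacetime n) : ℝ :=
  (fderivWithin ℝ X (closure U) p eT).1 * ((dT U φ p ^ 2 + ∑ i, dX U φ i p ^ 2) / 2) +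
    dT U φ p * ∑ i, (fderivWithin ℝ X (closure U) p eT).2 i * dX U φ i p + w * dT U φ p ^ 2 +
    ((-dT U φ p ^ 2 + ∑ i, dX U φ i p ^ 2) / 2) *
      ∑ i, (fderivWithin ℝ X (closure U) p (eX i)).2 i -
    dT U φ p * ∑ i, (fderivWithin ℝ X (closure U) p (eX i)).1 * dX U φ i p -
    ∑ i, (∑ j, (fderivWithin ℝ X (closure U) p (eX i)).2 j * dX U φ j p) * dX U φ i p -
    w * ∑ i, dX U φ i p ^ 2

lemma IsGTC.contDiffOn_fderivWithin (hU : IsGTC U) {F : Type*} [NormedAddCommGroup F]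
    [NormedSpace ℝ F] {g : Spacetime n → F} (hg : ContDiffOn ℝ ∞ g (closure U)) :
    ContDiffOn ℝ 1 (fderivWithin ℝ g (closure U)) (closure U) :=
  hg.fderivWithin hU.uniqueDiffOn (by norm_cast)

lemma IsGTC.contDiffOn_dT (hU : IsGTC U) (hφ : ContDiffOn ℝ ∞ φ (closure U)) :
    ContDiffOn ℝ 1 (dT U φ) (closure U) :=
  (hU.contDiffOn_fderivWithin hφ).clm_apply contDiffOn_const

lemma IsGTC.contDiffOn_dX (hU : IsGTC U) (hφ : ContDiffOn ℝ ∞ φ (closure U)) (i : Fin n) :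
    ContDiffOn ℝ 1 (dX U φ i) (closure U) :=
  (hU.contDiffOn_fderivWithin hφ).clm_apply contDiffOn_const

lemma contDiffOn_snd_apply {s : Set (Spacetime n)} (hX : ContDiffOn ℝ 1 X s) (i : Fin n) :
    ContDiffOn ℝ 1 (fun p => (X p).2 i) s :=
  contDiffOn_euclidean.1 hX.snd i

lemma IsGTC.contDiffOn_current (hU : IsGTC U) (hφ : ContDiffOn ℝ ∞ φ (closure U))
    (hX : ContDiffOn ℝ 1 X (closure U)) (w : ℝ) :
    ContDiffOn ℝ 1 (current U φ X w) (closure U) := by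
  have ha := hU.contDiffOn_dT hφ
  have hb := hU.contDiffOn_dX hφ
  have hX1 : ContDiffOn ℝ 1 (fun p => (X p).1) (closure U) := hX.fst
  have hX2 := contDiffOn_snd_apply hX
  have hφ1 : ContDiffOn ℝ 1 φ (closure U) := hφ.of_le (by norm_cast)
  have hS : ContDiffOn ℝ 1 (fun p => ∑ i, dX U φ i p ^ 2) (closure U) :=
    ContDiffOn.sum fun i _ => (hb i).pow 2
  have hP : ContDiffOn ℝ 1 (fun p => ∑ i, (X p).2 i * dX U φ i p) (closure U) :=
    ContDiffOn.sum fun i _ => (hX2 i).mul (hb i)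
  refine ContDiffOn.prodMk ?_ (contDiffOn_euclidean.2 fun i => ?_)
  · exact ((hX1.mul (((ha.pow 2).add hS).div_const 2)).add (ha.mul hP)).add
      (contDiffOn_const.mul (hφ1.mul ha))
  · exact ((hX2 i).mul (((ha.pow 2).neg.add hS).div_const 2)).sub
      ((((hX1.mul ha).add hP).add (contDiffOn_const.mul hφ1)).mul (hb i))

lemma IsGTC.continuousOn_currentDiv (hU : IsGTC U) (hφ : ContDiffOn ℝ ∞ φ (closure U))
    (hX : ContDiffOn ℝ 1 X (closure U)) (w : ℝ) :
    ContinuousOn (currentDiv U φ X w) (closure U) := by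
  have ha := (hU.contDiffOn_dT hφ).continuousOn
  have hb := fun i => (hU.contDiffOn_dX hφ i).continuousOn
  have hX' : ContinuousOn (fderivWithin ℝ X (closure U)) (closure U) :=
    hX.continuousOn_fderivWithin hU.uniqueDiffOn (by simp)
  have h1 : ∀ v, ContinuousOn (fun p => (fderivWithin ℝ X (closure U) p v).1) (closure U) :=
    fun v => (hX'.clm_apply continuousOn_const).fst
  have h2 : ∀ v i, ContinuousOn (fun p => (fderivWithin ℝ X (closure U) p v).2 i) (closure U) :=
    fun v i => ((EuclideanSpace.proj i : EuclideanSpace ℝ (Fin n) →L[ℝ] ℝ).continuous.comp_continuousOn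
      (hX'.clm_apply continuousOn_const).snd)
  unfold currentDiv
  fun_prop

lemma continuousOn_energyDensity (hU : IsGTC U) (hφ : ContDiffOn ℝ ∞ φ (closure U)) :
    ContinuousOn (energyDensity U φ) (closure U) := by
  have ha := (hU.contDiffOn_dT hφ).continuousOn
  have hb := fun i => (hU.contDiffOn_dX hφ i).continuousOn
  unfold energyDensity
  fun_prop

/-- The algebraic cancellation behind the divergence identity for the current. -/
lemma current_cancellation (a x0 x0t f w Htt : ℝ) (b x xt Ht x0x xx : Fin n → ℝ)
    (H xX : Fin n → Fin n → ℝ) (hsymm : ∀ i j, H i j = H j i) (hbox : Htt = ∑ i, H i i)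
    (hxx : ∀ i, xx i = xX i i) :
    (x0t * ((a ^ 2 + ∑ i, b i ^ 2) / 2) + x0 * ((2 * a * Htt + ∑ i, 2 * b i * Ht i) / 2) +
        (Htt * ∑ i, x i * b i + a * ∑ i, (xt i * b i + x i * Ht i)) +
        w * (a * a + f * Htt)) +
      ∑ i, (xX i i * ((-a ^ 2 + ∑ j, b j ^ 2) / 2) +
          x i * ((-(2 * a * Ht i) + ∑ j, 2 * b j * H i j) / 2) -
        ((x0x i * a + x0 * Ht i + ∑ j, (xX i j * b j + x j * H i j) + w * b i) * b i +
          (x0 * a + ∑ j, x j * b j + w * f) * H i i)) =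
    x0t * ((a ^ 2 + ∑ i, b i ^ 2) / 2) + a * ∑ i, xt i * b i + w * a ^ 2 +
      ((-a ^ 2 + ∑ i, b i ^ 2) / 2) * ∑ i, xx i - a * ∑ i, x0x i * b i -
      ∑ i, (∑ j, xX i j * b j) * b i - w * ∑ i, b i ^ 2 := by
  have hcross : ∑ i, x i * ∑ j, b j * H i j = ∑ i, (∑ j, x j * H i j) * b i := by
    simp only [Finset.mul_sum, Finset.sum_mul]
    rw [Finset.sum_comm]
    refine Finset.sum_congr rfl fun i _ => Finset.sum_congr rfl fun j _ => ?_
    rw [hsymm j i]; ring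
  have hterm : ∀ i, (xX i i * ((-a ^ 2 + ∑ j, b j ^ 2) / 2) +
          x i * ((-(2 * a * Ht i) + ∑ j, 2 * b j * H i j) / 2) -
        ((x0x i * a + x0 * Ht i + ∑ j, (xX i j * b j + x j * H i j) + w * b i) * b i +
          (x0 * a + ∑ j, x j * b j + w * f) * H i i)) =
      ((-a ^ 2 + ∑ j, b j ^ 2) / 2) * xx i - a * (x i * Ht i) + x i * ∑ j, b j * H i j -
        a * (x0x i * b i) - x0 * (b i * Ht i) - (∑ j, xX i j * b j) * b i -
        (∑ j, x j * H i j) * b i - w * b i ^ 2 -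
        (x0 * a + ∑ j, x j * b j + w * f) * H i i := by
    intro i
    have e1 : ∑ j, 2 * b j * H i j = 2 * ∑ j, b j * H i j := by
      rw [Finset.mul_sum]; exact Finset.sum_congr rfl fun j _ => by ring
    rw [e1, Finset.sum_add_distrib, hxx]
    ring
  have e2 : ∑ i, 2 * b i * Ht i = 2 * ∑ i, b i * Ht i := by
    rw [Finset.mul_sum]; exact Finset.sum_congr rfl fun j _ => by ring
  rw [Finset.sum_congr rfl fun i _ => hterm i]
  simp only [Finset.sum_sub_distrib, Finset.sum_add_distrib, ← Finset.mul_sum, hcross, e2, ← hbox]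
  ring

/-- Second derivatives of `φ` cancel by their symmetry and the wave equation
(`current_cancellation`). The product rule is applied along coordinate lines, where it is a
one-variable computation. -/
lemma IsGTC.diverg_current (hU : IsGTC U) (hφ : ContDiffOn ℝ ∞ φ (closure U))
    (hX : ContDiffOn ℝ 1 X (closure U)) (hp : p ∈ U) (hbox : box φ p = 0) :
    diverg (current U φ X w) p = currentDiv U φ X w p := by
  have hnhds : closure U ∈ 𝓝 p := mem_of_superset (hU.isOpen.mem_nhds hp) subset_closure
  set Φ := fderivWithin ℝ φ (closure U) with hΦ
  have hΦd : HasFDerivAt Φ (fderiv ℝ Φ p) p :=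
    (((hU.contDiffOn_fderivWithin hφ).contDiffAt hnhds).differentiableAt (by simp)).hasFDerivAt
  set B := fderiv ℝ Φ p with hB
  have hΦeq : Φ =ᶠ[𝓝 p] fderiv ℝ φ := by
    filter_upwards [hU.isOpen.mem_nhds hp] with q hq
    exact fderivWithin_of_mem_nhds (mem_of_superset (hU.isOpen.mem_nhds hq) subset_closure)
  have hBeq : B = fderiv ℝ (fderiv ℝ φ) p := hΦeq.fderiv_eq
  have hφat : ContDiffAt ℝ ∞ φ p := hφ.contDiffAt hnhds
  have hsymm : ∀ v u, B v u = B u v := by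
    intro v u
    rw [hBeq]
    exact (hφat.isSymmSndFDerivAt
      (by simp only [minSmoothness_of_isRCLikeNormedField]; norm_cast)).eq
      v u
  have hφd : HasFDerivAt φ (Φ p) p := by
    rw [hΦeq.self_of_nhds]
    exact (hφat.differentiableAt (by simp)).hasFDerivAt
  set X' := fderivWithin ℝ X (closure U) p with hX'
  have hXd : HasFDerivAt X X' p := by
    rw [hX', fderivWithin_of_mem_nhds hnhds]
    exact ((hX.contDiffAt hnhds).differentiableAt (by simp)).hasFDerivAt
  have hVd : HasFDerivAt (current U φ X w) (fderiv ℝ (current U φ X w) p) p :=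
    (((hU.contDiffOn_current hφ hX w).contDiffAt hnhds).differentiableAt (by simp)).hasFDerivAt
  -- derivatives along lines
  have hline : ∀ v : Spacetime n, HasDerivAt (fun s : ℝ => p + s • v) v 0 := by
    intro v
    have := ((hasDerivAt_id (0 : ℝ)).smul_const v).const_add p
    simpa using this
  have hp0 : ∀ v : Spacetime n, p + (0 : ℝ) • v = p := fun v => by simp
  have hΦl : ∀ v u, HasDerivAt (fun s : ℝ => Φ (p + s • v) u) (B v u) 0 := by
    intro v u
    have h1 := HasFDerivAt.comp_hasDerivAt_of_eq (0 : ℝ) hΦd (hline v) (hp0 v).symm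
    have h2 := h1.clm_apply (hasDerivAt_const (0 : ℝ) u)
    simpa using h2
  have hφl : ∀ v, HasDerivAt (fun s : ℝ => φ (p + s • v)) (Φ p v) 0 := fun v =>
    HasFDerivAt.comp_hasDerivAt_of_eq (0 : ℝ) hφd (hline v) (hp0 v).symm
  have hXl : ∀ v, HasDerivAt (fun s : ℝ => X (p + s • v)) (X' v) 0 := fun v =>
    HasFDerivAt.comp_hasDerivAt_of_eq (0 : ℝ) hXd (hline v) (hp0 v).symm
  have hVl : ∀ v, HasDerivAt (fun s : ℝ => current U φ X w (p + s • v))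
      (fderiv ℝ (current U φ X w) p v) 0 := fun v =>
    HasFDerivAt.comp_hasDerivAt_of_eq (0 : ℝ) hVd (hline v) (hp0 v).symm
  have hfst : ∀ {F : ℝ → Spacetime n} {F' : Spacetime n}, HasDerivAt F F' 0 →
      HasDerivAt (fun s => (F s).1) F'.1 0 := fun {F F'} h =>
    (ContinuousLinearMap.fst ℝ ℝ (EuclideanSpace ℝ (Fin n))).hasFDerivAt.comp_hasDerivAt 0 h
  have hsnd : ∀ (i : Fin n) {F : ℝ → Spacetime n} {F' : Spacetime n}, HasDerivAt F F' 0 →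
      HasDerivAt (fun s => (F s).2 i) (F'.2 i) 0 := fun i {F F'} h =>
    (EuclideanSpace.proj i ∘L ContinuousLinearMap.snd ℝ ℝ
      (EuclideanSpace ℝ (Fin n))).hasFDerivAt.comp_hasDerivAt 0 h
  have hal : ∀ v, HasDerivAt (fun s : ℝ => dT U φ (p + s • v)) (B v eT) 0 := fun v => hΦl v eT
  have hbl : ∀ i v, HasDerivAt (fun s : ℝ => dX U φ i (p + s • v)) (B v (eX i)) 0 :=
    fun i v => hΦl v (eX i)
  have hT : (fderiv ℝ (current U φ X w) p eT).1 = _ := (hfst (hVl eT)).unique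
    ((((hfst (hXl eT)).mul ((((hal eT).pow 2).add
      (HasDerivAt.fun_sum fun i (_ : i ∈ Finset.univ) => (hbl i eT).pow 2)).div_const 2)).add
      ((hal eT).mul (HasDerivAt.fun_sum fun i (_ : i ∈ Finset.univ) =>
        (hsnd i (hXl eT)).mul (hbl i eT)))).add
      (((hφl eT).mul (hal eT)).const_mul w))
  have hS : ∀ i, (fderiv ℝ (current U φ X w) p (eX i)).2 i = _ := fun i =>
    (hsnd i (hVl (eX i))).unique
    (((hsnd i (hXl (eX i))).mul ((((hal (eX i)).pow 2).neg.add
      (HasDerivAt.fun_sum fun j (_ : j ∈ Finset.univ) => (hbl j (eX i)).pow 2)).div_const 2)).sub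
      (((((hfst (hXl (eX i))).mul (hal (eX i))).add
        (HasDerivAt.fun_sum fun j (_ : j ∈ Finset.univ) =>
          (hsnd j (hXl (eX i))).mul (hbl j (eX i)))).add
        ((hφl (eX i)).const_mul w)).mul (hbl i (eX i))))
  have hbox' : B eT eT = ∑ i, B (eX i) (eX i) := by
    rw [box, ← hBeq] at hbox; linarith
  have key := current_cancellation (dT U φ p) (X p).1 (X' eT).1 (φ p) w (B eT eT)
    (fun i => dX U φ i p) (fun i => (X p).2 i) (fun i => (X' eT).2 i) (fun i => B eT (eX i))
    (fun i => (X' (eX i)).1) (fun i => (X' (eX i)).2 i) (fun i j => B (eX i) (eX j))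
    (fun i j => (X' (eX i)).2 j) (fun i j => hsymm _ _) hbox' (fun i => rfl)
  rw [currentDiv, ← hX', ← key, diverg, hT]
  congr 1
  · simp [dT, dX, hΦ]
  · refine Finset.sum_congr rfl fun i _ => ?_
    rw [hS i]
    simp [dT, dX, hΦ, hsymm (eX i) eT]

end Spacetime

/-! ### Boundary values of currents, and the scaling field. -/

namespace Spacetime

variable {n : ℕ} {U : Set (Spacetime n)} {φ : Spacetime n → ℝ} {X : Spacetime n → Spacetime n}
  {w : ℝ} {p : Spacetime n}

/-- At the boundary the differential of a function that vanishes there is conormal. -/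
lemma IsGTC.exists_fderivWithin_eq (hU : IsGTC U) (hφ : ContDiffOn ℝ ∞ φ (closure U))
    (h0 : ∀ p ∈ frontier U, φ p = 0) (hp : p ∈ frontier U) :
    ∃ l : ℝ, ∀ v, fderivWithin ℝ φ (closure U) p v = l * edot v (euclNormal U p) := by
  obtain ⟨k, ε, ψ, W, hε, hψ, hpW, hW⟩ := hU.exists_graphPatch hp
  set L : Spacetime n →L[ℝ] Spacetime n := flip k ε with hL
  have hLL : ∀ q, L (L q) = q := flip_flip k hε
  set y := (L p).2 with hy
  have hLy : L (ψ y, y) = p := by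
    rw [hy, ← hW.eq_of_mem_frontier hψ.continuous hU.isOpen hpW hp]; exact hLL p
  set Φ := fderivWithin ℝ φ (closure U) p with hΦ
  have hΦd : HasFDerivWithinAt φ Φ (closure U) p :=
    ((hφ p (frontier_subset_closure hp)).differentiableWithinAt (by simp)).hasFDerivWithinAt
  have hψc := hψ.continuous
  have hGc : Continuous fun y => L (ψ y, y) := by fun_prop
  have hGW : ∀ᶠ z in 𝓝 y, L (ψ z, z) ∈ frontier U := by
    have h1 : ∀ᶠ z in 𝓝 y, L (ψ z, z) ∈ W :=
      hGc.continuousAt (hW.isOpen.mem_nhds (by rw [hLy]; exact hpW))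
    filter_upwards [h1] with z hz using (hW.exists_eq_edot hε hz).1
  have hGd : HasFDerivAt (fun y => L (ψ y, y))
      (L ∘L ((fderiv ℝ ψ y).prod (ContinuousLinearMap.id ℝ _))) y :=
    L.hasFDerivAt.comp y
      ((hψ.contDiffAt.differentiableAt (by simp)).hasFDerivAt.prodMk (hasFDerivAt_id y))
  have h1 : HasFDerivAt (φ ∘ fun y => L (ψ y, y)) _ y :=
    HasFDerivWithinAt.comp_hasFDerivAt (x := y) (t := closure U) (g' := Φ)
      (by rw [hLy]; exact hΦd) hGd (hGW.mono fun z hz => frontier_subset_closure hz)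
  -- `φ` is zero along the graph, so its differential kills the tangent vectors of the boundary.
  have h2 : HasFDerivAt (φ ∘ fun y => L (ψ y, y)) (0 : _ →L[ℝ] ℝ) y :=
    (hasFDerivAt_const (0 : ℝ) y).congr_of_eventuallyEq (hGW.mono fun z hz => h0 _ hz)
  have hz : ∀ v, Φ (L (fderiv ℝ ψ y v, v)) = 0 := by
    intro v
    have := congrArg (fun A => A v) (h1.unique h2)
    simpa using this
  obtain ⟨-, m, -, -, hm⟩ := hW.exists_eq_edot hε (y := y) (by rw [← hL, hLy]; exact hpW)
  rw [← hL, hLy] at hm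
  refine ⟨m * Φ (L eT), fun v => ?_⟩
  have hdec : v = L (fderiv ℝ ψ y (L v).2, (L v).2)
      + ((L v).1 - fderiv ℝ ψ y (L v).2) • L eT := by
    conv_lhs => rw [← hLL v]
    rw [← map_smul, ← map_add]
    congr 1
    ext1
    · simp [eT]
    · simp [eT]
  conv_lhs => rw [hdec]
  rw [map_add, hz, map_smul, smul_eq_mul, zero_add, hm]
  ring

lemma edot_eT (v : Spacetime n) : edot eT v = v.1 := by simp [edot, eT]

lemma edot_eX (i : Fin n) (v : Spacetime n) : edot (eX i) v = v.2 i := by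
  simp [edot, eX, EuclideanSpace.inner_single_left]

lemma edot_eq_sum (v w : Spacetime n) : edot v w = v.1 * w.1 + ∑ i, v.2 i * w.2 i := by
  simp [edot, PiLp.inner_apply, mul_comm]

lemma mink_self (v : Spacetime n) : mink v v = -v.1 ^ 2 + ∑ i, v.2 i ^ 2 := by
  rw [mink, PiLp.inner_apply]
  simp [sq]

lemma IsGTC.mink_euclNormal_pos (hU : IsGTC U) (hp : p ∈ frontier U) :
    0 < mink (euclNormal U p) (euclNormal U p) := by
  obtain ⟨ρ, hρ⟩ := hU.smooth_boundary p hp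
  have hex : ∃ ρ, IsDefiningFunctionAt U p ρ := ⟨ρ, hρ⟩
  have h1 := hU.timelike_boundary p hp _ hex.choose_spec
  have h2 := hex.choose_spec.edot_grad_self_pos
  rw [edot_self] at h2
  rw [euclNormal, dif_pos hex]
  set c := (√((grad hex.choose p).1 ^ 2 + ‖(grad hex.choose p).2‖ ^ 2))⁻¹ with hc
  have hc0 : 0 < c := inv_pos.2 (Real.sqrt_pos.2 h2)
  set g := grad hex.choose p
  have : mink (c • g) (c • g) = c ^ 2 * mink g g := by
    simp only [mink, Prod.smul_fst, Prod.smul_snd, inner_smul_left, inner_smul_right, smul_eq_mul,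
      conj_trivial]
    ring
  rw [this]; positivity

/-- The pairing of a vector with the Minkowski normal, lowered by a diagonal sign. -/
lemma edot_minkNormal (v : Spacetime n) :
    edot (minkNormal U p) v = (√(mink (euclNormal U p) (euclNormal U p)))⁻¹ *
      (-(euclNormal U p).1 * v.1 + ∑ i, (euclNormal U p).2 i * v.2 i) := by
  rw [minkNormal, edot_comm, edot_smul_right, edot_comm, edot_eq_sum]

/-- The Euclidean pairing of `𝒩` with `ν` is `g(ν, ν)` divided by its square root, whence the factor
`g(ν, ν)`. -/
lemma IsGTC.normalDeriv_sq (hU : IsGTC U) (hp : p ∈ frontier U) {l : ℝ}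
    (hl : ∀ v, fderivWithin ℝ φ (closure U) p v = l * edot v (euclNormal U p)) :
    normalDeriv U φ p ^ 2 = l ^ 2 * mink (euclNormal U p) (euclNormal U p) := by
  have hpos := hU.mink_euclNormal_pos hp
  set ν := euclNormal U p with hν
  have h1 : -ν.1 * ν.1 + ∑ i, ν.2 i * ν.2 i = mink ν ν := by
    rw [mink_self]; simp [sq]
  rw [normalDeriv, hl, edot_minkNormal, ← hν, h1, mul_pow, mul_pow, inv_pow,
    Real.sq_sqrt hpos.le]
  field_simp

/-- The normal component of the current at the boundary. -/
lemma IsGTC.edot_current (hU : IsGTC U) (hφ : ContDiffOn ℝ ∞ φ (closure U))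
    (h0 : ∀ p ∈ frontier U, φ p = 0) (hp : p ∈ frontier U) :
    -edot (current U φ X w p) (euclNormal U p) =
      normalDeriv U φ p ^ 2 * edot (X p) (euclNormal U p) / 2 := by
  obtain ⟨l, hl⟩ := hU.exists_fderivWithin_eq hφ h0 hp
  rw [hU.normalDeriv_sq hp hl]
  set ν := euclNormal U p with hν
  -- With `φ = 0` and `dφ = l ν` the `w` terms drop out, and the rest collapses to `l² g(ν, ν) (X·ν)
  -- / 2`.
  have ha : dT U φ p = l * ν.1 := by rw [dT, hl, edot_eT]
  have hb : ∀ i, dX U φ i p = l * ν.2 i := fun i => by rw [dX, hl, edot_eX]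
  have hS : ∑ i, (l * ν.2 i) ^ 2 = l ^ 2 * ∑ i, ν.2 i ^ 2 := by
    rw [Finset.mul_sum]; exact Finset.sum_congr rfl fun i _ => by ring
  have hP : ∑ i, (X p).2 i * (l * ν.2 i) = l * ∑ i, (X p).2 i * ν.2 i := by
    rw [Finset.mul_sum]; exact Finset.sum_congr rfl fun i _ => by ring
  rw [edot_eq_sum, edot_eq_sum, mink_self]
  simp only [current, ha, hb, h0 p hp, hS, hP, mul_zero, add_zero, zero_mul]
  have hsum : ∀ A B : ℝ, ∑ i, ((X p).2 i * A - B * (l * ν.2 i)) * ν.2 i =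
      A * (∑ i, (X p).2 i * ν.2 i) - B * l * ∑ i, ν.2 i ^ 2 := by
    intro A B
    rw [Finset.mul_sum, Finset.mul_sum, ← Finset.sum_sub_distrib]
    exact Finset.sum_congr rfl fun i _ => by ring
  rw [hsum]
  ring

lemma fderiv_hyp (P q v : Spacetime n) :
    fderiv ℝ (hyp P) q v = (∑ i, (q.2 i - P.2 i) * v.2 i - (q.1 - P.1) * v.1) / 2 := by
  have h1 : HasFDerivAt (fun q : Spacetime n => q.2 - P.2)
      (ContinuousLinearMap.snd ℝ ℝ (EuclideanSpace ℝ (Fin n))) q := hasFDerivAt_snd.sub_const _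
  have h2 : HasFDerivAt (fun q : Spacetime n => q.1 - P.1)
      (ContinuousLinearMap.fst ℝ ℝ (EuclideanSpace ℝ (Fin n))) q := hasFDerivAt_fst.sub_const _
  have h3 := (h1.norm_sq.sub (h2.pow 2)).mul_const (4⁻¹ : ℝ)
  have h4 : fderiv ℝ (hyp P) q = _ := HasFDerivAt.fderiv h3
  rw [h4]
  simp only [sub_mul, Finset.sum_sub_distrib]
  simp [PiLp.inner_apply, mul_comm]
  ring

/-- The scaling vector field centred at `P`. -/
noncomputable def scaling (P p : Spacetime n) : Spacetime n := p - P

/-- The metric gradient of `hyp P` is half the scaling field. Hence `𝒩f_P > 0`, the condition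
defining `Γ_*`, says that the scaling field points outward. -/
lemma fderiv_hyp_minkNormal (P : Spacetime n) :
    fderiv ℝ (hyp P) p (minkNormal U p) = (√(mink (euclNormal U p) (euclNormal U p)))⁻¹ *
      edot (scaling P p) (euclNormal U p) / 2 := by
  set ν := euclNormal U p with hν
  set c := (√(mink ν ν))⁻¹ with hc
  have h1 : (minkNormal U p).1 = c * -ν.1 := by simp [minkNormal, hc, hν]
  have h2 : ∀ i, (minkNormal U p).2 i = c * ν.2 i := fun i => by simp [minkNormal, hc, hν]
  rw [fderiv_hyp, edot_eq_sum]
  simp only [h1, h2, scaling, Prod.fst_sub, Prod.snd_sub, PiLp.sub_apply, mul_left_comm _ c,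
    ← Finset.mul_sum]
  ring

/-- The current for the scaling field is divergence free. -/
lemma IsGTC.currentDiv_scaling (hU : IsGTC U) (P : Spacetime n) (hp : p ∈ closure U) :
    currentDiv U φ (scaling P) ((n - 1) / 2) p = 0 := by
  have h1 : fderivWithin ℝ (scaling P) (closure U) p = ContinuousLinearMap.id ℝ _ :=
    ((hasFDerivAt_id p).sub_const P).hasFDerivWithinAt.fderivWithin (hU.uniqueDiffOn p hp)
  have h2 : ∀ i, ∑ j, (eX i : Spacetime n).2 j * dX U φ j p = dX U φ i p := by
    intro i
    simp [eX]
  have h3 : ∀ i, (eX i : Spacetime n).1 = 0 := fun i => rfl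
  have h4 : ∀ i, (eX i : Spacetime n).2 i = 1 := fun i => by simp [eX]
  -- With weight `w`, the coefficients of `(∂ₜφ)²` and `|∇φ|²` are `1/2 + w - n/2` and `n/2 - 1/2 -
  -- w`; both vanish exactly for `w = (n - 1)/2`.
  simp only [currentDiv, h1, ContinuousLinearMap.id_apply, h2, h3, h4]
  simp only [eT, PiLp.zero_apply, zero_mul, Finset.sum_const_zero, mul_zero, Finset.sum_const,
    Finset.card_univ, Fintype.card_fin, nsmul_eq_mul, mul_one, ← sq]
  ring

lemma contDiff_scaling (P : Spacetime n) {m : WithTop ℕ∞} : ContDiff ℝ m (scaling P) :=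
  contDiff_id.sub contDiff_const

end Spacetime

/-! ### Gronwall's inequality, balance laws and the virial identity. -/

/-- Two-sided Gronwall inequality for an absolutely continuous function. -/
lemma gronwall_two_sided {I D : ℝ → ℝ} (hD : Continuous D) {k t₁ t₂ : ℝ} (ht : t₁ ≤ t₂)
    (hI : ∀ t ∈ Icc t₁ t₂, I t - I t₁ = ∫ s in t₁..t, D s)
    (hb : ∀ t ∈ Icc t₁ t₂, |D t| ≤ k * I t) :
    I t₂ ≤ Real.exp (k * (t₂ - t₁)) * I t₁ ∧ I t₁ ≤ Real.exp (k * (t₂ - t₁)) * I t₂ := by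
  -- `J` agrees with `I` on the interval and is differentiable everywhere, which is not known of
  -- `I`.
  set J : ℝ → ℝ := fun t => I t₁ + ∫ s in t₁..t, D s with hJ
  have hJI : ∀ t ∈ Icc t₁ t₂, J t = I t := fun t h => by
    simp only [hJ]; linarith [hI t h]
  have hJd : ∀ t, HasDerivAt J (D t) t := fun t =>
    (intervalIntegral.integral_hasDerivAt_right (hD.intervalIntegrable _ _)
      hD.stronglyMeasurable.stronglyMeasurableAtFilter hD.continuousAt).const_add _
  have hderiv : ∀ (c t : ℝ), HasDerivAt (fun t => Real.exp (c * (t - t₁)) * J t)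
      (Real.exp (c * (t - t₁)) * (c * J t + D t)) t := by
    intro c t
    have h1 : HasDerivAt (fun t => c * (t - t₁)) c t := by
      simpa using ((hasDerivAt_id t).sub_const t₁).const_mul c
    convert! h1.exp.mul (hJd t) using 1
    ring
  have hcont : ∀ c : ℝ, ContinuousOn (fun t => Real.exp (c * (t - t₁)) * J t) (Icc t₁ t₂) :=
    fun c t _ => (hderiv c t).continuousAt.continuousWithinAt
  have hl := left_mem_Icc.2 ht
  have hr := right_mem_Icc.2 ht
  constructor
  · have hanti : AntitoneOn (fun t => Real.exp (-k * (t - t₁)) * J t) (Icc t₁ t₂) := by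
      refine antitoneOn_of_deriv_nonpos (convex_Icc _ _) (hcont (-k))
        (fun t _ => (hderiv (-k) t).differentiableAt.differentiableWithinAt) fun t ht' => ?_
      rw [interior_Icc] at ht'
      have h' := Ioo_subset_Icc_self ht'
      rw [(hderiv (-k) t).deriv, hJI t h']
      have := hb t h'
      exact mul_nonpos_of_nonneg_of_nonpos (Real.exp_pos _).le (by linarith [le_abs_self (D t)])
    have h1 := hanti hl hr ht
    simp only [hJI _ hl, hJI _ hr, sub_self, mul_zero, Real.exp_zero, one_mul] at h1
    have h2 : Real.exp (k * (t₂ - t₁)) * Real.exp (-k * (t₂ - t₁)) = 1 := by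
      rw [← Real.exp_add]; simp
    calc I t₂ = Real.exp (k * (t₂ - t₁)) * (Real.exp (-k * (t₂ - t₁)) * I t₂) := by
          rw [← mul_assoc, h2, one_mul]
      _ ≤ _ := mul_le_mul_of_nonneg_left h1 (Real.exp_pos _).le
  · have hmono : MonotoneOn (fun t => Real.exp (k * (t - t₁)) * J t) (Icc t₁ t₂) := by
      refine monotoneOn_of_deriv_nonneg (convex_Icc _ _) (hcont k)
        (fun t _ => (hderiv k t).differentiableAt.differentiableWithinAt) fun t ht' => ?_
      rw [interior_Icc] at ht'
      have h' := Ioo_subset_Icc_self ht'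
      rw [(hderiv k t).deriv, hJI t h']
      have := hb t h'
      exact mul_nonneg (Real.exp_pos _).le (by linarith [neg_abs_le (D t)])
    have h1 := hmono hl hr ht
    simpa only [hJI _ hl, hJI _ hr, sub_self, mul_zero, Real.exp_zero, one_mul] using h1

namespace Spacetime

variable {n : ℕ} {U : Set (Spacetime n)} {φ : Spacetime n → ℝ} {X : Spacetime n → Spacetime n}
  {w : ℝ} {p : Spacetime n}

lemma IsGTC.sliceInt_mono (hU : IsGTC U) (hn : 1 ≤ n) {G₁ G₂ : Spacetime n → ℝ}
    (h₁ : ContinuousOn G₁ (closure U)) (h₂ : ContinuousOn G₂ (closure U)) {t : ℝ}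
    (h : ∀ y, (t, y) ∈ U → G₁ (t, y) ≤ G₂ (t, y)) : sliceInt U G₁ t ≤ sliceInt U G₂ t :=
  setIntegral_mono_on (hU.integrableOn_slice hn h₁ t) (hU.integrableOn_slice hn h₂ t)
    (hU.slice_open t).measurableSet h

lemma IsGTC.sliceInt_add_mul (hU : IsGTC U) (hn : 1 ≤ n) {G₁ G₂ : Spacetime n → ℝ}
    (h₁ : ContinuousOn G₁ (closure U)) (h₂ : ContinuousOn G₂ (closure U)) (c₁ c₂ t : ℝ) :
    sliceInt U (fun p => c₁ * G₁ p + c₂ * G₂ p) t =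
      c₁ * sliceInt U G₁ t + c₂ * sliceInt U G₂ t := by
  simp only [sliceInt]
  rw [integral_add ((hU.integrableOn_slice hn h₁ t).const_mul _)
    ((hU.integrableOn_slice hn h₂ t).const_mul _), integral_const_mul, integral_const_mul]

lemma sliceInt_const_mul (c : ℝ) (G : Spacetime n → ℝ) (t : ℝ) :
    sliceInt U (fun p => c * G p) t = c * sliceInt U G t := by
  simp only [sliceInt]
  rw [integral_const_mul]

lemma diverg_neg (V : Spacetime n → Spacetime n) (p : Spacetime n) :
    diverg (fun p => -V p) p = -diverg V p := by
  simp [diverg, fderiv_fun_neg]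
  ring

/-- The balance law for a field that is tangent to the boundary. -/
lemma IsGTC.sliceInt_sub_eq (hU : IsGTC U) (hn : 1 ≤ n) {V : Spacetime n → Spacetime n}
    {D : Spacetime n → ℝ} (hV : ContDiffOn ℝ 1 V (closure U)) (hD : ContinuousOn D (closure U))
    (hdiv : ∀ p ∈ U, diverg V p = D p)
    (htan : ∀ p ∈ frontier U, edot (V p) (euclNormal U p) = 0) {τm τp : ℝ} (hτ : τm ≤ τp) :
    sliceInt U (fun p => (V p).1) τp - sliceInt U (fun p => (V p).1) τm =
      ∫ t in τm..τp, sliceInt U D t := by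
  rcases hτ.eq_or_lt with rfl | hlt
  · simp
  obtain ⟨C, hC⟩ := hU.exists_slab_bound hn τm τp
  -- With `Γ` empty the slab bound has right-hand side zero; used for `V` and for `-V`, it gives an
  -- equality.
  have h1 := hC V D ∅ 0 τm τp le_rfl hlt le_rfl hV hD hdiv fun p hp _ => by simp [htan p hp]
  have hneg : ∀ G : Spacetime n → ℝ, ∀ t, sliceInt U (fun p => -G p) t = -sliceInt U G t :=
    fun G t => by simp only [sliceInt, integral_neg]
  have h2 := hC (fun p => -V p) (fun p => -D p) ∅ 0 τm τp le_rfl hlt le_rfl hV.neg hD.neg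
    (fun p hp => by rw [diverg_neg, hdiv p hp]) fun p hp _ => by
      have := htan p hp
      have h3 : edot (-V p) (euclNormal U p) = -edot (V p) (euclNormal U p) := by
        simp [edot]; ring
      simp [h3, this]
  simp only [Measure.restrict_empty, lintegral_zero_measure, mul_zero, nonpos_iff_eq_zero,
    ENNReal.ofReal_eq_zero] at h1 h2
  have h3 : sliceInt U (fun p => (-V p).1) = fun t => -sliceInt U (fun p => (V p).1) t :=
    funext fun t => hneg (fun p => (V p).1) t
  simp only [h3, hneg D, intervalIntegral.integral_neg] at h2
  linarith

/-- The integrand of the virial identity on slices. -/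
noncomputable def virial (U : Set (Spacetime n)) (φ : Spacetime n → ℝ)
    (x₀ : EuclideanSpace ℝ (Fin n)) (p : Spacetime n) : ℝ :=
  n * φ p ^ 2 + 2 * φ p * ∑ i, (p.2 i - x₀ i) * dX U φ i p

lemma IsGTC.continuousOn_virial (hU : IsGTC U) (hφ : ContDiffOn ℝ ∞ φ (closure U))
    (x₀ : EuclideanSpace ℝ (Fin n)) : ContinuousOn (virial U φ x₀) (closure U) := by
  have hb := fun i => (hU.contDiffOn_dX hφ i).continuousOn
  have hφc := hφ.continuousOn
  unfold virial
  fun_prop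

/-- The field `(0, φ² (x - x₀))` vanishes on the boundary and has no time component, so the slice
integrals of its divergence integrate to zero over every time interval. By continuity in time they
vanish one by one, and no divergence theorem on slices is needed. -/
lemma IsGTC.sliceInt_virial (hU : IsGTC U) (hn : 1 ≤ n) (hφ : ContDiffOn ℝ ∞ φ (closure U))
    (h0 : ∀ p ∈ frontier U, φ p = 0) (x₀ : EuclideanSpace ℝ (Fin n)) (t : ℝ) :
    sliceInt U (virial U φ x₀) t = 0 := by
  set V : Spacetime n → Spacetime n := fun p => (0, φ p ^ 2 • (p.2 - x₀)) with hV
  have hφ1 : ContDiffOn ℝ 1 φ (closure U) := hφ.of_le (by norm_cast)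
  have hVs : ContDiffOn ℝ 1 V (closure U) :=
    contDiffOn_const.prodMk ((hφ1.pow 2).smul (contDiff_snd.sub contDiff_const).contDiffOn)
  have hdiv : ∀ p ∈ U, diverg V p = virial U φ x₀ p := by
    intro p hp
    have hnhds : closure U ∈ 𝓝 p := mem_of_superset (hU.isOpen.mem_nhds hp) subset_closure
    have hφd : HasFDerivAt φ (fderivWithin ℝ φ (closure U) p) p := by
      rw [fderivWithin_of_mem_nhds hnhds]
      exact ((hφ.contDiffAt hnhds).differentiableAt (by simp)).hasFDerivAt
    have h1 : HasFDerivAt (fun q : Spacetime n => q.2 - x₀)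
      (ContinuousLinearMap.snd ℝ ℝ (EuclideanSpace ℝ (Fin n))) p := hasFDerivAt_snd.sub_const _
    have h2 := (hasFDerivAt_const (0 : ℝ) p).prodMk ((hφd.pow 2).smul h1)
    have h3 : fderiv ℝ V p = _ := HasFDerivAt.fderiv h2
    rw [diverg, h3, virial]
    simp only [ContinuousLinearMap.prod_apply, add_apply,
      smul_apply, ContinuousLinearMap.smulRight_apply,
      zero_apply, ContinuousLinearMap.coe_snd', PiLp.add_apply,
      PiLp.smul_apply, PiLp.sub_apply, smul_eq_mul, zero_add, Finset.sum_add_distrib]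
    have h4 : ∀ i, (eX i : Spacetime n).2 i = 1 := fun i => by simp [eX]
    simp only [h4, mul_one, Finset.sum_const, Finset.card_univ, Fintype.card_fin, nsmul_eq_mul,
      Finset.mul_sum]
    congr 1
    exact Finset.sum_congr rfl fun i _ => by simp [dX]; ring
  have hcons := fun (s t : ℝ) (hst : s ≤ t) => hU.sliceInt_sub_eq hn hVs
    (hU.continuousOn_virial hφ x₀) hdiv (fun p hp => by simp [hV, edot, h0 p hp]) hst
  have hzero : ∀ s, sliceInt U (fun p => (V p).1) s = 0 := fun s => by simp [sliceInt, hV]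
  simp only [hzero, sub_zero] at hcons
  have hc := hU.continuous_sliceInt hn (hU.continuousOn_virial hφ x₀)
  have h1 : HasDerivAt (fun u => ∫ s in t..u, sliceInt U (virial U φ x₀) s)
      (sliceInt U (virial U φ x₀) t) t :=
    intervalIntegral.integral_hasDerivAt_right (hc.intervalIntegrable _ _)
      hc.stronglyMeasurable.stronglyMeasurableAtFilter hc.continuousAt
  have h2 : (fun u => ∫ s in t..u, sliceInt U (virial U φ x₀) s) = fun _ => 0 := by
    ext u
    rcases le_total t u with h | h
    · exact (hcons t u h).symm
    · rw [intervalIntegral.integral_symm, ← hcons u t h, neg_zero]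
  rw [h2] at h1
  exact h1.unique (hasDerivAt_const t 0)

lemma sum_mul_sq_le (x : EuclideanSpace ℝ (Fin n)) (b : Fin n → ℝ) :
    (∑ i, x i * b i) ^ 2 ≤ ‖x‖ ^ 2 * ∑ i, b i ^ 2 := by
  rw [EuclideanSpace.real_norm_sq_eq]
  exact Finset.sum_mul_sq_le_sq_mul_sq _ _ _

lemma abs_mul_sum_le (a : ℝ) (x : EuclideanSpace ℝ (Fin n)) (b : Fin n → ℝ) :
    |a * ∑ i, x i * b i| ≤ ‖x‖ * ((a ^ 2 + ∑ i, b i ^ 2) / 2) := by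
  have hS : 0 ≤ ∑ i, b i ^ 2 := Finset.sum_nonneg fun i _ => sq_nonneg _
  have h1 : |∑ i, x i * b i| ≤ ‖x‖ * √(∑ i, b i ^ 2) := by
    refine abs_le_of_sq_le_sq ?_ (by positivity)
    rw [mul_pow, Real.sq_sqrt hS]
    exact sum_mul_sq_le x b
  rw [abs_mul]
  calc |a| * |∑ i, x i * b i| ≤ |a| * (‖x‖ * √(∑ i, b i ^ 2)) :=
        mul_le_mul_of_nonneg_left h1 (abs_nonneg _)
    _ = ‖x‖ * (|a| * √(∑ i, b i ^ 2)) := by ring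
    _ ≤ _ := by
      refine mul_le_mul_of_nonneg_left ?_ (norm_nonneg _)
      nlinarith [sq_nonneg (|a| - √(∑ i, b i ^ 2)), sq_abs a, Real.sq_sqrt hS]

lemma energyDensity_nonneg (p : Spacetime n) : 0 ≤ energyDensity U φ p := by
  have : 0 ≤ ∑ i, dX U φ i p ^ 2 := Finset.sum_nonneg fun i _ => sq_nonneg _
  unfold energyDensity
  positivity

lemma sliceInt_energyDensity_nonneg (t : ℝ) : 0 ≤ sliceInt U (energyDensity U φ) t :=
  integral_nonneg fun _ => energyDensity_nonneg _

lemma abs_sum_mul_le {c b : Fin n → ℝ} {M β : ℝ} (hM : 0 ≤ M) (hc : ∀ i, |c i| ≤ M)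
    (hb : ∀ i, |b i| ≤ β) : |∑ i, c i * b i| ≤ n * M * β := by
  refine (Finset.abs_sum_le_sum_abs _ _).trans ?_
  have : ∀ i ∈ Finset.univ, |c i * b i| ≤ M * β := fun i _ => by
    rw [abs_mul]; exact mul_le_mul (hc i) (hb i) (abs_nonneg _) hM
  refine (Finset.sum_le_card_nsmul _ _ _ this).trans ?_
  simp [mul_assoc]

/-- This is the bound that Gronwall needs. Each first derivative of `φ` is at most `√(2e)`, `e`
being the energy density, so every term is at most a multiple of `M e`; the numerical constant is
crude. -/
lemma abs_currentDiv_le {M : ℝ} (hM0 : 0 ≤ M)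
    (hM : ‖fderivWithin ℝ X (closure U) p‖ ≤ M) :
    |currentDiv U φ X 0 p| ≤ M * (1 + 5 * n + 2 * n ^ 2) * energyDensity U φ p := by
  set A := fderivWithin ℝ X (closure U) p with hA
  have heT : ‖(eT : Spacetime n)‖ ≤ 1 := by simp [eT, Prod.norm_def]
  have heX : ∀ i, ‖(eX i : Spacetime n)‖ ≤ 1 := fun i => by simp [eX, Prod.norm_def]
  have hAv : ∀ v : Spacetime n, ‖v‖ ≤ 1 → ‖A v‖ ≤ M := fun v hv =>
    (A.le_opNorm v).trans (by nlinarith [norm_nonneg A, norm_nonneg v])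
  have h1 : ∀ v : Spacetime n, ‖v‖ ≤ 1 → |(A v).1| ≤ M := fun v hv =>
    (norm_fst_le _).trans (hAv v hv)
  have h2 : ∀ v : Spacetime n, ‖v‖ ≤ 1 → ∀ i, |(A v).2 i| ≤ M := fun v hv i =>
    (abs_snd_apply_le _ _).trans (hAv v hv)
  have he0 := energyDensity_nonneg (U := U) (φ := φ) p
  set e := energyDensity U φ p with he
  set a := dT U φ p with ha
  set b : Fin n → ℝ := fun i => dX U φ i p with hb
  have hS : 0 ≤ ∑ i, b i ^ 2 := Finset.sum_nonneg fun i _ => sq_nonneg _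
  have hee : e = (a ^ 2 + ∑ i, b i ^ 2) / 2 := rfl
  set β := √(2 * e) with hβ
  have hβ2 : β * β = 2 * e := Real.mul_self_sqrt (by positivity)
  have hβ0 : 0 ≤ β := Real.sqrt_nonneg _
  have hab : |a| ≤ β := Real.abs_le_sqrt (by rw [hee]; linarith)
  have hbb : ∀ i, |b i| ≤ β := fun i => Real.abs_le_sqrt (by
    have := Finset.single_le_sum (fun j _ => sq_nonneg (b j)) (Finset.mem_univ i)
    rw [hee]; nlinarith [sq_nonneg a])
  have t1 : |(A eT).1 * e| ≤ M * e := by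
    rw [abs_mul, abs_of_nonneg he0]; exact mul_le_mul_of_nonneg_right (h1 _ heT) he0
  have t2 : |a * ∑ i, (A eT).2 i * b i| ≤ 2 * n * M * e := by
    rw [abs_mul]
    have := abs_sum_mul_le hM0 (h2 _ heT) hbb
    calc _ ≤ β * (n * M * β) := mul_le_mul hab this (abs_nonneg _) hβ0
      _ = n * M * (β * β) := by ring
      _ = _ := by rw [hβ2]; ring
  have t3 : |((-a ^ 2 + ∑ i, b i ^ 2) / 2) * ∑ i, (A (eX i)).2 i| ≤ n * M * e := by
    rw [abs_mul]
    have h3 : |(-a ^ 2 + ∑ i, b i ^ 2) / 2| ≤ e := by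
      rw [hee, abs_le]; constructor <;> nlinarith [sq_nonneg a]
    have h4 : |∑ i, (A (eX i)).2 i| ≤ n * M := by
      refine (Finset.abs_sum_le_sum_abs _ _).trans ?_
      refine (Finset.sum_le_card_nsmul _ _ M fun i _ => h2 _ (heX i) i).trans ?_
      simp
    calc _ ≤ e * (n * M) := mul_le_mul h3 h4 (abs_nonneg _) he0
      _ = _ := by ring
  have t4 : |a * ∑ i, (A (eX i)).1 * b i| ≤ 2 * n * M * e := by
    rw [abs_mul]
    have := abs_sum_mul_le hM0 (fun i => h1 _ (heX i)) hbb
    calc _ ≤ β * (n * M * β) := mul_le_mul hab this (abs_nonneg _) hβ0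
      _ = n * M * (β * β) := by ring
      _ = _ := by rw [hβ2]; ring
  have t5 : |∑ i, (∑ j, (A (eX i)).2 j * b j) * b i| ≤ 2 * n ^ 2 * M * e := by
    have := abs_sum_mul_le (c := fun i => ∑ j, (A (eX i)).2 j * b j) (M := n * M * β)
      (by positivity) (fun i => abs_sum_mul_le hM0 (h2 _ (heX i)) hbb) hbb
    calc _ ≤ n * (n * M * β) * β := this
      _ = n ^ 2 * M * (β * β) := by ring
      _ = _ := by rw [hβ2]; ring
  have hD : currentDiv U φ X 0 p = (A eT).1 * e + a * ∑ i, (A eT).2 i * b i +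
      ((-a ^ 2 + ∑ i, b i ^ 2) / 2) * ∑ i, (A (eX i)).2 i - a * ∑ i, (A (eX i)).1 * b i -
      ∑ i, (∑ j, (A (eX i)).2 j * b j) * b i := by
    rw [currentDiv, hee]; simp only [zero_mul, add_zero, sub_zero, ← hA, ← ha, hb]
  rw [hD]
  have := abs_le.1 t1
  have := abs_le.1 t2
  have := abs_le.1 t3
  have := abs_le.1 t4
  have := abs_le.1 t5
  rw [abs_le]
  constructor <;> nlinarith

end Spacetime

/-! ### Flux bound, energy comparison and slice estimates, leading to observability. -/

namespace Spacetime

variable {n : ℕ} {U : Set (Spacetime n)} {φ : Spacetime n → ℝ} {Z : Spacetime n → Spacetime n}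
  {p : Spacetime n}

lemma IsGenerator.edot_euclNormal (hZ : IsGenerator U Z) (hU : IsGTC U) (hp : p ∈ frontier U) :
    edot (Z p) (euclNormal U p) = 0 := by
  obtain ⟨ρ, hρ⟩ := hU.smooth_boundary p hp
  obtain ⟨c, hc, h⟩ := hρ.exists_fderiv_eq_edot
  have h1 := hZ.tangent p hp ρ hρ
  rw [h] at h1
  exact (mul_eq_zero.1 h1).resolve_left hc.ne'

lemma IsGTC.exists_pos_le (hU : IsGTC U) (hn : 1 ≤ n) {G : Spacetime n → ℝ}
    (hG : ContinuousOn G (closure U)) (hpos : ∀ p ∈ closure U, 0 < G p) (a b : ℝ) :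
    ∃ c, 0 < c ∧ ∀ p ∈ closure U, p.1 ∈ Icc a b → c ≤ G p := by
  obtain ⟨c, hc, h⟩ := (hU.isCompact_slab hn a b).exists_forall_le' (a := 0)
    (hG.mono inter_subset_left) fun p hp => hpos p hp.1
  exact ⟨c, hc, fun p hp hpt => h p ⟨hp, hpt⟩⟩

/-- On a slab the boundary is uniformly timelike. -/
lemma IsGTC.exists_le_sqrt_mink (hU : IsGTC U) (hn : 1 ≤ n) (a b : ℝ) :
    ∃ c, 0 < c ∧ ∀ p ∈ frontier U, p.1 ∈ Icc a b →
      c ≤ √(mink (euclNormal U p) (euclNormal U p)) := by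
  obtain ⟨Z, hZ⟩ := hU.generator
  have hZc := hZ.smooth.continuousOn
  obtain ⟨δ, hδ, hδle⟩ := hU.exists_pos_le hn (G := fun p => (Z p).1 ^ 2 - ‖(Z p).2‖ ^ 2)
    (by fun_prop) (fun p hp => by
      have := hZ.timelike p hp
      rw [mink, real_inner_self_eq_norm_sq] at this
      linarith) a b
  obtain ⟨M, hM0, hM⟩ := hU.exists_bound hn hZc.fst a b
  refine ⟨√(δ / (2 * (M + 1) ^ 2)), Real.sqrt_pos.2 (by positivity), fun p hp hpt => ?_⟩
  have hpc := frontier_subset_closure hp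
  have h1 := hZ.edot_euclNormal hU hp
  have h2 := hU.mink_euclNormal_pos hp
  obtain ⟨ρ, hρ⟩ := hU.smooth_boundary p hp
  have h3 := hρ.edot_euclNormal_self
  have h4 := hδle p hpc hpt
  have h5 := hM p hpc hpt
  refine Real.sqrt_le_sqrt ?_
  set ν := euclNormal U p
  rw [edot_self] at h3
  rw [edot] at h1
  rw [mink, real_inner_self_eq_norm_sq] at h2 ⊢
  set z := Z p
  -- Tangency of `Z` gives `z.1 * ν.1 = -⟨z.2, ν.2⟩`, and the uniform timelikeness of `Z` keeps
  -- `ν.1` away from `‖ν.2‖`. The factor 2 in the constant comes from `‖ν.2‖² ≥ 1/2`, as `ν` is a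
  -- spacelike Euclidean unit vector.
  have h6 : (z.1 * ν.1) ^ 2 ≤ ‖z.2‖ ^ 2 * ‖ν.2‖ ^ 2 := by
    have h7 : z.1 * ν.1 = -inner ℝ z.2 ν.2 := by linarith
    rw [h7, neg_sq, ← mul_pow, ← sq_abs]
    exact pow_le_pow_left₀ (abs_nonneg _) (abs_real_inner_le_norm _ _) 2
  have h8 : z.1 ^ 2 ≤ (M + 1) ^ 2 := by
    rw [← sq_abs]
    exact pow_le_pow_left₀ (abs_nonneg _) (by
      rw [Real.norm_eq_abs] at h5; linarith) 2
  have h9 : δ * ‖ν.2‖ ^ 2 ≤ z.1 ^ 2 * (-(ν.1 * ν.1) + ‖ν.2‖ ^ 2) := by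
    nlinarith [mul_le_mul_of_nonneg_right h4 (sq_nonneg ‖ν.2‖)]
  have h10 : z.1 ^ 2 * (-(ν.1 * ν.1) + ‖ν.2‖ ^ 2) ≤ (M + 1) ^ 2 * (-(ν.1 * ν.1) + ‖ν.2‖ ^ 2) :=
    mul_le_mul_of_nonneg_right h8 h2.le
  rw [div_le_iff₀ (by positivity)]
  nlinarith

/-- The flux of the scaling current is controlled on the observation region. -/
lemma IsGTC.exists_scaling_flux_le (hU : IsGTC U) (hn : 1 ≤ n) (P : Spacetime n) (a b : ℝ) :
    ∃ C : ℝ≥0, ∀ φ : Spacetime n → ℝ, ContDiffOn ℝ ∞ φ (closure U) →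
      (∀ p ∈ U, box φ p = 0) → (∀ p ∈ frontier U, φ p = 0) →
      ∀ τm τp, a ≤ τm → τm < τp → τp ≤ b →
        ENNReal.ofReal
          (sliceInt U (fun p => (current U φ (scaling P) ((n - 1) / 2) p).1) τp -
            sliceInt U (fun p => (current U φ (scaling P) ((n - 1) / 2) p).1) τm) ≤
        C * boundaryIntegral U (observationRegion U P τm τp)
          (fun p => normalDeriv U φ p ^ 2) := by
  obtain ⟨C, hC⟩ := hU.exists_slab_bound hn a b
  obtain ⟨c, hc, hcle⟩ := hU.exists_le_sqrt_mink hn a b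
  obtain ⟨M, hM0, hM⟩ := hU.exists_bound hn
    (contDiff_scaling (n := n) P (m := 0)).continuous.continuousOn a b
  -- `M` bounds half the pairing of the scaling field with `ν`; dividing by `c` pays for the density
  -- `√g(ν, ν)` built into `boundaryIntegral`.
  refine ⟨C * (M / c).toNNReal, fun φ hφ hbox h0 τm τp ha hτ hb => ?_⟩
  have hS : ContDiffOn ℝ 1 (scaling P) (closure U) := (contDiff_scaling P).contDiffOn
  have key := hC (current U φ (scaling P) ((n - 1) / 2)) 0 (observationRegion U P τm τp)
    (fun p => (M / c).toNNReal * ENNReal.ofReal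
      (normalDeriv U φ p ^ 2 * √(mink (euclNormal U p) (euclNormal U p)))) τm τp ha hτ hb
    (hU.contDiffOn_current hφ hS _) continuousOn_const
    (fun p hp => by
      rw [hU.diverg_current hφ hS hp (hbox p hp), hU.currentDiv_scaling P (subset_closure hp)]
      rfl)
    (fun p hp hpt => by
      have hpos := hU.mink_euclNormal_pos hp
      have hsq := Real.sqrt_pos.2 hpos
      rw [hU.edot_current hφ h0 hp]
      by_cases hΓ : p ∈ observationRegion U P τm τp
      · rw [indicator_of_mem hΓ]
        rw [← ENNReal.ofReal_coe_nnreal, Real.coe_toNNReal _ (by positivity),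
          ← ENNReal.ofReal_mul (by positivity)]
        refine ENNReal.ofReal_le_ofReal ?_
        have hpab : p.1 ∈ Icc a b := ⟨ha.trans hpt.1.le, hpt.2.le.trans hb⟩
        have h1 := hcle p hp hpab
        have h2 := hM p (frontier_subset_closure hp) hpab
        obtain ⟨ρ, hρ⟩ := hU.smooth_boundary p hp
        have h3 := abs_flip_fst_le_one hρ.edot_euclNormal_self
        have h4 : edot (scaling P p) (euclNormal U p) ≤ 2 * M := by
          have e1 : (scaling P p).1 * (euclNormal U p).1 ≤ M := by
            refine (le_abs_self _).trans ?_
            rw [abs_mul]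
            calc _ ≤ M * 1 := mul_le_mul ((norm_fst_le _).trans h2) h3.1 (abs_nonneg _) hM0
              _ = M := mul_one M
          have e2 : inner ℝ (scaling P p).2 (euclNormal U p).2 ≤ M := by
            refine (real_inner_le_norm _ _).trans ?_
            calc _ ≤ M * 1 := mul_le_mul ((norm_snd_le _).trans h2) h3.2 (norm_nonneg _) hM0
              _ = M := mul_one M
          rw [edot]; linarith
        have h5 : M ≤ M / c * √(mink (euclNormal U p) (euclNormal U p)) := by
          rw [div_mul_eq_mul_div, le_div_iff₀ hc]
          exact mul_le_mul_of_nonneg_left h1 hM0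
        nlinarith [mul_le_mul_of_nonneg_left h4 (sq_nonneg (normalDeriv U φ p)),
          mul_le_mul_of_nonneg_left h5 (sq_nonneg (normalDeriv U φ p))]
      -- Off `Γ_*` the scaling field does not point outward, so the flux has the favourable sign and
      -- is discarded.
      · rw [indicator_of_notMem hΓ, nonpos_iff_eq_zero, ENNReal.ofReal_eq_zero]
        have h1 : ¬ 0 < fderiv ℝ (hyp P) p (minkNormal U p) := fun h => hΓ ⟨hp, hpt.1, hpt.2, h⟩
        rw [fderiv_hyp_minkNormal] at h1
        have h2 : edot (scaling P p) (euclNormal U p) ≤ 0 := by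
          by_contra! h
          exact h1 (by positivity)
        nlinarith [sq_nonneg (normalDeriv U φ p)])
  have hz : ∀ t, sliceInt U (0 : Spacetime n → ℝ) t = 0 := fun t => by simp [sliceInt]
  simp only [hz, intervalIntegral.integral_zero, sub_zero] at key
  refine key.trans (le_of_eq ?_)
  rw [lintegral_const_mul' _ _ ENNReal.coe_ne_top, ← mul_assoc, ENNReal.coe_mul]
  rfl

/-- The energies of a solution on the slices of a slab are comparable. -/
lemma IsGTC.exists_energy_comparison (hU : IsGTC U) (hn : 1 ≤ n) (a b : ℝ) :
    ∃ K : ℝ, 1 ≤ K ∧ ∀ φ : Spacetime n → ℝ, ContDiffOn ℝ ∞ φ (closure U) →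
      (∀ p ∈ U, box φ p = 0) → (∀ p ∈ frontier U, φ p = 0) →
      ∀ τm τp, a ≤ τm → τm ≤ τp → τp ≤ b →
        sliceInt U (energyDensity U φ) τp ≤ K * sliceInt U (energyDensity U φ) τm ∧
        sliceInt U (energyDensity U φ) τm ≤ K * sliceInt U (energyDensity U φ) τp := by
  obtain ⟨Z, hZ⟩ := hU.generator
  have hZ1 : ContDiffOn ℝ 1 Z (closure U) := hZ.smooth.of_le (by norm_cast)
  have hZc := hZ.smooth.continuousOn
  obtain ⟨c, hc, hcle⟩ := hU.exists_pos_le hn (G := fun p => (Z p).1 - ‖(Z p).2‖)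
    (by fun_prop) (fun p hp => by
      have h1 := hZ.timelike p hp
      rw [mink, real_inner_self_eq_norm_sq] at h1
      have h2 := hZ.future p hp
      have h3 := abs_lt_of_sq_lt_sq (a := ‖(Z p).2‖) (b := (Z p).1) (by linarith) h2.le
      rw [abs_norm] at h3
      linarith) a b
  obtain ⟨M, hM0, hM⟩ := hU.exists_bound hn hZc a b
  obtain ⟨N, hN0, hN⟩ := hU.exists_bound hn (hU.contDiffOn_fderivWithin hZ.smooth).continuousOn a b
  set N' : ℝ := N * (1 + 5 * n + 2 * n ^ 2) with hN'
  have hN'0 : 0 ≤ N' := by positivity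
  set k := N' / c with hk
  set K := Real.exp (k * (b - a)) * (2 * M) / c with hK
  refine ⟨max K 1, le_max_right _ _, fun φ hφ hbox h0 τm τp ha hτ hb => ?_⟩
  have hV := hU.contDiffOn_current hφ hZ1 0
  have hVc : ContinuousOn (fun p => (current U φ Z 0 p).1) (closure U) := hV.continuousOn.fst
  have hec := continuousOn_energyDensity hU hφ
  have hDc := hU.continuousOn_currentDiv hφ hZ1 0
  set E := sliceInt U (energyDensity U φ) with hE
  set I := sliceInt U (fun p => (current U φ Z 0 p).1) with hI
  have hE0 : ∀ t, 0 ≤ E t := sliceInt_energyDensity_nonneg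
  -- The density of the current lies between `Z⁰ - |Z'|` and `Z⁰ + |Z'|` times the energy density,
  -- with `Z⁰` and `Z'` the time and space parts of `Z`. The lower factor is at least `c > 0`
  -- because `Z` is timelike and future directed.
  have hpt : ∀ p, |(current U φ Z 0 p).1 - (Z p).1 * energyDensity U φ p| ≤
      ‖(Z p).2‖ * energyDensity U φ p := fun p => by
    have := abs_mul_sum_le (dT U φ p) (Z p).2 (fun i => dX U φ i p)
    convert! this using 2
    simp only [current, energyDensity]; ring
  have hlow : ∀ t ∈ Icc a b, c * E t ≤ I t := fun t ht => by
    rw [hE, ← sliceInt_const_mul]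
    refine hU.sliceInt_mono hn (continuousOn_const.mul hec) hVc fun y hy => ?_
    rw [Pi.mul_apply]
    have h1 := hcle _ (subset_closure hy) ht
    have h2 := (abs_le.1 (hpt (t, y))).1
    nlinarith [mul_le_mul_of_nonneg_right h1 (energyDensity_nonneg (U := U) (φ := φ) (t, y))]
  have hup : ∀ t ∈ Icc a b, I t ≤ 2 * M * E t := fun t ht => by
    rw [hE, ← sliceInt_const_mul]
    refine hU.sliceInt_mono hn hVc (continuousOn_const.mul hec) fun y hy => ?_
    rw [Pi.mul_apply]
    have h1 := hM _ (subset_closure hy) ht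
    have h2 := (abs_le.1 (hpt (t, y))).2
    have he := energyDensity_nonneg (U := U) (φ := φ) (t, y)
    have h3 : (Z (t, y)).1 ≤ M := ((le_abs_self _).trans (norm_fst_le (Z (t, y)))).trans h1
    have h4 : ‖(Z (t, y)).2‖ ≤ M := (norm_snd_le (Z (t, y))).trans h1
    nlinarith [mul_le_mul_of_nonneg_right h3 he, mul_le_mul_of_nonneg_right h4 he]
  have hDb : ∀ t ∈ Icc a b, |sliceInt U (currentDiv U φ Z 0) t| ≤ k * I t := fun t ht => by
    have hb : ∀ y, (t, y) ∈ U → |currentDiv U φ Z 0 (t, y)| ≤ N' * energyDensity U φ (t, y) :=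
      fun y hy => abs_currentDiv_le hN0 (hN _ (subset_closure hy) ht)
    have h1 : |sliceInt U (currentDiv U φ Z 0) t| ≤ N' * E t := by
      rw [abs_le]
      constructor
      · have := hU.sliceInt_mono hn (t := t) (continuousOn_const.mul hec) hDc
          (G₁ := fun p => -N' * energyDensity U φ p)
          fun y hy => by linarith [(abs_le.1 (hb y hy)).1]
        rw [sliceInt_const_mul] at this
        linarith
      · rw [hE, ← sliceInt_const_mul]
        exact hU.sliceInt_mono hn hDc (continuousOn_const.mul hec)
          fun y hy => (abs_le.1 (hb y hy)).2
    refine h1.trans ?_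
    rw [hk, div_mul_eq_mul_div, le_div_iff₀ hc]
    nlinarith [mul_le_mul_of_nonneg_left (hlow t ht) hN'0]
  have htan : ∀ p ∈ frontier U, edot (current U φ Z 0 p) (euclNormal U p) = 0 := fun p hp => by
    have := hU.edot_current (X := Z) (w := 0) hφ h0 hp
    rw [hZ.edot_euclNormal hU hp] at this
    linarith
  have hsub : Icc τm τp ⊆ Icc a b := Icc_subset_Icc ha hb
  obtain ⟨g1, g2⟩ := gronwall_two_sided (hU.continuous_sliceInt hn hDc) hτ
    (fun t ht => hU.sliceInt_sub_eq hn hV hDc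
      (fun p hp => hU.diverg_current hφ hZ1 hp (hbox p hp)) htan ht.1)
    (fun t ht => hDb t (hsub ht))
  have hexp : Real.exp (k * (τp - τm)) ≤ Real.exp (k * (b - a)) :=
    Real.exp_le_exp.2 (mul_le_mul_of_nonneg_left (by linarith) (by positivity))
  have comb : ∀ s t, s ∈ Icc a b → t ∈ Icc a b → I s ≤ Real.exp (k * (τp - τm)) * I t →
      E s ≤ max K 1 * E t := fun s t hs ht h => by
    have h1 : c * E s ≤ Real.exp (k * (b - a)) * (2 * M * E t) :=
      (hlow s hs).trans <| h.trans <| mul_le_mul hexp (hup t ht)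
        ((mul_nonneg hc.le (hE0 t)).trans (hlow t ht)) (Real.exp_pos _).le
    have h2 : E s ≤ K * E t := by
      rw [hK, div_mul_eq_mul_div, le_div_iff₀ hc]; linarith
    exact h2.trans (mul_le_mul_of_nonneg_right (le_max_left _ _) (hE0 t))
  have hm := hsub (left_mem_Icc.2 hτ)
  have hp := hsub (right_mem_Icc.2 hτ)
  exact ⟨comb τp τm hp hm g1, comb τm τp hm hp g2⟩

/-- The density of the scaling current, integrated over a slice, differs from `t - t₀` times the
energy by at most the radius of the slice times the energy. -/
lemma IsGTC.abs_sliceInt_scaling_sub_le (hU : IsGTC U) (hn : 1 ≤ n)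
    (hφ : ContDiffOn ℝ ∞ φ (closure U)) (h0 : ∀ p ∈ frontier U, φ p = 0) (P : Spacetime n)
    {t R : ℝ} (hR0 : 0 < R) (hR : ∀ y, (t, y) ∈ U → ‖y - P.2‖ ≤ R) :
    |sliceInt U (fun p => (current U φ (scaling P) ((n - 1) / 2) p).1) t -
      (t - P.1) * sliceInt U (energyDensity U φ) t| ≤ R * sliceInt U (energyDensity U φ) t := by
  have hec := continuousOn_energyDensity hU hφ
  have hvc := hU.continuousOn_virial hφ P.2
  have hVc : ContinuousOn (fun p => (current U φ (scaling P) ((n - 1) / 2) p).1) (closure U) :=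
    (hU.contDiffOn_current hφ (contDiff_scaling P).contDiffOn _).continuousOn.fst
  set w : ℝ := (n - 1) / 2 with hw
  have hn1 : (1 : ℝ) ≤ n := by exact_mod_cast hn
  have hw0 : 0 ≤ w := by rw [hw]; linarith
  have hwn : w ≤ n := by rw [hw]; linarith
  have hpt : ∀ y, (t, y) ∈ U → |(current U φ (scaling P) w (t, y)).1 -
      (t - P.1) * energyDensity U φ (t, y)| ≤
        R * energyDensity U φ (t, y) + w / (2 * R) * virial U φ P.2 (t, y) := fun y hy => by
    have h1 := sum_mul_sq_le (y - P.2) (fun i => dX U φ i (t, y))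
    have hS : 0 ≤ ∑ i, dX U φ i (t, y) ^ 2 := Finset.sum_nonneg fun i _ => sq_nonneg _
    have h2 : ‖y - P.2‖ ^ 2 ≤ R ^ 2 := pow_le_pow_left₀ (norm_nonneg _) (hR y hy) 2
    have h3 := h1.trans (mul_le_mul_of_nonneg_right h2 hS)
    simp only [PiLp.sub_apply] at h3
    simp only [current, energyDensity, virial, scaling, Prod.fst_sub, Prod.snd_sub,
      PiLp.sub_apply]
    set a := dT U φ (t, y)
    set S := ∑ i, dX U φ i (t, y) ^ 2
    set q := ∑ i, (y i - P.2 i) * dX U φ i (t, y)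
    set f := φ (t, y)
    -- The term `w² f²` is absorbed because `w ≤ n`. What multiplies `w` on the right is the virial
    -- integrand, whose slice integral is zero, so no term in `φ²` survives.
    have h4 : (q + w * f) ^ 2 ≤ R ^ 2 * S + w * (n * f ^ 2 + 2 * f * q) := by
      nlinarith [mul_nonneg (mul_nonneg hw0 (sub_nonneg.2 hwn)) (sq_nonneg f)]
    have h5 : R * ((a ^ 2 + S) / 2) + w / (2 * R) * (n * f ^ 2 + 2 * f * q) =
        (R ^ 2 * a ^ 2 + (R ^ 2 * S + w * (n * f ^ 2 + 2 * f * q))) / (2 * R) := by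
      field_simp
      ring
    rw [h5, le_div_iff₀ (by positivity)]
    have h6 : (t - P.1) * ((a ^ 2 + S) / 2) + a * q + w * (f * a) - (t - P.1) * ((a ^ 2 + S) / 2)
        = a * (q + w * f) := by ring
    rw [h6]
    have h7 : |a * (q + w * f)| * (2 * R) = 2 * (R * |a|) * |q + w * f| := by
      rw [abs_mul]; ring
    rw [h7]
    nlinarith [sq_nonneg (R * |a| - |q + w * f|), sq_abs a, sq_abs (q + w * f)]
  have hv := hU.sliceInt_virial hn hφ h0 P.2 t
  have hcomb : ∀ c₁ c₂, sliceInt U (fun p => c₁ * energyDensity U φ p + c₂ * virial U φ P.2 p) t =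
      c₁ * sliceInt U (energyDensity U φ) t := fun c₁ c₂ => by
    rw [hU.sliceInt_add_mul hn hec hvc, hv, mul_zero, add_zero]
  have hcc : ∀ c₁ c₂ : ℝ, ContinuousOn
      (fun p => c₁ * energyDensity U φ p + c₂ * virial U φ P.2 p) (closure U) := fun c₁ c₂ =>
    (continuousOn_const.mul hec).add (continuousOn_const.mul hvc)
  rw [abs_le]
  constructor
  · have := hU.sliceInt_mono hn (t := t) (hcc (t - P.1 - R) (-(w / (2 * R)))) hVc fun y hy => by
      linarith [(abs_le.1 (hpt y hy)).1]
    rw [hcomb] at this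
    linarith
  · have := hU.sliceInt_mono hn (t := t) hVc (hcc (t - P.1 + R) (w / (2 * R))) fun y hy => by
      linarith [(abs_le.1 (hpt y hy)).2]
    rw [hcomb] at this
    linarith

/-- The Poincaré inequality on slices, as a bound of the full energy. -/
lemma IsGTC.sliceEnergy_le (hU : IsGTC U) (hn : 1 ≤ n) (hφ : ContDiffOn ℝ ∞ φ (closure U))
    (h0 : ∀ p ∈ frontier U, φ p = 0) (x₀ : EuclideanSpace ℝ (Fin n)) {t R : ℝ}
    (hR : ∀ y, (t, y) ∈ U → ‖y - x₀‖ ≤ R) :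
    sliceEnergy U φ t ≤
      ENNReal.ofReal ((2 + 8 * R ^ 2) * sliceInt U (energyDensity U φ) t) := by
  have hec := continuousOn_energyDensity hU hφ
  have hvc := hU.continuousOn_virial hφ x₀
  have hφc := hφ.continuousOn
  have hn1 : (1 : ℝ) ≤ n := by exact_mod_cast hn
  set G : Spacetime n → ℝ := fun p => 2 * energyDensity U φ p + φ p ^ 2 with hG
  have hGc : ContinuousOn G (closure U) := (continuousOn_const.mul hec).add (hφc.pow 2)
  have hG0 : ∀ p, 0 ≤ G p := fun p => by
    have := energyDensity_nonneg (U := U) (φ := φ) p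
    positivity
  have h1 : sliceEnergy U φ t = ENNReal.ofReal (sliceInt U G t) := by
    rw [sliceInt, ofReal_integral_eq_lintegral_ofReal (hU.integrableOn_slice hn hGc t)
      (Eventually.of_forall fun y => hG0 _), sliceEnergy]
    refine setLIntegral_congr_fun (hU.slice_open t).measurableSet fun y hy => ?_
    have hy' : (t, y) ∈ U := hy
    have hnhds : closure U ∈ 𝓝 (t, y) := mem_of_superset (hU.isOpen.mem_nhds hy') subset_closure
    simp only [hG, gradSq, energyDensity, dT, dX, fderivWithin_of_mem_nhds hnhds]
    congr 1
    ring
  rw [h1]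
  refine ENNReal.ofReal_le_ofReal ?_
  -- Adding `2/n` times the virial integrand costs nothing and contributes `2f² + 4f(q/n)`; after
  -- completing the square `(f + 2q/n)²`, the remainder `4(q/n)²` is at most `4R²S`.
  have h2 : sliceInt U (fun p => (2 + 8 * R ^ 2) * energyDensity U φ p +
      (2 / n) * virial U φ x₀ p) t = (2 + 8 * R ^ 2) * sliceInt U (energyDensity U φ) t := by
    rw [hU.sliceInt_add_mul hn hec hvc, hU.sliceInt_virial hn hφ h0 x₀ t, mul_zero, add_zero]
  rw [← h2]
  refine hU.sliceInt_mono hn hGc ((continuousOn_const.mul hec).add (continuousOn_const.mul hvc))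
    fun y hy => ?_
  have h3 := sum_mul_sq_le (y - x₀) (fun i => dX U φ i (t, y))
  have hS : 0 ≤ ∑ i, dX U φ i (t, y) ^ 2 := Finset.sum_nonneg fun i _ => sq_nonneg _
  have h4 : ‖y - x₀‖ ^ 2 ≤ R ^ 2 := pow_le_pow_left₀ (norm_nonneg _) (hR y hy) 2
  have h5 := h3.trans (mul_le_mul_of_nonneg_right h4 hS)
  simp only [PiLp.sub_apply] at h5
  simp only [hG, Pi.add_apply, Pi.mul_apply, energyDensity, virial]
  set a := dT U φ (t, y)
  set S := ∑ i, dX U φ i (t, y) ^ 2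
  set q := ∑ i, (y i - x₀ i) * dX U φ i (t, y)
  set f := φ (t, y)
  have h6 : (2 / n : ℝ) * (n * f ^ 2 + 2 * f * q) = 2 * f ^ 2 + 4 * f * (q / n) := by
    field_simp
    ring
  have h7 : (q / n) ^ 2 ≤ q ^ 2 := by
    rw [div_pow]
    exact div_le_self (sq_nonneg _) (one_le_pow₀ hn1)
  rw [h6]
  nlinarith [sq_nonneg (f + 2 * (q / n)), mul_nonneg (sq_nonneg R) (sq_nonneg a)]

/-- The observability inequality, with a constant that is uniform as long as one of the two gaps
`τ₊ - t₀ - R₊` and `t₀ - τ₋ - R₋` stays away from zero. -/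
lemma IsGTC.exists_observability (hU : IsGTC U) (hn : 1 ≤ n) (t₀ : ℝ)
    (x₀ : EuclideanSpace ℝ (Fin n)) (a b : ℝ) {δ : ℝ} (hδ : 0 < δ) :
    ∃ C : ℝ≥0, ∀ τm τp : ℝ, a ≤ τm → τm < τp → τp ≤ b →
      boundaryRadius U x₀ τp < τp - t₀ → boundaryRadius U x₀ τm < t₀ - τm →
      (δ ≤ τp - t₀ - boundaryRadius U x₀ τp ∨ δ ≤ t₀ - τm - boundaryRadius U x₀ τm) →
      ∀ φ : Spacetime n → ℝ, ContDiffOn ℝ ∞ φ (closure U) →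
        (∀ p ∈ U, box φ p = 0) → (∀ p ∈ frontier U, φ p = 0) → ∀ τ ∈ ({τm, τp} : Set ℝ),
          sliceEnergy U φ τ ≤ C * boundaryIntegral U (observationRegion U (t₀, x₀) τm τp)
            (fun p => normalDeriv U φ p ^ 2) := by
  obtain ⟨C, hC⟩ := hU.exists_scaling_flux_le hn (t₀, x₀) a b
  obtain ⟨K, hK1, hK⟩ := hU.exists_energy_comparison hn a b
  have hK0 : 0 < K := by linarith
  set R : ℝ := boundaryRadius U x₀ a + (b - a) with hR
  -- The larger gap yields `δ / 2` times the energy at one end; the division by `K` carries the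
  -- bound to the other end.
  set m : ℝ := δ / 2 / K with hm
  have hm0 : 0 < m := by positivity
  set L : ℝ := (2 + 8 * R ^ 2) / m with hL
  have hL0 : 0 ≤ L := by positivity
  refine ⟨L.toNNReal * C, fun τm τp ha hτ hb hp hm' hgap φ hφ hbox h0 τ hτmem => ?_⟩
  have hflux := hC φ hφ hbox h0 τm τp ha hτ hb
  obtain ⟨k1, k2⟩ := hK φ hφ hbox h0 τm τp ha hτ.le hb
  have hRp := hU.boundaryRadius_nonneg hn x₀ τp
  have hRm := hU.boundaryRadius_nonneg hn x₀ τm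
  -- The radius used is the mean of `R₊` and `τ₊ - t₀`: it is positive even if `R₊ = 0`, bounds the
  -- slice, and leaves half of the gap. The same is done at `τ₋`.
  have ep := (abs_le.1 (hU.abs_sliceInt_scaling_sub_le hn hφ h0 (t₀, x₀) (t := τp)
    (R := (boundaryRadius U x₀ τp + (τp - t₀)) / 2) (by linarith) fun y hy =>
      (hU.norm_sub_le_boundaryRadius hn (subset_closure hy)).trans (by linarith))).1
  have em := (abs_le.1 (hU.abs_sliceInt_scaling_sub_le hn hφ h0 (t₀, x₀) (t := τm)
    (R := (boundaryRadius U x₀ τm + (t₀ - τm)) / 2) (by linarith) fun y hy =>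
      (hU.norm_sub_le_boundaryRadius hn (subset_closure hy)).trans (by linarith))).2
  have hEp : 0 ≤ sliceInt U (energyDensity U φ) τp := sliceInt_energyDensity_nonneg τp
  have hEm : 0 ≤ sliceInt U (energyDensity U φ) τm := sliceInt_energyDensity_nonneg τm
  set Ep := sliceInt U (energyDensity U φ) τp with hEpd
  set Em := sliceInt U (energyDensity U φ) τm with hEmd
  set I := sliceInt U (fun p => (current U φ (scaling (t₀, x₀)) ((n - 1) / 2) p).1)
  have hsum : (τp - t₀ - boundaryRadius U x₀ τp) / 2 * Ep +
      (t₀ - τm - boundaryRadius U x₀ τm) / 2 * Em ≤ I τp - I τm := by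
    dsimp only at ep em
    linarith
  have hmK : m * K = δ / 2 := by rw [hm]; field_simp
  have hmle : m ≤ δ / 2 := by rw [← hmK]; nlinarith
  have hboth : m * Em ≤ I τp - I τm ∧ m * Ep ≤ I τp - I τm := by
    have q1 : 0 ≤ (τp - t₀ - boundaryRadius U x₀ τp) / 2 * Ep := mul_nonneg (by linarith) hEp
    have q2 : 0 ≤ (t₀ - τm - boundaryRadius U x₀ τm) / 2 * Em := mul_nonneg (by linarith) hEm
    have aux : ∀ E E' g : ℝ, 0 ≤ E → δ ≤ g → E' ≤ K * E → g / 2 * E ≤ I τp - I τm →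
        m * E' ≤ I τp - I τm ∧ m * E ≤ I τp - I τm := by
      intro E E' g hE hg hE' h
      have h1 : δ / 2 * E ≤ I τp - I τm :=
        (mul_le_mul_of_nonneg_right (by linarith) hE).trans h
      refine ⟨?_, (mul_le_mul_of_nonneg_right hmle hE).trans h1⟩
      calc m * E' ≤ m * (K * E) := mul_le_mul_of_nonneg_left hE' hm0.le
        _ = δ / 2 * E := by rw [← hmK]; ring
        _ ≤ _ := h1
    rcases hgap with hg | hg
    · exact aux Ep Em _ hEp hg k2 (by linarith)
    · exact (aux Em Ep _ hEm hg k1 (by linarith)).symm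
  have hτE : m * sliceInt U (energyDensity U φ) τ ≤ I τp - I τm := by
    rcases hτmem with rfl | rfl
    · exact hboth.1
    · exact hboth.2
  have hτab : a ≤ τ ∧ τ ≤ b := by
    rcases hτmem with rfl | rfl
    · exact ⟨ha, hτ.le.trans hb⟩
    · exact ⟨ha.trans hτ.le, hb⟩
  have hRτ : boundaryRadius U x₀ τ ≤ R := by
    have := hU.boundaryRadius_le_add hn x₀ τ a
    rw [abs_sub_comm, abs_of_nonneg (by linarith)] at this
    rw [hR]; linarith
  calc sliceEnergy U φ τ
      ≤ ENNReal.ofReal ((2 + 8 * R ^ 2) * sliceInt U (energyDensity U φ) τ) :=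
        hU.sliceEnergy_le hn hφ h0 x₀ fun y hy =>
          (hU.norm_sub_le_boundaryRadius hn (subset_closure hy)).trans hRτ
    _ ≤ ENNReal.ofReal (L * (I τp - I τm)) := by
        refine ENNReal.ofReal_le_ofReal ?_
        have : (2 + 8 * R ^ 2) * sliceInt U (energyDensity U φ) τ =
            L * (m * sliceInt U (energyDensity U φ) τ) := by
          rw [hL]; field_simp
        rw [this]
        exact mul_le_mul_of_nonneg_left hτE hL0
    _ = L.toNNReal * ENNReal.ofReal (I τp - I τm) := ENNReal.ofReal_mul hL0
    _ ≤ L.toNNReal * (C * _) := mul_le_mul_right hflux _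
    _ = _ := by rw [ENNReal.coe_mul, mul_assoc]

end Spacetime

/-! ### Uniformity of the constant, and the theorem. -/

open Spacetime in
theorem theorem2p14 {n : ℕ} (hn : 1 ≤ n) (U : Set (Spacetime n)) (hU : IsGTC U)
    (t₀ : ℝ) (x₀ : EuclideanSpace ℝ (Fin n)) (T : ℝ) :
    ∃ C : ℝ≥0, 0 < C ∧
      ∀ τm τp : ℝ, τm < τp → τp - τm = T →
        boundaryRadius U x₀ τp + boundaryRadius U x₀ τm < τp - τm →
        τm < t₀ → t₀ < τp →
        boundaryRadius U x₀ τp < τp - t₀ → boundaryRadius U x₀ τm < t₀ - τm →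
        ∀ φ : Spacetime n → ℝ, ContDiffOn ℝ ∞ φ (closure U) →
          (∀ p ∈ U, box φ p = 0) → (∀ p ∈ frontier U, φ p = 0) →
          sliceEnergy U φ τp ≤ C *
              boundaryIntegral U (observationRegion U (t₀, x₀) τm τp)
                (fun p => normalDeriv U φ p ^ 2) ∧
            sliceEnergy U φ τm ≤ C *
              boundaryIntegral U (observationRegion U (t₀, x₀) τm τp)
                (fun p => normalDeriv U φ p ^ 2) := by
  -- One admissible pair of length `T` serves as reference for the constant; if there is none, the
  -- claim is vacuous.
  by_cases hex : ∃ σm σp : ℝ, σp - σm = T ∧ boundaryRadius U x₀ σp < σp - t₀ ∧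
      boundaryRadius U x₀ σm < t₀ - σm
  · obtain ⟨σm, σp, hσ, hσp, hσm⟩ := hex
    -- An interval of length `T` containing `t₀` lies in `[t₀ - T, t₀ + T]`.
    obtain ⟨C, hC⟩ := hU.exists_observability hn t₀ x₀ (t₀ - T) (t₀ + T)
      (δ := min (σp - t₀ - boundaryRadius U x₀ σp) (t₀ - σm - boundaryRadius U x₀ σm))
      (lt_min (by linarith) (by linarith))
    refine ⟨C + 1, by positivity, fun τm τp hτ hT _ hm hp hRp hRm φ hφ hbox h0 => ?_⟩
    have hgap : min (σp - t₀ - boundaryRadius U x₀ σp) (t₀ - σm - boundaryRadius U x₀ σm) ≤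
          τp - t₀ - boundaryRadius U x₀ τp ∨
        min (σp - t₀ - boundaryRadius U x₀ σp) (t₀ - σm - boundaryRadius U x₀ σm) ≤
          t₀ - τm - boundaryRadius U x₀ τm := by
      -- As the lengths agree, `τp` is later than `σp` or `τm` is earlier than `σm`, up to equality.
      -- The radius is 1-Lipschitz, so the corresponding gap has not shrunk.
      rcases le_total σp τp with h | h
      · have := hU.boundaryRadius_le_add hn x₀ τp σp
        rw [abs_sub_comm, abs_of_nonneg (by linarith)] at this
        exact Or.inl ((min_le_left _ _).trans (by linarith))
      · have := hU.boundaryRadius_le_add hn x₀ τm σm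
        rw [abs_of_nonneg (by linarith)] at this
        exact Or.inr ((min_le_right _ _).trans (by linarith))
    have hmain := hC τm τp (by linarith) hτ (by linarith) hRp hRm hgap φ hφ hbox h0
    have hle : (C : ℝ≥0∞) ≤ (C + 1 : ℝ≥0) := by exact_mod_cast le_self_add
    exact ⟨(hmain τp (by simp)).trans (mul_le_mul_left hle _),
      (hmain τm (by simp)).trans (mul_le_mul_left hle _)⟩
  · exact ⟨1, one_pos, fun τm τp _ hT _ _ _ hRp hRm => absurd ⟨τm, τp, hT, hRp, hRm⟩ hex⟩
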